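/- Let $n\ge 1$, let $dv$ be Lebesgue measure on $\mathbb{C}^n$, let $B_1(z)$ be the open Euclidean ball with centre $z$ and radius $1$, and let $Q_r(z)$ be the cube in $\mathbb{C}^n=\mathbb{R}^{2n}$ with centre $z$ and side length $r$. A weight is a non-negative locally integrable function $w$ on $\mathbb{C}^n$, and $w(E):=\int_E w\,dv$. For $1<s<\infty$ and $1/s+1/s'=1$, the class $A_s^{\mathrm{restricted}}$ consists of the weights $w$ with $w>0$ a.e. such that for some $r>0$ $$\sup_{z\in\mathbb{C}^n}\left(\frac{1}{v(Q_r(z))}\int_{Q_r(z)}w\,dv\right)\left(\frac{1}{v(Q_r(z))}\int_{Q_r(z)}w^{-s'/s}\,dv\right)^{s/s'}<\infty,$$ the class $A_1^{\mathrm{restricted}}$ consists of the weights $w$ with $w>0$ a.e. such that for some $r>0$ $$\sup_{z\in\mathbb{C}^n}\frac{\int_{Q_r(z)}w\,dv}{v(Q_r(z))\,\operatorname{ess\,inf}_{Q_r(z)}w}<\infty,$$ and $A_\infty^{\mathrm{restricted}}:=\bigcup_{1\le s<\infty}A_s^{\mathrm{restricted}}$. For $0<p,\alpha<\infty$, the weighted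 Fock space $F^p_{\alpha,w}$ is the space of entire functions $f$ on $\mathbb{C}^n$ with $$\|f\|_{F^p_{\alpha,w}}:=\left(\int_{\mathbb{C}^n}|f(z)|^pe^{-\frac{p\alpha}{2}|z|^2}w(z)\,dv(z)\right)^{1/p}<\infty,$$ with the topology of this (quasi-)norm. For a positive Borel measure $\mu$ on $\mathbb{C}^n$, let $$T^\alpha_\mu f(z):=\int_{\mathbb{C}^n}f(u)e^{\alpha\langle z,u\rangle-\alpha|u|^2}\,d\mu(u),\qquad \langle z,u\rangle=\sum_j z_j\overline{u_j}.$$ We say that $T^\alpha_\mu$ maps $F^p_{\alpha,w}$ into $F^q_{\alpha,w}$ if for every $f\in F^p_{\alpha,w}$ this integral converges absolutely for every $z\in\mathbb{C}^n$ and $T^\alpha_\mu f\in F^q_{\alpha,w}$. In that case it is bounded if $\|T^\alpha_\mu f\|_{F^q_{\alpha,w}}\le K\|f\|_{F^p_{\alpha,w}}$ for all $f\in F^p_{\alpha,w}$ with a finite constant $K$, its norm is $\|T^\alpha_\mu\|:=\sup_{\|f\|_{F^p_{\alpha,w}}\le1}\|T^\alpha_\mu f\|_{F^q_{\alpha,w}}$,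 and it is compact if it maps every bounded set of $F^p_{\alpha,w}$ to a relatively compact set of $F^q_{\alpha,w}$. **Theorem.** Let $0<p,q,\alpha<\infty$ and $w\in A_\infty^{\mathrm{restricted}}$. For a positive Borel measure $\mu$ on $\mathbb{C}^n$ put $$H_\mu(z):=\frac{\mu(B_1(z))}{w(B_1(z))^{\frac1p-\frac1q}}\in[0,\infty],\qquad z\in\mathbb{C}^n.$$ There is a constant $C\in(0,\infty)$, depending only on $n,p,q,\alpha,w$, such that the following holds for every positive Borel measure $\mu$ on $\mathbb{C}^n$. 1. Suppose $p\le q$. (i) $T^\alpha_\mu:F^p_{\alpha,w}\to F^q_{\alpha,w}$ is bounded if and only if $H_\mu$ is bounded on $\mathbb{C}^n$; in that case $$C^{-1}\sup_{z\in\mathbb{C}^n}H_\mu(z)\le\|T^\alpha_\mu\|\le C\sup_{z\in\mathbb{C}^n}H_\mu(z).$$ (ii) If $\mu$ is finite on compact subsets of $\mathbb{C}^n$, then $T^\alpha_\mu:F^p_{\alpha,w}\to F^q_{\alpha,w}$ is compact if and only if $\lim_{|z|\to\infty}H_\mu(z)=0$. 2. Suppose $p>q$. The following are equivalent: (i) $T^\alpha_\mu:F^p_{\alpha,w}\to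 F^q_{\alpha,w}$ is bounded; (ii) $T^\alpha_\mu:F^p_{\alpha,w}\to F^q_{\alpha,w}$ is compact; (iii) $H_\mu\in L^{\frac{pq}{p-q}}(dv)$. In that case $$C^{-1}\|H_\mu\|_{L^{\frac{pq}{p-q}}(dv)}\le\|T^\alpha_\mu\|\le C\|H_\mu\|_{L^{\frac{pq}{p-q}}(dv)}.$$ -/

import Mathlib

open MeasureTheory Filter Topology
open scoped ENNReal NNReal

namespace WeightedFock

/-- The complex Euclidean space `ℂⁿ` with norm `|z|² = ∑ |z_j|²`; its `volume` is Lebesgue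
measure on `ℂⁿ = ℝ²ⁿ`. -/
abbrev Cn (n : ℕ) : Type := EuclideanSpace ℂ (Fin n)

/-- The (closed) cube in `ℂⁿ = ℝ²ⁿ` centred at `z` with side length `r`. -/
def cube {n : ℕ} (z : Cn n) (r : ℝ) : Set (Cn n) :=
  {u | ∀ j, |(u j - z j).re| ≤ r / 2 ∧ |(u j - z j).im| ≤ r / 2}

/-- A weight: a non-negative locally integrable function on `ℂⁿ`. -/
def IsWeight {n : ℕ} (w : Cn n → ℝ) : Prop :=
  (∀ z, 0 ≤ w z) ∧ LocallyIntegrable w volume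

/-- `w(E) = ∫_E w dv`. -/
noncomputable def wMass {n : ℕ} (w : Cn n → ℝ) (E : Set (Cn n)) : ℝ≥0∞ :=
  ∫⁻ z in E, ENNReal.ofReal (w z)

/-- The class `A_1^restricted`. -/
def RestrictedAOne {n : ℕ} (w : Cn n → ℝ) : Prop :=
  IsWeight w ∧ (∀ᵐ z, 0 < w z) ∧ ∃ r : ℝ, 0 < r ∧
    (⨆ z : Cn n, wMass w (cube z r) /
      (volume (cube z r) *
        essInf (fun u => ENNReal.ofReal (w u)) (volume.restrict (cube z r)))) < ∞

/-- The class `A_p^restricted` for `1 < p < ∞`, where `p' = p / (p - 1)`. -/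
def RestrictedAp {n : ℕ} (p : ℝ) (w : Cn n → ℝ) : Prop :=
  IsWeight w ∧ (∀ᵐ z, 0 < w z) ∧ ∃ r : ℝ, 0 < r ∧
    (⨆ z : Cn n, (wMass w (cube z r) / volume (cube z r)) *
      ((∫⁻ u in cube z r, ENNReal.ofReal (w u) ^ (-(p.conjExponent / p))) /
        volume (cube z r)) ^ (p / p.conjExponent)) < ∞

/-- The class `A_∞^restricted`, the union of the classes `A_p^restricted`, `1 ≤ p < ∞`. -/
def RestrictedAInfty {n : ℕ} (w : Cn n → ℝ) : Prop :=
  RestrictedAOne w ∨ ∃ p : ℝ, 1 < p ∧ RestrictedAp p w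

/-- The measure `e^{-(pα/2)|z|²} w(z) dv(z)`. -/
noncomputable def fockMeasure {n : ℕ} (p α : ℝ) (w : Cn n → ℝ) : Measure (Cn n) :=
  volume.withDensity fun z => ENNReal.ofReal (Real.exp (-(p * α / 2) * ‖z‖ ^ 2) * w z)

/-- The (quasi-)norm `(∫ |f(z)|^p e^{-(pα/2)|z|²} w(z) dv(z))^{1/p}`, with values in `[0, ∞]`. -/
noncomputable def fockNorm {n : ℕ} (p α : ℝ) (w : Cn n → ℝ) (f : Cn n → ℂ) : ℝ≥0∞ :=
  (∫⁻ z, ‖f z‖ₑ ^ p ∂(fockMeasure p α w)) ^ (1 / p)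

/-- Membership in the weighted Fock space `F^p_{α,w}`: entire functions of finite (quasi-)norm. -/
def MemFock {n : ℕ} (p α : ℝ) (w : Cn n → ℝ) (f : Cn n → ℂ) : Prop :=
  Differentiable ℂ f ∧ fockNorm p α w f < ∞

/-- The weighted Fock space `F^p_{α,w}`. -/
def Fock (n : ℕ) (p α : ℝ) (w : Cn n → ℝ) : Type :=
  {f : Cn n → ℂ // MemFock p α w f}

theorem fock_triangle {n : ℕ} {p : ℝ} (hp : 0 < p) (α : ℝ) (w : Cn n → ℝ)
    {f g : Cn n → ℂ} (hf : Differentiable ℂ f) (hg : Differentiable ℂ g) :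
    fockNorm p α w (f + g) ^ min 1 p ≤
      fockNorm p α w f ^ min 1 p + fockNorm p α w g ^ min 1 p := by
  have mf : Measurable fun z => ‖f z‖ₑ := hf.continuous.enorm.measurable
  have mg : Measurable fun z => ‖g z‖ₑ := hg.continuous.enorm.measurable
  have h1 : (∫⁻ z, ‖(f + g) z‖ₑ ^ p ∂(fockMeasure p α w)) ≤
      ∫⁻ z, (‖f z‖ₑ + ‖g z‖ₑ) ^ p ∂(fockMeasure p α w) :=
    lintegral_mono fun z => ENNReal.rpow_le_rpow (enorm_add_le _ _) hp.le
  rcases le_total 1 p with h | h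
  · simp only [min_eq_left h, ENNReal.rpow_one, fockNorm]
    refine (ENNReal.rpow_le_rpow h1 (by positivity)).trans ?_
    exact ENNReal.lintegral_Lp_add_le mf.aemeasurable mg.aemeasurable h
  · have key : ∀ φ : Cn n → ℂ, fockNorm p α w φ ^ p =
        ∫⁻ z, ‖φ z‖ₑ ^ p ∂(fockMeasure p α w) := fun φ => by
      rw [fockNorm, ← ENNReal.rpow_mul, one_div_mul_cancel hp.ne', ENNReal.rpow_one]
    rw [min_eq_right h, key, key, key, ← lintegral_add_left (mf.pow_const p)]
    exact h1.trans (lintegral_mono fun z => ENNReal.rpow_add_le_add_rpow _ _ hp.le h)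

/-- `F^p_{α,w}` with its usual topology, given by the distance `‖f - g‖^{min(1,p)}`. -/
noncomputable instance {n : ℕ} {p α : ℝ} {w : Cn n → ℝ} [hp : Fact (0 < p)] :
    PseudoEMetricSpace (Fock n p α w) where
  edist f g := fockNorm p α w (f.1 - g.1) ^ min 1 p
  edist_self f := by
    have h := hp.out
    simp [fockNorm, h]
  edist_comm f g := by
    simp only [fockNorm, Pi.sub_apply, ← edist_eq_enorm_sub, edist_comm]
  edist_triangle f g h := by
    have := fock_triangle hp.out α w (f.2.1.sub g.2.1) (g.2.1.sub h.2.1)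
    rwa [sub_add_sub_cancel] at this

/-- The integrand `f(u) e^{α⟨z,u⟩ - α|u|²}`, where `⟨z,u⟩ = ∑ z_j conj(u_j)`
(`inner ℂ` is conjugate-linear in its first argument). -/
noncomputable def toeplitzIntegrand {n : ℕ} (α : ℝ) (f : Cn n → ℂ) (z u : Cn n) : ℂ :=
  f u * Complex.exp ((α : ℂ) * inner ℂ u z - (α : ℂ) * (‖u‖ : ℂ) ^ 2)

/-- `T^α_μ f(z) = ∫ f(u) e^{α⟨z,u⟩ - α|u|²} dμ(u)`. -/
noncomputable def toeplitz {n : ℕ} (α : ℝ) (μ : Measure (Cn n)) (f : Cn n → ℂ) (z : Cn n) : ℂ :=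
  ∫ u, toeplitzIntegrand α f z u ∂μ

/-- `T^α_μ` is an operator `F^p_{α,w} → F^q_{α,w}`: for every `f` in `F^p_{α,w}` the defining
integral converges absolutely at every point, and `T^α_μ f` belongs to `F^q_{α,w}`. -/
def ToeplitzMaps {n : ℕ} (p q α : ℝ) (w : Cn n → ℝ) (μ : Measure (Cn n)) : Prop :=
  ∀ f : Fock n p α w, (∀ z, Integrable (toeplitzIntegrand α f.1 z) μ) ∧
    MemFock q α w (toeplitz α μ f.1)

/-- `T^α_μ : F^p_{α,w} → F^q_{α,w}` is bounded. -/
def ToeplitzBounded {n : ℕ} (p q α : ℝ) (w : Cn n → ℝ) (μ : Measure (Cn n)) : Prop :=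
  ToeplitzMaps p q α w μ ∧ ∃ C : ℝ≥0, ∀ f : Fock n p α w,
    fockNorm q α w (toeplitz α μ f.1) ≤ C * fockNorm p α w f.1

/-- The operator norm `sup {‖T^α_μ f‖ : ‖f‖ ≤ 1}`. -/
noncomputable def toeplitzNorm {n : ℕ} (p q α : ℝ) (w : Cn n → ℝ) (μ : Measure (Cn n)) : ℝ≥0∞ :=
  ⨆ (f : Fock n p α w) (_ : fockNorm p α w f.1 ≤ 1), fockNorm q α w (toeplitz α μ f.1)

/-- `T^α_μ : F^p_{α,w} → F^q_{α,w}` is compact: it maps bounded sets to relatively compact sets. -/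
def ToeplitzCompact {n : ℕ} (p q α : ℝ) [Fact (0 < q)] (w : Cn n → ℝ)
    (μ : Measure (Cn n)) : Prop :=
  ToeplitzMaps p q α w μ ∧ ∀ S : Set (Fock n p α w),
    (∃ M : ℝ≥0, ∀ f ∈ S, fockNorm p α w f.1 ≤ M) →
      IsCompact (closure {g : Fock n q α w | ∃ f ∈ S, g.1 = toeplitz α μ f.1})

/-- `H_μ(z) = μ(B_1(z)) / w(B_1(z))^{1/p - 1/q}`, with values in `[0, ∞]`. -/
noncomputable def H {n : ℕ} (p q : ℝ) (w : Cn n → ℝ) (μ : Measure (Cn n)) (z : Cn n) : ℝ≥0∞ :=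
  μ (Metric.ball z 1) / wMass w (Metric.ball z 1) ^ (1 / p - 1 / q)

end WeightedFock

namespace WeightedFock

/-! Multiplying `T^α_μ f(z)` by `e^{-α|z|²/2}` and completing the square turns the kernel into
`e^{-α|z-u|²/2}`. So `|T^α_μ f| e^{-α|·|²/2}` is pointwise at most a positive Gaussian operator
applied to `|f| e^{-α|·|²/2}` (`fockAbs_toeplitz_le`). The weight enters mainly through two
consequences of the restricted `A_∞` condition. First, `w(B_1(z))` varies at most exponentially with
`z` (`ExpDoubling`), and Gaussians absorb this growth. Second, the sub-mean value property of
`|f|^{p/s}`, inserted into the `A_s` testing inequality, gives a mean value estimate for `|f|^p`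
with respect to `w dv` (`HasLocalBound`).

Upper bounds. Over the cells of a lattice the `q`-th power of the norm of the image is controlled by
the sum over `k` of `(∫_{B_2(k)} |f|^p e^{-pα|·|²/2} w)^{q/p} (μ(cell_k) w(B_1(k))^{1/q-1/p})^q`
(`lintegral_gaussOp_rpow_le`). For `p ≤ q` one takes out the supremum and uses that `ℓ¹` embeds in
`ℓ^{q/p}`; for `p > q` one uses Hölder's inequality. Bounded overlap of the balls `B_2(k)` gives
back the norm of `f`.

Lower bounds. On the coherent state centred at `x`, the integrand of `T^α_μ` at the point `x` is
positive, so the value there is a Gaussian average of `μ`, which dominates `μ(B_1(x))`. For `p ≤ q`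
one coherent state is enough. For `p > q` lattice sums of coherent states with all choices of signs
are tested. Near each centre only the diagonal term has to be recovered, so flipping one sign
replaces Khinchine's inequality (`enorm_rpow_mul_card_le_sum_signs`); an extremal choice of the
coefficients then gives the `L^{pq/(p-q)}` norm.

Compactness. If the part of `μ` outside a large ball has small norm, it can be ignored. The part
inside the ball depends only on the size of `f` there, where a bounded family of entire functions is
totally bounded (`toeplitzCompact_of_tail`). Conversely, a finite `ε`-net of the image of the unit
ball has little mass near infinity, which forces `H_μ → 0` (`ToeplitzCompact.tendsto_symbol`). For
`p > q`, integrability of `H_μ^{pq/(p-q)}` makes its tails small, so that boundedness already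
implies compactness. -/

/-! ### Sub-mean value properties of powers of entire functions -/

open Real in
/-- The sub-mean value property of `|g|^t` on circles, for an entire function `g`. -/
theorem norm_rpow_le_circleAverage {g : ℂ → ℂ} (hg : Differentiable ℂ g) {t : ℝ} (ht : 0 < t) :
    ‖g 0‖ ^ t ≤ circleAverage (fun z => ‖g z‖ ^ t) 0 1 := by
  by_cases h0 : g 0 = 0
  · rw [h0, norm_zero, Real.zero_rpow ht.ne']
    exact circleAverage_nonneg_of_nonneg fun x _ => by positivity
  have hpos : 0 < ‖g 0‖ := norm_pos_iff.2 h0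
  -- Jensen's inequality is replaced by the tangent line of `log`, as a function of `x ^ t`, at `x =
  -- a`. The normalisation `a = e^{1/t}` makes this line vanish at `x = 0`, so the bound `key` also
  -- holds there under the convention `log 0 = 0`.
  set a : ℝ := exp (1 / t) with ha
  have hapos : 0 < a := exp_pos _
  set l : ℂ := ((a / ‖g 0‖ : ℝ) : ℂ) with hl
  have hlnorm : ‖l‖ = a / ‖g 0‖ := by
    rw [hl, Complex.norm_real, Real.norm_of_nonneg (by positivity)]
  have hl0 : l ≠ 0 := by rw [← norm_pos_iff, hlnorm]; positivity
  have hG : Differentiable ℂ fun z => l * g z := hg.const_mul l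
  have hG0 : ‖l * g 0‖ = a := by rw [norm_mul, hlnorm]; field_simp
  have hana : ∀ s : Set ℂ, AnalyticOnNhd ℂ (fun z => l * g z) s := fun s =>
    (hG.differentiableOn.analyticOnNhd isOpen_univ).mono (Set.subset_univ s)
  have hJ := (hana _).circleAverage_log_norm (c := 0) (R := 1) one_ne_zero
    (mul_ne_zero hl0 h0)
  -- Jensen's formula: an entire function has zeros but no poles, and each zero `u` in the closed
  -- unit disc contributes its multiplicity times `log (1/|u|) ≥ 0`.
  have hJ' : log a ≤ circleAverage (fun z => log ‖l * g z‖) 0 1 := by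
    rw [hJ, hG0]
    have : 0 ≤ ∑ᶠ u, (MeromorphicOn.divisor (fun z => l * g z) (Metric.closedBall 0 |(1 : ℝ)|)) u *
        log (1 * ‖0 - u‖⁻¹) := by
      refine finsum_nonneg fun u => ?_
      by_cases hu : u ∈ Metric.closedBall (0 : ℂ) |(1 : ℝ)|
      · refine mul_nonneg (Int.cast_nonneg ?_) ?_
        · exact MeromorphicOn.AnalyticOnNhd.divisor_nonneg (hana _) u
        · rw [one_mul, zero_sub, norm_neg, log_inv]
          have : ‖u‖ ≤ 1 := by simpa using hu
          exact neg_nonneg.2 (log_nonpos (norm_nonneg _) this)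
      · rw [Function.locallyFinsuppWithin.apply_eq_zero_of_notMem _ hu]; simp
    linarith
  have hloga : log a = 1 / t := log_exp _
  have key : ∀ x : ℝ, 0 ≤ x → log x ≤ (x ^ t / a ^ t - 1) / t + 1 / t := by
    intro x hx
    rcases hx.eq_or_lt with rfl | hx
    · rw [log_zero, zero_rpow ht.ne', zero_div]
      exact le_of_eq (by ring)
    have h := log_le_sub_one_of_pos (x := x ^ t / a ^ t) (by positivity)
    rw [log_div (by positivity) (by positivity), log_rpow hx, log_rpow hapos, hloga] at h
    rw [← hloga, ← sub_le_iff_le_add, le_div_iff₀ ht, hloga]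
    linarith
  have hcont : Continuous fun z => ‖l * g z‖ ^ t :=
    hG.continuous.norm.rpow_const fun _ => Or.inr ht.le
  have hint : CircleIntegrable (fun z => ‖l * g z‖ ^ t) 0 1 := hcont.continuousOn.circleIntegrable'
  have hlogint : CircleIntegrable (fun z => log ‖l * g z‖) 0 1 :=
    MeromorphicOn.circleIntegrable_log_norm (hana _).meromorphicOn
  have heq : ∀ z, ‖l * g z‖ ^ t = (‖l‖ ^ t) * ‖g z‖ ^ t := fun z => by
    rw [norm_mul, mul_rpow (norm_nonneg _) (norm_nonneg _)]
  have hsimp : (fun z => (‖l * g z‖ ^ t / a ^ t - 1) / t + 1 / t) =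
      fun z => ((1 / t) * (a ^ t)⁻¹ * ‖l‖ ^ t) • (‖g z‖ ^ t) := by
    funext z; rw [heq]; simp only [smul_eq_mul]; field_simp; ring
  have hm : circleAverage (fun z => log ‖l * g z‖) 0 1 ≤
      circleAverage (fun z => (‖l * g z‖ ^ t / a ^ t - 1) / t + 1 / t) 0 1 := by
    refine circleAverage_mono hlogint ?_ fun x _ => key _ (norm_nonneg _)
    exact ((((hcont.div_const _).sub continuous_const).div_const _).add
      continuous_const).continuousOn.circleIntegrable'
  rw [hsimp, circleAverage_fun_smul, smul_eq_mul] at hm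
  have h1 : 1 / t ≤ 1 / t * (a ^ t)⁻¹ * ‖l‖ ^ t * circleAverage (fun z => ‖g z‖ ^ t) 0 1 := by
    rw [← hloga] at *; exact hJ'.trans hm
  rw [hlnorm, div_rpow hapos.le hpos.le] at h1
  have h2 : 1 / t * (a ^ t)⁻¹ * (a ^ t / ‖g 0‖ ^ t) * circleAverage (fun z => ‖g z‖ ^ t) 0 1 =
      (1 / t) * (circleAverage (fun z => ‖g z‖ ^ t) 0 1 / ‖g 0‖ ^ t) := by
    field_simp
  rw [h2] at h1
  have h3 : 1 ≤ circleAverage (fun z => ‖g z‖ ^ t) 0 1 / ‖g 0‖ ^ t :=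
    le_of_mul_le_mul_left (by rwa [mul_one]) (by positivity : 0 < 1 / t)
  rwa [le_div_iff₀ (by positivity), one_mul] at h3

theorem enorm_rpow_eq_ofReal {E : Type*} [SeminormedAddCommGroup E] (x : E) {t : ℝ} (ht : 0 ≤ t) :
    ‖x‖ₑ ^ t = ENNReal.ofReal (‖x‖ ^ t) := by
  rw [← ENNReal.ofReal_rpow_of_nonneg (norm_nonneg _) ht, ofReal_norm]

theorem enorm_rpow_le_lintegral_circle {g : ℂ → ℂ} (hg : Differentiable ℂ g) {t : ℝ} (ht : 0 < t) :
    ‖g 0‖ₑ ^ t ≤ ENNReal.ofReal (2 * Real.pi)⁻¹ *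
      ∫⁻ θ in Set.Ioc 0 (2 * Real.pi), ‖g (Circle.exp θ)‖ₑ ^ t := by
  have h := norm_rpow_le_circleAverage hg ht
  have hc : Continuous fun θ : ℝ => ‖g (circleMap 0 1 θ)‖ ^ t :=
    (hg.continuous.comp (continuous_circleMap 0 1)).norm.rpow_const fun _ => Or.inr ht.le
  rw [Real.circleAverage_def, smul_eq_mul, intervalIntegral.integral_of_le (by positivity)] at h
  have := ENNReal.ofReal_le_ofReal h
  rw [← enorm_rpow_eq_ofReal _ ht.le, ENNReal.ofReal_mul (by positivity),
    ofReal_integral_eq_lintegral_ofReal] at this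
  · refine this.trans_eq ?_
    congr 1
    refine lintegral_congr fun θ => ?_
    rw [enorm_rpow_eq_ofReal _ ht.le]
    simp [circleMap, Circle.coe_exp]
  · exact (hc.integrableOn_Icc).mono_set Set.Ioc_subset_Icc_self
  · exact Eventually.of_forall fun _ => by positivity

variable {n : ℕ}

/-- Multiplication by a unimodular scalar is a real linear isometry. This invariance allows the
circle average on each complex line to be integrated over a ball. -/
theorem lintegral_ball_circle_smul (c : Circle) (ρ : ℝ) {φ : Cn n → ℝ≥0∞} :
    ∫⁻ u in Metric.ball 0 ρ, φ ((c : ℂ) • u) = ∫⁻ u in Metric.ball 0 ρ, φ u := by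
  let e : Cn n ≃ₗᵢ[ℝ] Cn n :=
    ⟨DistribMulAction.toLinearEquiv ℝ (Cn n) c, fun x => by
      change ‖(c : ℂ) • x‖ = ‖x‖
      rw [norm_smul, Circle.norm_coe, one_mul]⟩
  have he : ∀ u, e u = (c : ℂ) • u := fun u => rfl
  have hp : (e : Cn n → Cn n) ⁻¹' Metric.ball 0 ρ = Metric.ball 0 ρ := by
    ext u; simp
  have := e.measurePreserving.setLIntegral_comp_preimage_emb
    e.toHomeomorph.measurableEmbedding φ (Metric.ball 0 ρ)
  rw [hp] at this
  exact this

/-- The sub-mean value property of `|g|^t` on balls of `ℂⁿ`, for an entire function `g`. -/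
theorem enorm_rpow_mul_volume_ball_le {g : Cn n → ℂ} (hg : Differentiable ℂ g) {t : ℝ}
    (ht : 0 < t) (z : Cn n) (ρ : ℝ) :
    ‖g z‖ₑ ^ t * volume (Metric.ball z ρ) ≤ ∫⁻ u in Metric.ball z ρ, ‖g u‖ₑ ^ t := by
  have hshift : ∀ φ : Cn n → ℝ≥0∞, ∫⁻ u in Metric.ball z ρ, φ u =
      ∫⁻ u in Metric.ball 0 ρ, φ (z + u) := fun φ => by
    have := (measurePreserving_add_left (volume : Measure (Cn n)) z).setLIntegral_comp_preimage_emb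
      (Homeomorph.addLeft z).measurableEmbedding φ (Metric.ball z ρ)
    rw [← this]; congr 2; ext u; simp
  have hvol : volume (Metric.ball z ρ) = volume (Metric.ball (0 : Cn n) ρ) :=
    Measure.addHaar_ball_center _ _ _
  have hmeas : Measurable fun q : Cn n × ℝ => ‖g (z + (Circle.exp q.2 : ℂ) • q.1)‖ₑ ^ t := by
    have : Continuous fun q : Cn n × ℝ => g (z + (Circle.exp q.2 : ℂ) • q.1) := by
      simp only [Circle.coe_exp]
      exact hg.continuous.comp (by fun_prop)
    exact this.enorm.measurable.pow_const t
  calc ‖g z‖ₑ ^ t * volume (Metric.ball z ρ)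
      = ∫⁻ u in Metric.ball (0 : Cn n) ρ, ‖g z‖ₑ ^ t := by rw [setLIntegral_const, hvol]
    _ ≤ ∫⁻ u in Metric.ball (0 : Cn n) ρ, ENNReal.ofReal (2 * Real.pi)⁻¹ *
        ∫⁻ θ in Set.Ioc 0 (2 * Real.pi), ‖g (z + (Circle.exp θ : ℂ) • u)‖ₑ ^ t := by
        -- The one-variable inequality on the complex line `ζ ↦ z + ζ u`; Fubini and rotation
        -- invariance then remove the average over the angle.
        refine lintegral_mono fun u => ?_
        have := enorm_rpow_le_lintegral_circle (g := fun ζ : ℂ => g (z + ζ • u))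
          (hg.comp ((differentiable_const _).add (differentiable_id.smul_const u))) ht
        simpa using this
    _ = ENNReal.ofReal (2 * Real.pi)⁻¹ * ∫⁻ θ in Set.Ioc 0 (2 * Real.pi),
        ∫⁻ u in Metric.ball (0 : Cn n) ρ, ‖g (z + (Circle.exp θ : ℂ) • u)‖ₑ ^ t := by
        rw [lintegral_const_mul, lintegral_lintegral_swap hmeas.aemeasurable]
        exact hmeas.lintegral_prod_right'
    _ = ENNReal.ofReal (2 * Real.pi)⁻¹ * ∫⁻ θ in Set.Ioc 0 (2 * Real.pi),
        ∫⁻ u in Metric.ball z ρ, ‖g u‖ₑ ^ t := by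
        congr 1
        refine lintegral_congr fun θ => ?_
        rw [hshift, lintegral_ball_circle_smul (Circle.exp θ) ρ (φ := fun u => ‖g (z + u)‖ₑ ^ t)]
    _ = ∫⁻ u in Metric.ball z ρ, ‖g u‖ₑ ^ t := by
        rw [setLIntegral_const, Real.volume_Ioc, sub_zero, mul_comm, mul_assoc,
          ← ENNReal.ofReal_mul (by positivity), mul_inv_cancel₀ (by positivity), ENNReal.ofReal_one,
          mul_one]

/-- The function `|f(z)| e^{-α|z|²/2}`. -/
noncomputable def fockAbs (α : ℝ) (f : Cn n → ℂ) (z : Cn n) : ℝ≥0∞ :=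
  ‖f z‖ₑ * ENNReal.ofReal (Real.exp (-(α / 2) * ‖z‖ ^ 2))

theorem measurable_fockAbs (α : ℝ) {f : Cn n → ℂ} (hf : Continuous f) :
    Measurable (fockAbs α f) := by
  unfold fockAbs
  have : Continuous fun z : Cn n => Real.exp (-(α / 2) * ‖z‖ ^ 2) := by fun_prop
  exact hf.enorm.measurable.mul this.measurable.ennreal_ofReal

/-- Multiplication by the zero-free entire function `u ↦ e^{-α⟨u,z⟩ + α|z|²/2}` moves the centre of
the Gaussian from `0` to `z`. Near `z` the Gaussian factor is then bounded below, uniformly in `z`.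
-/
theorem exists_fockAbs_translate (α : ℝ) {f : Cn n → ℂ} (hf : Differentiable ℂ f) (z : Cn n) :
    ∃ g : Cn n → ℂ, Differentiable ℂ g ∧ ∀ u, fockAbs α f u =
      ‖g u‖ₑ * ENNReal.ofReal (Real.exp (-(α / 2) * ‖u - z‖ ^ 2)) := by
  refine ⟨fun u => f u * Complex.exp (-(α : ℂ) * inner ℂ z u + ((α / 2 * ‖z‖ ^ 2 : ℝ) : ℂ)), ?_, ?_⟩
  · refine hf.mul (Differentiable.cexp (Differentiable.add_const _ ?_))
    exact (differentiable_const _).mul ((innerSL ℂ z).differentiable)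
  · intro u
    rw [fockAbs, enorm_mul, mul_assoc]
    congr 1
    rw [← ofReal_norm, Complex.norm_exp, ← ENNReal.ofReal_mul (Real.exp_nonneg _), ← Real.exp_add]
    congr 2
    have h : ‖u - z‖ ^ 2 = ‖u‖ ^ 2 - 2 * (inner ℂ u z).re + ‖z‖ ^ 2 :=
      norm_sub_sq (𝕜 := ℂ) u z
    have h2 : (inner ℂ u z : ℂ).re = (inner ℂ z u : ℂ).re := by
      rw [← inner_conj_symm, Complex.conj_re]
    have h3 : (-(α : ℂ) * inner ℂ z u + ((α / 2 * ‖z‖ ^ 2 : ℝ) : ℂ)).re =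
        -α * (inner ℂ z u : ℂ).re + α / 2 * ‖z‖ ^ 2 := by
      rw [Complex.add_re, Complex.ofReal_re, ← Complex.ofReal_neg, Complex.re_ofReal_mul]
    rw [h, h2, h3]
    ring

/-- Local mean value estimate for `|f| e^{-α|·|²/2}`. -/
theorem fockAbs_rpow_mul_volume_ball_le {α : ℝ} (hα : 0 < α) {f : Cn n → ℂ}
    (hf : Differentiable ℂ f) {t : ℝ} (ht : 0 < t) (z : Cn n) {ρ : ℝ} (hρ : ρ ≤ 1) :
    fockAbs α f z ^ t * volume (Metric.ball z ρ) ≤ ENNReal.ofReal (Real.exp (t * α / 2)) *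
      ∫⁻ u in Metric.ball z ρ, fockAbs α f u ^ t := by
  obtain ⟨g, hg, h⟩ := exists_fockAbs_translate α hf z
  have hz : fockAbs α f z = ‖g z‖ₑ := by rw [h]; simp
  rw [hz, ← lintegral_const_mul' _ _ ENNReal.ofReal_ne_top]
  refine (enorm_rpow_mul_volume_ball_le hg ht z ρ).trans ?_
  refine setLIntegral_mono' measurableSet_ball fun u hu => ?_
  have hu' : ‖u - z‖ < 1 := (mem_ball_iff_norm.1 hu).trans_le hρ
  rw [h, ENNReal.mul_rpow_of_nonneg _ _ ht.le, mul_left_comm]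
  refine le_mul_of_one_le_right' ?_
  rw [ENNReal.ofReal_rpow_of_nonneg (Real.exp_nonneg _) ht.le, ← Real.exp_mul,
    ← ENNReal.ofReal_mul (Real.exp_nonneg _), ← Real.exp_add, ENNReal.one_le_ofReal,
    Real.one_le_exp_iff]
  have : ‖u - z‖ ^ 2 ≤ 1 := by nlinarith [norm_nonneg (u - z)]
  nlinarith [mul_pos ht hα]

/-! ### Consequences of the restricted `A_∞` condition -/

/-- The measure `w dv`. -/
noncomputable def weightMeasure (w : Cn n → ℝ) : Measure (Cn n) :=
  volume.withDensity fun z => ENNReal.ofReal (w z)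

/-- Unit balls have positive finite measure, and comparable measure up to a factor exponential in
the distance of the centres. -/
structure ExpDoubling (ν : Measure (Cn n)) : Prop where
  ne_zero : ∀ z, ν (Metric.ball z 1) ≠ 0
  ne_top : ∀ z, ν (Metric.ball z 1) ≠ ∞
  growth : ∃ C c : ℝ, 0 < C ∧ 0 < c ∧ ∀ z z',
    ν (Metric.ball z 1) ≤ ENNReal.ofReal (C * Real.exp (c * dist z z')) * ν (Metric.ball z' 1)

/-- The weighted local mean value estimate for `|f| e^{-α|·|²/2}`. -/
def HasLocalBound (α p : ℝ) (ν : Measure (Cn n)) : Prop :=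
  ∃ C : ℝ≥0, ∀ f : Cn n → ℂ, Differentiable ℂ f → ∀ z,
    fockAbs α f z ^ p * ν (Metric.ball z 1) ≤ C * ∫⁻ u in Metric.ball z 1, fockAbs α f u ^ p ∂ν

/-- The testing form of the `A_s` condition on cubes of side length `r`. -/
def LocalAs (s r : ℝ) (ν : Measure (Cn n)) : Prop :=
  ∃ A : ℝ≥0, ∀ z : Cn n, ∀ φ : Cn n → ℝ≥0∞, Measurable φ →
    (∫⁻ u in cube z r, φ u) ^ s * ν (cube z r) ≤ A * ∫⁻ u in cube z r, φ u ^ s ∂ν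

theorem isClosed_cube (z : Cn n) (r : ℝ) : IsClosed (cube z r) := by
  have : cube z r = ⋂ j, ({u : Cn n | |(u j - z j).re| ≤ r / 2} ∩
      {u : Cn n | |(u j - z j).im| ≤ r / 2}) := by
    ext u; simp [cube]
  rw [this]
  refine isClosed_iInter fun j => IsClosed.inter ?_ ?_
  · exact isClosed_le (by fun_prop) continuous_const
  · exact isClosed_le (by fun_prop) continuous_const

theorem closedBall_subset_cube (z : Cn n) (r : ℝ) : Metric.closedBall z (r / 2) ⊆ cube z r := by
  intro u hu j
  have h1 : ‖u j - z j‖ ≤ r / 2 :=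
    (PiLp.norm_apply_le (u - z) j).trans (mem_closedBall_iff_norm.1 hu)
  exact ⟨(Complex.abs_re_le_norm _).trans h1, (Complex.abs_im_le_norm _).trans h1⟩

theorem cube_subset_closedBall (z : Cn n) (r : ℝ) :
    cube z r ⊆ Metric.closedBall z (√(n * r ^ 2)) := by
  intro u hu
  rw [mem_closedBall_iff_norm, EuclideanSpace.norm_eq]
  refine Real.sqrt_le_sqrt ?_
  have : ∀ j ∈ Finset.univ, ‖(u - z) j‖ ^ 2 ≤ r ^ 2 := fun j _ => by
    obtain ⟨h1, h2⟩ := hu j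
    have := Complex.norm_le_abs_re_add_abs_im ((u - z) j)
    simp only [PiLp.sub_apply] at *
    have h3 : ‖u j - z j‖ ≤ r := by linarith
    exact pow_le_pow_left₀ (norm_nonneg _) h3 2
  refine (Finset.sum_le_sum this).trans_eq ?_
  simp

theorem volume_cube (z : Cn n) (r : ℝ) : volume (cube z r) = volume (cube (0 : Cn n) r) := by
  have : (fun u => u - z) ⁻¹' cube (0 : Cn n) r = cube z r := by
    ext u; simp [cube]
  rw [← this]
  exact (measurePreserving_sub_right volume z).measure_preimage
    (isClosed_cube 0 r).measurableSet.nullMeasurableSet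

theorem volume_cube_ne_top (z : Cn n) (r : ℝ) : volume (cube z r) ≠ ∞ :=
  ((measure_mono (cube_subset_closedBall z r)).trans_lt measure_closedBall_lt_top).ne

theorem volume_cube_ne_zero (z : Cn n) {r : ℝ} (hr : 0 < r) : volume (cube z r) ≠ 0 :=
  ((Metric.measure_closedBall_pos volume z (half_pos hr)).trans_le
    (measure_mono (closedBall_subset_cube z r))).ne'

theorem IsWeight.aemeasurable {w : Cn n → ℝ} (hw : IsWeight w) :
    AEMeasurable (fun z => ENNReal.ofReal (w z)) volume :=
  hw.2.aestronglyMeasurable.aemeasurable.ennreal_ofReal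

theorem weightMeasure_apply (w : Cn n → ℝ) {E : Set (Cn n)} (hE : MeasurableSet E) :
    weightMeasure w E = wMass w E :=
  withDensity_apply _ hE

theorem setLIntegral_weightMeasure {w : Cn n → ℝ} (hw : IsWeight w) {E : Set (Cn n)}
    (hE : MeasurableSet E) {φ : Cn n → ℝ≥0∞} (hφ : Measurable φ) :
    ∫⁻ u in E, φ u ∂(weightMeasure w) = ∫⁻ u in E, φ u * ENNReal.ofReal (w u) := by
  rw [weightMeasure, restrict_withDensity hE,
    lintegral_withDensity_eq_lintegral_mul₀ hw.aemeasurable.restrict hφ.aemeasurable]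
  simp_rw [Pi.mul_apply, mul_comm]

theorem IsWeight.ne_top_of_isBounded {w : Cn n → ℝ} (hw : IsWeight w) {E : Set (Cn n)}
    (hE : Bornology.IsBounded E) : weightMeasure w E ≠ ∞ := by
  have h := hw.2.integrableOn_isCompact hE.isCompact_closure
  refine ((measure_mono subset_closure).trans_lt ?_).ne
  rw [weightMeasure_apply w isClosed_closure.measurableSet]
  refine lt_of_le_of_lt ?_ h.2
  exact lintegral_mono fun u => by
    rw [← ofReal_norm]; exact ENNReal.ofReal_le_ofReal (le_abs_self _)

theorem weightMeasure_ne_zero {w : Cn n → ℝ} (hw : IsWeight w) (hpos : ∀ᵐ z, 0 < w z)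
    {E : Set (Cn n)} (hE : MeasurableSet E) (h : volume E ≠ 0) : weightMeasure w E ≠ 0 := by
  rw [weightMeasure_apply w hE, wMass, Ne, lintegral_eq_zero_iff' hw.aemeasurable.restrict]
  intro h0
  apply h
  have h1 := ae_restrict_of_ae (s := E) hpos
  rw [← Measure.restrict_eq_zero, ← ae_eq_bot, ← empty_mem_iff_bot]
  filter_upwards [h0, h1] with u hu hu'
  simp at hu
  linarith

/-- On the cube `w` is almost everywhere at least its essential infimum, and `A_1` bounds the mean
of `w` by a multiple of that infimum. -/
theorem RestrictedAOne.localAs {w : Cn n → ℝ} (hw : RestrictedAOne w) :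
    ∃ r, 0 < r ∧ LocalAs 1 r (weightMeasure w) := by
  obtain ⟨hw, hpos, r, hr, hM⟩ := hw
  refine ⟨r, hr, ?_⟩
  set M := ⨆ z : Cn n, wMass w (cube z r) / (volume (cube z r) *
        essInf (fun u => ENNReal.ofReal (w u)) (volume.restrict (cube z r))) with hMdef
  -- `M + 1` is nonzero as well as finite, so clearing the denominator in `h1` needs no information
  -- on the essential infimum, which could a priori be infinite.
  have hMt : (M + 1) * volume (cube (0 : Cn n) r) ≠ ∞ :=
    ENNReal.mul_ne_top (by simp [hM.ne]) (volume_cube_ne_top 0 r)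
  refine ⟨((M + 1) * volume (cube (0 : Cn n) r)).toNNReal, fun z φ hφ => ?_⟩
  rw [ENNReal.coe_toNNReal hMt, ENNReal.rpow_one]
  simp_rw [ENNReal.rpow_one]
  have hQ := (isClosed_cube z r).measurableSet
  set e := essInf (fun u => ENNReal.ofReal (w u)) (volume.restrict (cube z r)) with he
  have h1 : wMass w (cube z r) ≤ (M + 1) * (volume (cube z r) * e) := by
    rw [← ENNReal.div_le_iff_le_mul (Or.inr (by simp [hM.ne])) (Or.inr (by simp))]
    exact (le_iSup (fun z : Cn n => wMass w (cube z r) / (volume (cube z r) *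
        essInf (fun u => ENNReal.ofReal (w u)) (volume.restrict (cube z r)))) z).trans le_self_add
  rw [weightMeasure_apply w hQ, setLIntegral_weightMeasure hw hQ hφ]
  calc (∫⁻ u in cube z r, φ u) * wMass w (cube z r)
      ≤ (∫⁻ u in cube z r, φ u) * ((M + 1) * (volume (cube z r) * e)) := by gcongr
    _ = (M + 1) * volume (cube (0 : Cn n) r) * ((∫⁻ u in cube z r, φ u) * e) := by
        rw [volume_cube z]; ring
    _ = (M + 1) * volume (cube (0 : Cn n) r) * ∫⁻ u in cube z r, φ u * e := by
        rw [lintegral_mul_const _ hφ]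
    _ ≤ _ := by
        refine mul_le_mul' le_rfl (lintegral_mono_ae ?_)
        filter_upwards [ae_essInf_le (f := fun u => ENNReal.ofReal (w u))
          (μ := volume.restrict (cube z r))] with u hu
        gcongr

/-- Hölder's inequality for `φ = (φ w^{1/p}) · w^{-1/p}`: the second factor produces the dual
average in the `A_p` condition. Positivity of `w` almost everywhere justifies the splitting. -/
theorem RestrictedAp.localAs {p : ℝ} (hp : 1 < p) {w : Cn n → ℝ} (hw : RestrictedAp p w) :
    ∃ r, 0 < r ∧ LocalAs p r (weightMeasure w) := by
  obtain ⟨hw, hpos, r, hr, hM⟩ := hw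
  refine ⟨r, hr, ?_⟩
  have hpq : p.HolderConjugate p.conjExponent := Real.HolderConjugate.conjExponent hp
  set q := p.conjExponent with hq
  have hp0 : 0 < p := hpq.pos
  have hq0 : 0 < q := hpq.symm.pos
  set M := (⨆ z : Cn n, (wMass w (cube z r) / volume (cube z r)) *
      ((∫⁻ u in cube z r, ENNReal.ofReal (w u) ^ (-(q / p))) /
        volume (cube z r)) ^ (p / q)) with hMdef
  set v := volume (cube (0 : Cn n) r) with hv
  have hv0 : v ≠ 0 := volume_cube_ne_zero 0 hr
  have hvt : v ≠ ∞ := volume_cube_ne_top 0 r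
  have hMt : M * (v * v ^ (p / q)) ≠ ∞ :=
    ENNReal.mul_ne_top hM.ne (ENNReal.mul_ne_top hvt
      (ENNReal.rpow_ne_top_of_nonneg (by positivity) hvt))
  refine ⟨(M * (v * v ^ (p / q))).toNNReal, fun z φ hφ => ?_⟩
  rw [ENNReal.coe_toNNReal hMt]
  have hQ := (isClosed_cube z r).measurableSet
  set S := ∫⁻ u in cube z r, ENNReal.ofReal (w u) ^ (-(q / p)) with hS
  have h1 : wMass w (cube z r) * S ^ (p / q) ≤ M * (v * v ^ (p / q)) := by
    have h := le_iSup (fun z : Cn n => (wMass w (cube z r) / volume (cube z r)) *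
      ((∫⁻ u in cube z r, ENNReal.ofReal (w u) ^ (-(q / p))) /
        volume (cube z r)) ^ (p / q)) z
    simp only [volume_cube z, ← hv, ← hMdef, ← hS] at h
    rw [ENNReal.div_rpow_of_nonneg _ _ (by positivity)] at h
    have hvv : v ^ (p / q) ≠ 0 := by simp [hv0, hvt]
    have hvv' : v ^ (p / q) ≠ ∞ := ENNReal.rpow_ne_top_of_nonneg (by positivity) hvt
    calc wMass w (cube z r) * S ^ (p / q)
        = (wMass w (cube z r) / v * (S ^ (p / q) / v ^ (p / q))) * (v * v ^ (p / q)) := by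
          rw [mul_mul_mul_comm, ENNReal.div_mul_cancel hv0 hvt, ENNReal.div_mul_cancel hvv hvv']
      _ ≤ _ := by gcongr
  have h2 : ∫⁻ u in cube z r, φ u ≤
      (∫⁻ u in cube z r, φ u ^ p ∂(weightMeasure w)) ^ (1 / p) * S ^ (1 / q) := by
    have hm : AEMeasurable (fun u => ENNReal.ofReal (w u)) (volume.restrict (cube z r)) :=
      hw.aemeasurable.restrict
    have := ENNReal.lintegral_mul_le_Lp_mul_Lq (volume.restrict (cube z r)) hpq
      (f := fun u => φ u * ENNReal.ofReal (w u) ^ (1 / p))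
      (g := fun u => ENNReal.ofReal (w u) ^ (-(1 / p)))
      (hφ.aemeasurable.mul (hm.pow_const _)) (hm.pow_const _)
    rw [setLIntegral_weightMeasure hw hQ (hφ.pow_const p)]
    convert this using 1
    · refine lintegral_congr_ae ?_
      filter_upwards [ae_restrict_of_ae hpos] with u hu
      have hu' : ENNReal.ofReal (w u) ≠ 0 := by simpa using hu
      simp only [Pi.mul_apply]
      rw [mul_assoc, ← ENNReal.rpow_add _ _ hu' ENNReal.ofReal_ne_top]
      simp
    · congr 2
      · refine lintegral_congr fun u => ?_
        rw [ENNReal.mul_rpow_of_nonneg _ _ hp0.le, ← ENNReal.rpow_mul, one_div_mul_cancel hp0.ne',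
          ENNReal.rpow_one]
      · refine lintegral_congr fun u => ?_
        rw [← ENNReal.rpow_mul]
        congr 1; field_simp
  have h3 : (∫⁻ u in cube z r, φ u) ^ p ≤
      (∫⁻ u in cube z r, φ u ^ p ∂(weightMeasure w)) * S ^ (p / q) := by
    refine (ENNReal.rpow_le_rpow h2 hp0.le).trans_eq ?_
    rw [ENNReal.mul_rpow_of_nonneg _ _ hp0.le, ← ENNReal.rpow_mul, one_div_mul_cancel hp0.ne',
      ENNReal.rpow_one, ← ENNReal.rpow_mul, one_div_mul_eq_div]
  rw [weightMeasure_apply w hQ]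
  calc (∫⁻ u in cube z r, φ u) ^ p * wMass w (cube z r)
      ≤ (∫⁻ u in cube z r, φ u ^ p ∂(weightMeasure w)) * S ^ (p / q) * wMass w (cube z r) := by
        gcongr
    _ = (wMass w (cube z r) * S ^ (p / q)) * ∫⁻ u in cube z r, φ u ^ p ∂(weightMeasure w) := by ring
    _ ≤ _ := by gcongr

theorem RestrictedAInfty.exists_localAs {w : Cn n → ℝ} (hw : RestrictedAInfty w) :
    IsWeight w ∧ (∀ᵐ z, 0 < w z) ∧ ∃ s r, 1 ≤ s ∧ 0 < r ∧ LocalAs s r (weightMeasure w) := by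
  rcases hw with hw | ⟨p, hp, hw⟩
  · obtain ⟨r, hr, h⟩ := hw.localAs
    exact ⟨hw.1, hw.2.1, 1, r, le_rfl, hr, h⟩
  · obtain ⟨r, hr, h⟩ := hw.localAs hp
    exact ⟨hw.1, hw.2.1, p, r, hp.le, hr, h⟩

/-- A chain of `m` steps of length at most `ρ` along the segment from `z` to `z'`, each costing a
factor `K`. -/
theorem le_pow_mul_of_dist_le {V : Cn n → ℝ≥0∞} {K : ℝ≥0∞} {ρ : ℝ} (hρ : 0 < ρ)
    (h : ∀ z z', dist z z' ≤ ρ → V z ≤ K * V z') (m : ℕ) :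
    ∀ z z', dist z z' ≤ m * ρ → V z ≤ K ^ m * V z' := by
  induction m with
  | zero =>
    intro z z' hz
    have : z = z' := dist_le_zero.1 (by simpa using hz)
    simp [this]
  | succ m ih =>
    intro z z' hz
    obtain ⟨y, hy1, hy2⟩ := exists_dist_le_le (x := z) (z := z') hρ.le
      (by positivity : (0 : ℝ) ≤ m * ρ) (by push_cast at hz; linarith)
    calc V z ≤ K * V y := h _ _ hy1
      _ ≤ K * (K ^ m * V z') := by gcongr; exact ih _ _ hy2
      _ = _ := by ring

/-- The testing inequality is applied to the indicator of a small ball. Since `2ρ ≤ r/2`, the ball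
about `z'` still lies in the cube about `z`, and its Lebesgue measure does not depend on `z'`. -/
theorem LocalAs.measure_cube_le {s r : ℝ} (hs : 1 ≤ s) {ν : Measure (Cn n)}
    (h : LocalAs s r ν) {ρ : ℝ} (hρ : 0 < ρ) (hρr : ρ ≤ r / 4) :
    ∃ K : ℝ≥0, 1 ≤ K ∧ ∀ z z', dist z z' ≤ ρ → ν (cube z r) ≤ K * ν (Metric.ball z' ρ) := by
  obtain ⟨A, hA⟩ := h
  set b := volume (Metric.ball (0 : Cn n) ρ) ^ s with hb
  have hb0 : b ≠ 0 := by
    have := (Metric.measure_ball_pos volume (0 : Cn n) hρ).ne'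
    simp only [hb, Ne, ENNReal.rpow_eq_zero_iff, not_or, not_and]
    exact ⟨fun h => absurd h this, fun h => absurd h measure_ball_lt_top.ne⟩
  have hbt : b ≠ ∞ := ENNReal.rpow_ne_top_of_nonneg (by positivity) measure_ball_lt_top.ne
  refine ⟨(A / b).toNNReal + 1, by simp, fun z z' hz => ?_⟩
  have hsub : Metric.ball z' ρ ⊆ cube z r := by
    refine Set.Subset.trans (fun u hu => ?_) (closedBall_subset_cube z r)
    rw [Metric.mem_closedBall]
    have := dist_triangle u z' z
    rw [dist_comm z' z] at this
    have h2 := Metric.mem_ball.1 hu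
    linarith
  have key := hA z ((Metric.ball z' ρ).indicator 1) (measurable_one.indicator measurableSet_ball)
  rw [lintegral_indicator_one measurableSet_ball, Measure.restrict_apply measurableSet_ball,
    Set.inter_eq_left.2 hsub, Measure.addHaar_ball_center, ← hb] at key
  have h2 : ∫⁻ u in cube z r, ((Metric.ball z' ρ).indicator (1 : Cn n → ℝ≥0∞) u) ^ s ∂ν =
      ν (Metric.ball z' ρ) := by
    have : ∀ u, ((Metric.ball z' ρ).indicator (1 : Cn n → ℝ≥0∞) u) ^ s =
        (Metric.ball z' ρ).indicator 1 u := fun u => by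
      by_cases hu : u ∈ Metric.ball z' ρ
      · simp [hu]
      · simp [hu, show 0 < s by linarith]
    simp_rw [this]
    rw [lintegral_indicator_one measurableSet_ball, Measure.restrict_apply measurableSet_ball,
      Set.inter_eq_left.2 hsub]
  rw [h2] at key
  calc ν (cube z r) = b * ν (cube z r) / b := by rw [mul_comm, ENNReal.mul_div_cancel_right hb0 hbt]
    _ ≤ A * ν (Metric.ball z' ρ) / b := by gcongr
    _ = (A / b) * ν (Metric.ball z' ρ) := by rw [ENNReal.mul_div_right_comm]
    _ ≤ _ := by
      rw [ENNReal.coe_add, ENNReal.coe_toNNReal (ENNReal.div_ne_top ENNReal.coe_ne_top hb0)]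
      gcongr
      exact le_self_add

/-- The condition speaks of a single, unknown side length `r`; here it is transferred to unit balls.
A unit ball is covered by a fixed number of balls of radius `ρ`, whose masses are compared by
chaining. -/
theorem LocalAs.exists_ball_comparison {s r : ℝ} (hs : 1 ≤ s) (hr : 0 < r) {ν : Measure (Cn n)}
    (h : LocalAs s r ν) :
    ∃ ρ : ℝ, 0 < ρ ∧ ρ ≤ 1 ∧ ρ ≤ r / 4 ∧ ∃ K : ℝ≥0, 1 ≤ K ∧
      (∀ z z', dist z z' ≤ ρ → ν (Metric.ball z ρ) ≤ K * ν (Metric.ball z' ρ)) ∧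
      ∃ D : ℝ≥0, ∀ z, ν (Metric.ball z 1) ≤ D * ν (Metric.ball z ρ) := by
  have hρ : 0 < min (r / 4) 1 := by positivity
  refine ⟨min (r / 4) 1, hρ, min_le_right _ _, min_le_left _ _, ?_⟩
  obtain ⟨K, hK1, hK⟩ := h.measure_cube_le hs hρ (min_le_left _ _)
  generalize hρ' : min (r / 4) 1 = ρ at *
  have hρr : ρ ≤ r / 4 := hρ' ▸ min_le_left _ _
  have hstep : ∀ z z', dist z z' ≤ ρ → ν (Metric.ball z ρ) ≤ K * ν (Metric.ball z' ρ) :=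
    fun z z' hz => (measure_mono (Metric.ball_subset_closedBall.trans
      ((Metric.closedBall_subset_closedBall (by linarith)).trans
        (closedBall_subset_cube z r)))).trans (hK z z' hz)
  refine ⟨K, hK1, hstep, ?_⟩
  obtain ⟨t, ht1, htf, ht⟩ := (isCompact_closedBall (0 : Cn n) 1).finite_cover_balls hρ
  set m := ⌈1 / ρ⌉₊
  have hm : 1 ≤ m * ρ := by
    have := Nat.le_ceil (1 / ρ)
    rwa [div_le_iff₀ hρ] at this
  refine ⟨htf.toFinset.card * K ^ m, fun z => ?_⟩
  have hcov : Metric.ball z 1 ⊆ ⋃ y ∈ htf.toFinset, Metric.ball (z + y) ρ := by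
    intro u hu
    have hu' : u - z ∈ Metric.closedBall (0 : Cn n) 1 := by
      rw [mem_closedBall_zero_iff]; exact (mem_ball_iff_norm.1 hu).le
    obtain ⟨y, hy, hyu⟩ := Set.mem_iUnion₂.1 (ht hu')
    refine Set.mem_iUnion₂.2 ⟨y, by simpa using hy, ?_⟩
    rw [mem_ball_iff_norm] at hyu ⊢
    rwa [← sub_sub]
  calc ν (Metric.ball z 1) ≤ ∑ y ∈ htf.toFinset, ν (Metric.ball (z + y) ρ) :=
        (measure_mono hcov).trans (measure_biUnion_finset_le _ _)
    _ ≤ ∑ y ∈ htf.toFinset, (K : ℝ≥0∞) ^ m * ν (Metric.ball z ρ) := by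
        refine Finset.sum_le_sum fun y hy => ?_
        refine le_pow_mul_of_dist_le (V := fun z => ν (Metric.ball z ρ)) hρ hstep m _ _ ?_
        have : ‖y‖ ≤ 1 := by simpa using ht1 (by simpa using hy)
        simpa using this.trans hm
    _ = _ := by
        rw [Finset.sum_const, nsmul_eq_mul]; push_cast; ring

theorem LocalAs.growth {s r : ℝ} (hs : 1 ≤ s) (hr : 0 < r) {ν : Measure (Cn n)}
    (h : LocalAs s r ν) : ∃ C c : ℝ, 0 < C ∧ 0 < c ∧ ∀ z z',
    ν (Metric.ball z 1) ≤ ENNReal.ofReal (C * Real.exp (c * dist z z')) * ν (Metric.ball z' 1) := by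
  obtain ⟨ρ, hρ, hρ1, -, K, hK1, hK, D, hD⟩ := h.exists_ball_comparison hs hr
  have hlog : 0 ≤ Real.log K := Real.log_nonneg (by exact_mod_cast hK1)
  have hKpos : (0 : ℝ) < K := by exact_mod_cast zero_lt_one.trans_le hK1
  -- About `dist z z' / ρ` steps are needed, each costing `K`, which gives the rate `log K / ρ`;
  -- rounding up costs one more factor `K`. The summands `1` only make the constants strictly
  -- positive.
  refine ⟨(D + 1) * K, Real.log K / ρ + 1, by positivity, by positivity, fun z z' => ?_⟩
  set m := ⌈dist z z' / ρ⌉₊ with hm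
  have h1 : dist z z' ≤ m * ρ := by
    have := Nat.le_ceil (dist z z' / ρ)
    rwa [div_le_iff₀ hρ] at this
  have h2 := le_pow_mul_of_dist_le (V := fun z => ν (Metric.ball z ρ)) hρ hK m z z' h1
  have h3 : (K : ℝ) ^ m ≤ K * Real.exp ((Real.log K / ρ + 1) * dist z z') := by
    have hm' : (m : ℝ) ≤ dist z z' / ρ + 1 := (Nat.ceil_lt_add_one (by positivity)).le
    calc (K : ℝ) ^ m = Real.exp (Real.log K * m) := by
          rw [Real.exp_mul, Real.exp_log hKpos, Real.rpow_natCast]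
      _ ≤ Real.exp (Real.log K + (Real.log K / ρ + 1) * dist z z') := by
          apply Real.exp_le_exp.2
          have : Real.log K * m ≤ Real.log K * (dist z z' / ρ + 1) := by gcongr
          have e : Real.log K / ρ * dist z z' = Real.log K * (dist z z' / ρ) := by ring
          nlinarith [dist_nonneg (x := z) (y := z')]
      _ = _ := by rw [Real.exp_add, Real.exp_log hKpos]
  calc ν (Metric.ball z 1) ≤ D * ν (Metric.ball z ρ) := hD z
    _ ≤ D * (K ^ m * ν (Metric.ball z' ρ)) := by gcongr
    _ ≤ D * (K ^ m * ν (Metric.ball z' 1)) := by gcongr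
    _ = (ENNReal.ofReal (D * K ^ m)) * ν (Metric.ball z' 1) := by
      rw [ENNReal.ofReal_mul (by positivity), ENNReal.ofReal_pow (by positivity),
        ENNReal.ofReal_coe_nnreal, ENNReal.ofReal_coe_nnreal, mul_assoc]
    _ ≤ _ := by
      refine mul_le_mul' (ENNReal.ofReal_le_ofReal ?_) le_rfl
      rw [mul_assoc]
      exact mul_le_mul (by linarith) h3 (by positivity) (by positivity)

/-- The exponent is lowered to `p / s` before the unweighted mean value estimate is used. Raising to
the power `s` and testing `A_s` on `|f|^{p/s} e^{-(p/s)α|·|²/2}`, cut off to a small ball, returns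
the power `p` integrated against the weight. As the sub-mean value property holds for every positive
exponent, `p` is unrestricted. -/
theorem LocalAs.hasLocalBound {s r : ℝ} (hs : 1 ≤ s) (hr : 0 < r) {ν : Measure (Cn n)}
    (h : LocalAs s r ν) {α p : ℝ} (hα : 0 < α) (hp : 0 < p) : HasLocalBound α p ν := by
  obtain ⟨ρ, hρ, hρ1, hρr, K, hK1, hK, D, hD⟩ := h.exists_ball_comparison hs hr
  obtain ⟨A, hA⟩ := h
  have hs0 : 0 < s := by linarith
  set b := volume (Metric.ball (0 : Cn n) ρ) with hb
  have hb0 : b ≠ 0 := (Metric.measure_ball_pos volume (0 : Cn n) hρ).ne'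
  have hbt : b ≠ ∞ := measure_ball_lt_top.ne
  set E := ENNReal.ofReal (Real.exp (p / s * α / 2)) with hE
  have hC : D * ((E / b) ^ s * A) ≠ ∞ :=
    ENNReal.mul_ne_top ENNReal.coe_ne_top (ENNReal.mul_ne_top
      (ENNReal.rpow_ne_top_of_nonneg hs0.le (ENNReal.div_ne_top ENNReal.ofReal_ne_top hb0))
      ENNReal.coe_ne_top)
  refine ⟨(D * ((E / b) ^ s * A)).toNNReal, fun f hf z => ?_⟩
  rw [ENNReal.coe_toNNReal hC]
  have hFm := measurable_fockAbs α hf.continuous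
  have hsub : Metric.ball z ρ ⊆ cube z r :=
    Metric.ball_subset_closedBall.trans ((Metric.closedBall_subset_closedBall (by linarith)).trans
        (closedBall_subset_cube z r))
  have h1 : fockAbs α f z ^ (p / s) ≤
      E / b * ∫⁻ u in Metric.ball z ρ, fockAbs α f u ^ (p / s) := by
    have := fockAbs_rpow_mul_volume_ball_le hα hf (t := p / s) (by positivity) z hρ1
    rw [Measure.addHaar_ball_center, ← hb, ← hE] at this
    rw [← ENNReal.mul_div_right_comm]
    rwa [ENNReal.le_div_iff_mul_le (Or.inl hb0) (Or.inl hbt)]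
  have h2 := hA z ((Metric.ball z ρ).indicator fun u => fockAbs α f u ^ (p / s))
    ((hFm.pow_const _).indicator measurableSet_ball)
  rw [lintegral_indicator measurableSet_ball, Measure.restrict_restrict measurableSet_ball,
    Set.inter_eq_left.2 hsub] at h2
  have h3 : ∫⁻ u in cube z r, ((Metric.ball z ρ).indicator
      (fun u => fockAbs α f u ^ (p / s)) u) ^ s ∂ν =
      ∫⁻ u in Metric.ball z ρ, fockAbs α f u ^ p ∂ν := by
    have : ∀ u, ((Metric.ball z ρ).indicator (fun u => fockAbs α f u ^ (p / s)) u) ^ s =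
        (Metric.ball z ρ).indicator (fun u => fockAbs α f u ^ p) u := fun u => by
      by_cases hu : u ∈ Metric.ball z ρ
      · simp only [Set.indicator_of_mem hu]
        rw [← ENNReal.rpow_mul, div_mul_cancel₀ _ hs0.ne']
      · simp [hu, hs0]
    simp_rw [this]
    rw [lintegral_indicator measurableSet_ball, Measure.restrict_restrict measurableSet_ball,
      Set.inter_eq_left.2 hsub]
  rw [h3] at h2
  calc fockAbs α f z ^ p * ν (Metric.ball z 1)
      ≤ fockAbs α f z ^ p * (D * ν (cube z r)) := by
        gcongr
        exact (hD z).trans (by gcongr)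
    _ = D * ((fockAbs α f z ^ (p / s)) ^ s * ν (cube z r)) := by
        rw [← ENNReal.rpow_mul, div_mul_cancel₀ _ hs0.ne']; ring
    _ ≤ D * ((E / b * ∫⁻ u in Metric.ball z ρ, fockAbs α f u ^ (p / s)) ^ s * ν (cube z r)) := by
        gcongr
    _ = D * ((E / b) ^ s * ((∫⁻ u in Metric.ball z ρ, fockAbs α f u ^ (p / s)) ^ s *
          ν (cube z r))) := by
        rw [ENNReal.mul_rpow_of_nonneg _ _ hs0.le, mul_assoc]
    _ ≤ D * ((E / b) ^ s * (A * ∫⁻ u in Metric.ball z ρ, fockAbs α f u ^ p ∂ν)) := by gcongr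
    _ ≤ D * ((E / b) ^ s * (A * ∫⁻ u in Metric.ball z 1, fockAbs α f u ^ p ∂ν)) := by gcongr
    _ = _ := by ring

theorem RestrictedAInfty.expDoubling {w : Cn n → ℝ} (hw : RestrictedAInfty w) :
    ExpDoubling (weightMeasure w) := by
  obtain ⟨hw, hpos, s, r, hs, hr, h⟩ := hw.exists_localAs
  exact ⟨fun z => weightMeasure_ne_zero hw hpos measurableSet_ball
    (Metric.measure_ball_pos volume z one_pos).ne',
    fun z => hw.ne_top_of_isBounded Metric.isBounded_ball, h.growth hs hr⟩

theorem RestrictedAInfty.hasLocalBound {w : Cn n → ℝ} (hw : RestrictedAInfty w) {α p : ℝ}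
    (hα : 0 < α) (hp : 0 < p) : HasLocalBound α p (weightMeasure w) := by
  obtain ⟨hw, hpos, s, r, hs, hr, h⟩ := hw.exists_localAs
  exact h.hasLocalBound hs hr hα hp

theorem lintegral_fockMeasure {w : Cn n → ℝ} (hw : IsWeight w) {p : ℝ} (hp : 0 < p) (α : ℝ)
    {f : Cn n → ℂ} (hf : Continuous f) :
    ∫⁻ z, ‖f z‖ₑ ^ p ∂(fockMeasure p α w) = ∫⁻ z, fockAbs α f z ^ p ∂(weightMeasure w) := by
  have hc : Continuous fun z : Cn n => Real.exp (-(p * α / 2) * ‖z‖ ^ 2) := by fun_prop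
  have hm : AEMeasurable (fun z : Cn n =>
      ENNReal.ofReal (Real.exp (-(p * α / 2) * ‖z‖ ^ 2) * w z)) :=
    (hc.measurable.aemeasurable.mul hw.2.aestronglyMeasurable.aemeasurable).ennreal_ofReal
  rw [fockMeasure, weightMeasure, lintegral_withDensity_eq_lintegral_mul₀ hm
    (hf.enorm.measurable.pow_const p).aemeasurable,
    lintegral_withDensity_eq_lintegral_mul₀ hw.aemeasurable
    ((measurable_fockAbs α hf).pow_const p).aemeasurable]
  refine lintegral_congr fun z => ?_
  simp only [Pi.mul_apply]
  rw [fockAbs, ENNReal.mul_rpow_of_nonneg _ _ hp.le, ENNReal.ofReal_mul (Real.exp_nonneg _),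
    ENNReal.ofReal_rpow_of_nonneg (Real.exp_nonneg _) hp.le, ← Real.exp_mul]
  have : -(p * α / 2) * ‖z‖ ^ 2 = -(α / 2) * ‖z‖ ^ 2 * p := by ring
  rw [this]
  ring

theorem fockNorm_eq {w : Cn n → ℝ} (hw : IsWeight w) {p : ℝ} (hp : 0 < p) (α : ℝ)
    {f : Cn n → ℂ} (hf : Continuous f) :
    fockNorm p α w f = (∫⁻ z, fockAbs α f z ^ p ∂(weightMeasure w)) ^ (1 / p) := by
  rw [fockNorm, lintegral_fockMeasure hw hp α hf]

theorem fockNorm_rpow {w : Cn n → ℝ} (hw : IsWeight w) {p : ℝ} (hp : 0 < p) (α : ℝ)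
    {f : Cn n → ℂ} (hf : Continuous f) :
    fockNorm p α w f ^ p = ∫⁻ z, fockAbs α f z ^ p ∂(weightMeasure w) := by
  rw [fockNorm_eq hw hp α hf, ← ENNReal.rpow_mul, one_div_mul_cancel hp.ne', ENNReal.rpow_one]

/-! ### A lattice of points and sums of Gaussians over it -/

/-- A maximal separated set is a net, since a point far from all of it could be added. Its points
are centres of disjoint balls of radius `1/4`, whence countability. -/
theorem exists_separated_net (n : ℕ) : ∃ X : Set (Cn n), X.Countable ∧
    X.Pairwise (fun x y => 1 / 2 < dist x y) ∧ ∀ z, ∃ x ∈ X, dist z x ≤ 1 / 2 := by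
  obtain ⟨X, hX⟩ := zorn_subset {X : Set (Cn n) | X.Pairwise (fun x y => 1 / 2 < dist x y)}
    fun c hc hchain => ⟨⋃₀ c, (Set.pairwise_sUnion hchain.directedOn).2 fun s hs => hc hs,
      fun s hs => Set.subset_sUnion_of_mem hs⟩
  have hsep : X.Pairwise (fun x y => 1 / 2 < dist x y) := hX.prop
  refine ⟨X, ?_, hsep, fun z => ?_⟩
  · refine Set.PairwiseDisjoint.countable_of_isOpen (s := fun x => Metric.ball x (1 / 4)) ?_
      (fun _ _ => Metric.isOpen_ball) (fun x _ => Metric.nonempty_ball.2 (by norm_num))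
    intro x hx y hy hxy
    exact Metric.ball_disjoint_ball (by linarith [hsep hx hy hxy])
  · by_contra! h
    have hins : (insert z X).Pairwise (fun x y => 1 / 2 < dist x y) :=
      hsep.insert fun y hy _ => ⟨h y hy, by rw [dist_comm]; exact h y hy⟩
    have hz : z ∈ X := hX.le_of_ge hins (Set.subset_insert z X) (Set.mem_insert z X)
    have := h z hz
    rw [dist_self] at this
    norm_num at this

/-- A fixed countable `1/2`-separated `1/2`-net of `ℂⁿ`. -/
noncomputable def net (n : ℕ) : Set (Cn n) := (exists_separated_net n).choose

instance : Countable (net n) := (exists_separated_net n).choose_spec.1.to_subtype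

theorem net_separated {x y : Cn n} (hx : x ∈ net n) (hy : y ∈ net n) (h : x ≠ y) :
    1 / 2 < dist x y := (exists_separated_net n).choose_spec.2.1 hx hy h

theorem exists_net_dist_le (z : Cn n) : ∃ k : net n, dist z k ≤ 1 / 2 := by
  obtain ⟨x, hx, h⟩ := (exists_separated_net n).choose_spec.2.2 z
  exact ⟨⟨x, hx⟩, h⟩

theorem iUnion_net : ⋃ k : net n, Metric.closedBall (k : Cn n) (1 / 2) = Set.univ :=
  Set.eq_univ_of_forall fun z => by
    obtain ⟨k, hk⟩ := exists_net_dist_le z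
    exact Set.mem_iUnion.2 ⟨k, hk⟩

theorem lintegral_le_tsum_net (ν : Measure (Cn n)) (φ : Cn n → ℝ≥0∞) :
    ∫⁻ z, φ z ∂ν ≤ ∑' k : net n, ∫⁻ z in Metric.closedBall (k : Cn n) (1 / 2), φ z ∂ν := by
  have := lintegral_iUnion_le (μ := ν) (fun k : net n => Metric.closedBall (k : Cn n) (1 / 2)) φ
  rwa [iUnion_net, Measure.restrict_univ] at this

/-- The Gaussian `e^{-c|x-z|²}`. -/
noncomputable def gauss (c : ℝ) (x z : Cn n) : ℝ≥0∞ :=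
  ENNReal.ofReal (Real.exp (-c * dist x z ^ 2))

theorem gauss_comm (c : ℝ) (x z : Cn n) : gauss c x z = gauss c z x := by
  rw [gauss, dist_comm, gauss]

@[fun_prop]
theorem measurable_gauss (c : ℝ) (x : Cn n) : Measurable (gauss c x) := by
  unfold gauss
  have : Continuous fun z : Cn n => Real.exp (-c * dist x z ^ 2) := by fun_prop
  exact this.measurable.ennreal_ofReal

theorem gauss_rpow (c : ℝ) (x z : Cn n) {q : ℝ} (hq : 0 ≤ q) :
    gauss c x z ^ q = gauss (c * q) x z := by
  rw [gauss, gauss, ENNReal.ofReal_rpow_of_nonneg (Real.exp_nonneg _) hq, ← Real.exp_mul]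
  congr 2; ring

/-- From `(a + b)² ≤ 2a² + 2b²`: halving the rate is the price of moving the centre by a bounded
amount. -/
theorem gauss_le_of_dist_le {c : ℝ} (hc : 0 ≤ c) {δ : ℝ} {x x' : Cn n}
    (h : dist x x' ≤ δ) (z : Cn n) :
    gauss c x z ≤ ENNReal.ofReal (Real.exp (c * δ ^ 2)) * gauss (c / 2) x' z := by
  rw [gauss, gauss, ← ENNReal.ofReal_mul (Real.exp_nonneg _), ← Real.exp_add]
  refine ENNReal.ofReal_le_ofReal (Real.exp_le_exp.2 ?_)
  have h1 : dist x' z ≤ δ + dist x z := (dist_triangle_left x' z x).trans (by gcongr)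
  have h2 : dist x' z ^ 2 ≤ 2 * δ ^ 2 + 2 * dist x z ^ 2 := by
    nlinarith [dist_nonneg (x := x') (y := z), sq_nonneg (δ - dist x z)]
  nlinarith

/-- Completing the square: half of the Gaussian absorbs any exponential growth. -/
theorem exp_mul_gauss_le {c : ℝ} (hc : 0 < c) (b : ℝ) (x z : Cn n) :
    ENNReal.ofReal (Real.exp (b * dist x z)) * gauss c x z ≤
      ENNReal.ofReal (Real.exp (b ^ 2 / (2 * c))) * gauss (c / 2) x z := by
  rw [gauss, gauss, ← ENNReal.ofReal_mul (Real.exp_nonneg _), ← Real.exp_add,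
    ← ENNReal.ofReal_mul (Real.exp_nonneg _), ← Real.exp_add]
  refine ENNReal.ofReal_le_ofReal (Real.exp_le_exp.2 ?_)
  have : b ^ 2 / (2 * c) + -(c / 2) * dist x z ^ 2 - (b * dist x z + -c * dist x z ^ 2) =
      (b - c * dist x z) ^ 2 / (2 * c) := by field_simp; ring
  have h2 : 0 ≤ (b - c * dist x z) ^ 2 / (2 * c) := by positivity
  linarith

theorem lintegral_gauss_volume_lt_top {c : ℝ} (hc : 0 < c) (z : Cn n) :
    ∫⁻ u, gauss c z u < ∞ := by
  have h := (GaussianFourier.integrable_cexp_neg_mul_sq_norm_add (V := Cn n) (b := (c : ℂ))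
    (by simpa) 0 0).2
  rw [hasFiniteIntegral_iff_enorm] at h
  have h2 : ∫⁻ u : Cn n, gauss c z u = ∫⁻ u : Cn n, gauss c 0 u := by
    have : ∀ u, gauss c z u = gauss c 0 (u - z) := fun u => by
      rw [gauss, gauss, dist_eq_norm, dist_eq_norm, zero_sub, norm_neg, norm_sub_rev]
    simp_rw [this]
    exact lintegral_sub_right_eq_self (fun u => gauss c 0 u) z
  rw [h2]
  refine lt_of_eq_of_lt (lintegral_congr fun u => ?_) h
  rw [← ofReal_norm, Complex.norm_exp, gauss, dist_eq_norm, zero_sub, norm_neg]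
  congr 2
  simp [← Complex.ofReal_pow, ← Complex.ofReal_mul, ← Complex.ofReal_neg]

/-- Each term is dominated by the average of a wider Gaussian over the ball of radius `1/4` about
`k`. These balls are disjoint and of equal volume, so the sum is at most a multiple of a Gaussian
integral independent of `z`. -/
theorem tsum_gauss_le {c : ℝ} (hc : 0 < c) :
    ∃ C : ℝ≥0, ∀ z : Cn n, ∑' k : net n, gauss c k z ≤ C := by
  set I := ∫⁻ u : Cn n, gauss (c / 2) 0 u with hI
  have hIt : I ≠ ∞ := (lintegral_gauss_volume_lt_top (half_pos hc) 0).ne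
  set b := volume (Metric.ball (0 : Cn n) (1 / 4)) with hb
  have hb0 : b ≠ 0 := (Metric.measure_ball_pos volume (0 : Cn n) (by norm_num)).ne'
  have hbt : b ≠ ∞ := measure_ball_lt_top.ne
  set E := ENNReal.ofReal (Real.exp (c * (1 / 4) ^ 2)) with hE
  refine ⟨(E * I / b).toNNReal, fun z => ?_⟩
  rw [ENNReal.coe_toNNReal (ENNReal.div_ne_top (ENNReal.mul_ne_top ENNReal.ofReal_ne_top hIt) hb0),
    ENNReal.le_div_iff_mul_le (Or.inl hb0) (Or.inl hbt), ← ENNReal.tsum_mul_right]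
  have hdisj : Pairwise (Function.onFun Disjoint fun k : net n =>
      Metric.ball (k : Cn n) (1 / 4)) := fun k l hkl =>
    Metric.ball_disjoint_ball (by
      linarith [net_separated k.2 l.2 (fun h => hkl (Subtype.ext h))])
  have hIz : ∫⁻ u : Cn n, gauss (c / 2) z u = I := by
    have : ∀ u, gauss (c / 2) z u = gauss (c / 2) 0 (u - z) := fun u => by
      rw [gauss, gauss, dist_eq_norm, dist_eq_norm, zero_sub, norm_neg, norm_sub_rev]
    simp_rw [this]
    exact lintegral_sub_right_eq_self (fun u => gauss (c / 2) 0 u) z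
  calc ∑' k : net n, gauss c k z * b
      ≤ ∑' k : net n, ∫⁻ u in Metric.ball (k : Cn n) (1 / 4), E * gauss (c / 2) z u := by
        refine ENNReal.tsum_le_tsum fun k => ?_
        rw [hb, ← Measure.addHaar_ball_center volume (k : Cn n), ← setLIntegral_const]
        refine setLIntegral_mono' measurableSet_ball fun u hu => ?_
        rw [gauss_comm (c / 2)]
        exact gauss_le_of_dist_le hc.le (by rw [dist_comm]; exact (Metric.mem_ball.1 hu).le) z
    _ = ∫⁻ u in ⋃ k : net n, Metric.ball (k : Cn n) (1 / 4), E * gauss (c / 2) z u :=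
        (lintegral_iUnion (fun k => measurableSet_ball) hdisj _).symm
    _ ≤ ∫⁻ u, E * gauss (c / 2) z u := setLIntegral_le_lintegral _ _
    _ = E * I := by rw [lintegral_const_mul _ (measurable_gauss _ _), hIz]

/-- The balls of a fixed radius about the points of the net have bounded overlap. -/
theorem tsum_setLIntegral_ball_le (R : ℝ) : ∃ N : ℝ≥0, ∀ (ν : Measure (Cn n)) (φ : Cn n → ℝ≥0∞),
    Measurable φ → ∑' k : net n, ∫⁻ u in Metric.ball (k : Cn n) R, φ u ∂ν ≤ N * ∫⁻ u, φ u ∂ν := by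
  obtain ⟨C, hC⟩ := tsum_gauss_le (n := n) one_pos
  refine ⟨(Real.exp (R ^ 2)).toNNReal * C, fun ν φ hφ => ?_⟩
  calc ∑' k : net n, ∫⁻ u in Metric.ball (k : Cn n) R, φ u ∂ν
      = ∑' k : net n, ∫⁻ u, (Metric.ball (k : Cn n) R).indicator φ u ∂ν := by
        simp_rw [lintegral_indicator measurableSet_ball]
    _ = ∫⁻ u, ∑' k : net n, (Metric.ball (k : Cn n) R).indicator φ u ∂ν :=
        (lintegral_tsum fun k => (hφ.indicator measurableSet_ball).aemeasurable).symm
    -- The indicator of `B_R(k)` is at most `e^{R²}` times the Gaussian centred at `k`, so the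
    -- overlap is bounded by a Gaussian lattice sum.
    _ ≤ ∫⁻ u, ENNReal.ofReal (Real.exp (R ^ 2)) * C * φ u ∂ν := by
        refine lintegral_mono fun u => ?_
        calc ∑' k : net n, (Metric.ball (k : Cn n) R).indicator φ u
            ≤ ∑' k : net n, ENNReal.ofReal (Real.exp (R ^ 2)) * gauss 1 k u * φ u := by
              refine ENNReal.tsum_le_tsum fun k => ?_
              by_cases hu : u ∈ Metric.ball (k : Cn n) R
              · rw [Set.indicator_of_mem hu]
                refine le_mul_of_one_le_left' ?_
                rw [gauss, ← ENNReal.ofReal_mul (Real.exp_nonneg _), ← Real.exp_add,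
                  ENNReal.one_le_ofReal, Real.one_le_exp_iff]
                rw [Metric.mem_ball, dist_comm] at hu
                nlinarith [dist_nonneg (x := (k : Cn n)) (y := u)]
              · simp [Set.indicator_of_notMem hu]
          _ = ENNReal.ofReal (Real.exp (R ^ 2)) * (∑' k : net n, gauss 1 k u) * φ u := by
              rw [ENNReal.tsum_mul_right, ENNReal.tsum_mul_left]
          _ ≤ _ := by gcongr; exact hC u
    _ = _ := by
        rw [lintegral_const_mul _ hφ, ENNReal.coe_mul]; rfl

theorem tsum_rpow_le_of_le_one {ι : Type*} (a : ι → ℝ≥0∞) {q : ℝ} (hq : 0 < q) (hq1 : q ≤ 1) :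
    (∑' k, a k) ^ q ≤ ∑' k, a k ^ q := by
  have hfin : ∀ s : Finset ι, (∑ k ∈ s, a k) ^ q ≤ ∑ k ∈ s, a k ^ q := fun s => by
    classical
    induction s using Finset.induction_on with
    | empty => simp [hq]
    | insert i s hi ih =>
      rw [Finset.sum_insert hi, Finset.sum_insert hi]
      exact (ENNReal.rpow_add_le_add_rpow _ _ hq.le hq1).trans (by gcongr)
  rw [ENNReal.tsum_eq_iSup_sum, ← ENNReal.le_rpow_inv_iff hq]
  refine iSup_le fun s => ?_
  rw [ENNReal.le_rpow_inv_iff hq]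
  exact (hfin s).trans (ENNReal.sum_le_tsum s)

theorem tsum_mul_rpow_le_of_one_le {ι : Type*} (w a : ι → ℝ≥0∞) {q : ℝ} (hq1 : 1 ≤ q) :
    (∑' k, w k * a k) ^ q ≤ (∑' k, w k) ^ (q - 1) * ∑' k, w k * a k ^ q := by
  have hq : 0 < q := by linarith
  rw [ENNReal.tsum_eq_iSup_sum (f := fun k => w k * a k), ← ENNReal.le_rpow_inv_iff hq]
  refine iSup_le fun s => ?_
  rw [ENNReal.le_rpow_inv_iff hq]
  refine (ENNReal.rpow_le_rpow (ENNReal.inner_le_weight_mul_Lp_of_nonneg s hq1 w a) hq.le).trans ?_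
  rw [ENNReal.mul_rpow_of_nonneg _ _ hq.le, ← ENNReal.rpow_mul, ← ENNReal.rpow_mul,
    inv_mul_cancel₀ hq.ne', ENNReal.rpow_one, show (1 - q⁻¹) * q = q - 1 by field_simp]
  exact mul_le_mul' (ENNReal.rpow_le_rpow (ENNReal.sum_le_tsum s) (by linarith))
    (ENNReal.sum_le_tsum s)

/-- For `q ≤ 1` the power is subadditive and the Gaussian acquires the rate `cq`. For `q ≥ 1`
Hölder's inequality applies with the Gaussians as weights of bounded total mass. -/
theorem tsum_mul_gauss_rpow_le {c q : ℝ} (hc : 0 < c) (hq : 0 < q) : ∃ (C : ℝ≥0) (c' : ℝ), 0 < c' ∧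
    ∀ (a : net n → ℝ≥0∞) (z : Cn n), (∑' k, a k * gauss c k z) ^ q ≤
      C * ∑' k, a k ^ q * gauss c' k z := by
  rcases le_total q 1 with hq1 | hq1
  · refine ⟨1, c * q, by positivity, fun a z => ?_⟩
    rw [ENNReal.coe_one, one_mul]
    refine (tsum_rpow_le_of_le_one _ hq hq1).trans_eq ?_
    simp_rw [ENNReal.mul_rpow_of_nonneg _ _ hq.le, gauss_rpow _ _ _ hq.le]
  · obtain ⟨C, hC⟩ := tsum_gauss_le (n := n) hc
    refine ⟨C ^ (q - 1), c, hc, fun a z => ?_⟩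
    simp_rw [mul_comm (a _), mul_comm (a _ ^ q)]
    refine (tsum_mul_rpow_le_of_one_le _ _ hq1).trans ?_
    rw [ENNReal.coe_rpow_of_nonneg _ (by linarith)]
    gcongr
    exact hC z

/-! ### Integrating Gaussians against the weight -/

namespace ExpDoubling

variable {ν : Measure (Cn n)}

theorem rpow_ne_top (hν : ExpDoubling ν) (e : ℝ) (z : Cn n) : ν (Metric.ball z 1) ^ e ≠ ∞ :=
  by simp [ENNReal.rpow_eq_top_iff, hν.ne_zero z, hν.ne_top z]

theorem rpow_ne_zero (hν : ExpDoubling ν) (e : ℝ) (z : Cn n) : ν (Metric.ball z 1) ^ e ≠ 0 := by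
  simp [ENNReal.rpow_eq_zero_iff, hν.ne_zero z, hν.ne_top z]

theorem rpow_mul_rpow_neg (hν : ExpDoubling ν) (e : ℝ) (z : Cn n) :
    ν (Metric.ball z 1) ^ e * ν (Metric.ball z 1) ^ (-e) = 1 := by
  rw [← ENNReal.rpow_add _ _ (hν.ne_zero z) (hν.ne_top z), add_neg_cancel, ENNReal.rpow_zero]

/-- The growth condition is symmetric in the two centres, so negative exponents follow by exchanging
them. -/
theorem rpow_growth (hν : ExpDoubling ν) (e : ℝ) : ∃ C c : ℝ, 0 < C ∧ 0 ≤ c ∧ ∀ z z',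
    ν (Metric.ball z 1) ^ e ≤
      ENNReal.ofReal (C * Real.exp (c * dist z z')) * ν (Metric.ball z' 1) ^ e := by
  obtain ⟨C, c, hC, hc, h⟩ := hν.growth
  have hpos : ∀ e : ℝ, 0 ≤ e → ∀ z z', ν (Metric.ball z 1) ^ e ≤
      ENNReal.ofReal (C ^ e * Real.exp (c * e * dist z z')) * ν (Metric.ball z' 1) ^ e := by
    intro e he z z'
    refine (ENNReal.rpow_le_rpow (h z z') he).trans_eq ?_
    rw [ENNReal.mul_rpow_of_nonneg _ _ he, ENNReal.ofReal_rpow_of_nonneg (by positivity) he,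
      Real.mul_rpow hC.le (Real.exp_nonneg _), ← Real.exp_mul]
    congr 4; ring
  rcases le_total 0 e with he | he
  · exact ⟨C ^ e, c * e, by positivity, by positivity, hpos e he⟩
  · refine ⟨C ^ (-e), c * (-e), by positivity, mul_nonneg hc.le (by linarith), fun z z' => ?_⟩
    have h1 := hpos (-e) (by linarith) z' z
    rw [dist_comm] at h1
    calc ν (Metric.ball z 1) ^ e
        = ν (Metric.ball z 1) ^ e * (ν (Metric.ball z' 1) ^ e * ν (Metric.ball z' 1) ^ (-e)) := by
          rw [hν.rpow_mul_rpow_neg, mul_one]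
      _ ≤ ν (Metric.ball z 1) ^ e * (ν (Metric.ball z' 1) ^ e *
          (ENNReal.ofReal (C ^ (-e) * Real.exp (c * (-e) * dist z z')) *
            ν (Metric.ball z 1) ^ (-e))) := by gcongr
      _ = (ENNReal.ofReal (C ^ (-e) * Real.exp (c * (-e) * dist z z')) *
          ν (Metric.ball z' 1) ^ e) * (ν (Metric.ball z 1) ^ e * ν (Metric.ball z 1) ^ (-e)) := by
          ring
      _ = _ := by rw [hν.rpow_mul_rpow_neg, mul_one]

theorem rpow_le_of_dist_le (hν : ExpDoubling ν) (e R : ℝ) : ∃ K : ℝ≥0, ∀ z z', dist z z' ≤ R →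
    ν (Metric.ball z 1) ^ e ≤ K * ν (Metric.ball z' 1) ^ e := by
  obtain ⟨C, c, hC, hc, h⟩ := hν.rpow_growth e
  refine ⟨(C * Real.exp (c * R)).toNNReal, fun z z' hz => (h z z').trans ?_⟩
  refine mul_le_mul' (ENNReal.ofReal_le_ofReal ?_) le_rfl
  gcongr

theorem le_of_dist_le (hν : ExpDoubling ν) (R : ℝ) : ∃ K : ℝ≥0, ∀ z z', dist z z' ≤ R →
    ν (Metric.ball z 1) ≤ K * ν (Metric.ball z' 1) := by
  simpa using hν.rpow_le_of_dist_le 1 R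

/-- On each cell the Gaussian is frozen at the lattice point `k`, and the mass of the cell is at
most `e^{d|k-x|}` times that of `B_1(x)`, up to a constant. Half of the remaining Gaussian absorbs
the exponential and the rest is summable. -/
theorem lintegral_gauss_le (hν : ExpDoubling ν) {c : ℝ} (hc : 0 < c) :
    ∃ C : ℝ≥0, ∀ x, ∫⁻ z, gauss c x z ∂ν ≤ C * ν (Metric.ball x 1) := by
  obtain ⟨D, d, hD, hd, h⟩ := hν.growth
  obtain ⟨N, hN⟩ := tsum_gauss_le (n := n) (c := c / 2 / 2) (by positivity)
  set E := ENNReal.ofReal (Real.exp (c * (1 / 2) ^ 2)) with hE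
  set E' := ENNReal.ofReal (Real.exp (d ^ 2 / (2 * (c / 2)))) with hE'
  have hC : E * ENNReal.ofReal D * E' * N ≠ ∞ := by finiteness
  refine ⟨(E * ENNReal.ofReal D * E' * N).toNNReal, fun x => ?_⟩
  rw [ENNReal.coe_toNNReal hC]
  calc ∫⁻ z, gauss c x z ∂ν
      ≤ ∑' k : net n, ∫⁻ z in Metric.closedBall (k : Cn n) (1 / 2), gauss c x z ∂ν :=
        lintegral_le_tsum_net _ _
    _ ≤ ∑' k : net n, ∫⁻ z in Metric.closedBall (k : Cn n) (1 / 2), E * gauss (c / 2) k x ∂ν := by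
        refine ENNReal.tsum_le_tsum fun k => ?_
        refine setLIntegral_mono' Metric.isClosed_closedBall.measurableSet fun z hz => ?_
        rw [gauss_comm]
        exact gauss_le_of_dist_le hc.le hz x
    _ ≤ ∑' k : net n, E * gauss (c / 2) k x *
          (ENNReal.ofReal (D * Real.exp (d * dist (k : Cn n) x)) * ν (Metric.ball x 1)) := by
        refine ENNReal.tsum_le_tsum fun k => ?_
        rw [setLIntegral_const]
        gcongr
        exact (measure_mono (Metric.closedBall_subset_ball (by norm_num))).trans (h _ _)
    _ ≤ ∑' k : net n, E * ENNReal.ofReal D * E' * ν (Metric.ball x 1) * gauss (c / 2 / 2) k x := by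
        refine ENNReal.tsum_le_tsum fun k => ?_
        have := exp_mul_gauss_le (half_pos hc) d (k : Cn n) x
        rw [ENNReal.ofReal_mul hD.le]
        calc E * gauss (c / 2) k x * (ENNReal.ofReal D *
                ENNReal.ofReal (Real.exp (d * dist (k : Cn n) x)) * ν (Metric.ball x 1))
            = E * ENNReal.ofReal D * ν (Metric.ball x 1) *
              (ENNReal.ofReal (Real.exp (d * dist (k : Cn n) x)) * gauss (c / 2) k x) := by ring
          _ ≤ E * ENNReal.ofReal D * ν (Metric.ball x 1) * (E' * gauss (c / 2 / 2) k x) := by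
              gcongr
          _ = _ := by ring
    _ = E * ENNReal.ofReal D * E' * ν (Metric.ball x 1) * ∑' k : net n, gauss (c / 2 / 2) k x := by
        rw [ENNReal.tsum_mul_left]
    _ ≤ E * ENNReal.ofReal D * E' * ν (Metric.ball x 1) * N := by gcongr; exact hN x
    _ = _ := by ring

end ExpDoubling

/-- The `L^q` norm of a lattice superposition of Gaussians. -/
theorem ExpDoubling.lintegral_tsum_mul_gauss_rpow_le {ν : Measure (Cn n)} (hν : ExpDoubling ν)
    {c q : ℝ} (hc : 0 < c) (hq : 0 < q) : ∃ C : ℝ≥0, ∀ a : net n → ℝ≥0∞,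
    ∫⁻ z, (∑' k, a k * gauss c k z) ^ q ∂ν ≤
      C * ∑' k : net n, a k ^ q * ν (Metric.ball (k : Cn n) 1) := by
  obtain ⟨C, c', hc', h⟩ := tsum_mul_gauss_rpow_le (n := n) hc hq
  obtain ⟨D, hD⟩ := hν.lintegral_gauss_le hc'
  refine ⟨C * D, fun a => ?_⟩
  calc ∫⁻ z, (∑' k, a k * gauss c k z) ^ q ∂ν
      ≤ ∫⁻ z, C * ∑' k, a k ^ q * gauss c' k z ∂ν := lintegral_mono fun z => h a z
    _ = C * ∑' k : net n, a k ^ q * ∫⁻ z, gauss c' k z ∂ν := by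
        rw [lintegral_const_mul' _ _ ENNReal.coe_ne_top, lintegral_tsum fun k =>
          ((measurable_gauss _ _).const_mul _).aemeasurable]
        simp_rw [lintegral_const_mul _ (measurable_gauss _ _)]
    _ ≤ C * ∑' k : net n, a k ^ q * (D * ν (Metric.ball (k : Cn n) 1)) := by
        gcongr; exact hD _
    _ = _ := by
        simp_rw [mul_left_comm _ (D : ℝ≥0∞)]
        rw [ENNReal.tsum_mul_left, ENNReal.coe_mul, mul_assoc]

/-! ### The dominating Gaussian operator and the upper bounds -/

/-- The positive operator `F ↦ ∫ F(u) e^{-α|z-u|²/2} dμ(u)` dominating `T^α_μ`. -/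
noncomputable def gaussOp (α : ℝ) (μ : Measure (Cn n)) (F : Cn n → ℝ≥0∞) (z : Cn n) : ℝ≥0∞ :=
  ∫⁻ u, F u * gauss (α / 2) z u ∂μ

/-- Half of `e^{-α|u|²}` goes to `f`; the other half, `e^{-α|z|²/2}` and the real part of `α⟨z,u⟩`
complete the square. -/
theorem enorm_toeplitzIntegrand_mul (α : ℝ) (f : Cn n → ℂ) (z u : Cn n) :
    ‖toeplitzIntegrand α f z u‖ₑ * ENNReal.ofReal (Real.exp (-(α / 2) * ‖z‖ ^ 2)) =
      fockAbs α f u * gauss (α / 2) z u := by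
  rw [toeplitzIntegrand, enorm_mul, fockAbs, mul_assoc, mul_assoc, gauss,
    ← ENNReal.ofReal_mul (Real.exp_nonneg _), ← ofReal_norm (Complex.exp _), Complex.norm_exp,
    ← ENNReal.ofReal_mul (Real.exp_nonneg _), ← Real.exp_add, ← Real.exp_add]
  congr 3
  have h : ‖u - z‖ ^ 2 = ‖u‖ ^ 2 - 2 * (inner ℂ u z).re + ‖z‖ ^ 2 := norm_sub_sq (𝕜 := ℂ) u z
  rw [dist_comm, dist_eq_norm, h, Complex.sub_re, Complex.re_ofReal_mul, Complex.re_ofReal_mul,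
    ← Complex.ofReal_pow, Complex.ofReal_re]
  ring

/-- This bound depends on `z` only through `‖z‖`, which makes it a majorant for absolute convergence
and for differentiation under the integral sign. -/
theorem enorm_toeplitzIntegrand_le {α : ℝ} (hα : 0 < α) (f : Cn n → ℂ) (z u : Cn n) :
    ‖toeplitzIntegrand α f z u‖ₑ ≤
      fockAbs α f u * ENNReal.ofReal (Real.exp (α * ‖z‖ * ‖u‖)) * gauss (α / 2) 0 u := by
  rw [toeplitzIntegrand, enorm_mul, fockAbs, mul_assoc, mul_assoc, gauss,
    ← ENNReal.ofReal_mul (Real.exp_nonneg _), ← ofReal_norm (Complex.exp _), Complex.norm_exp,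
    ← ENNReal.ofReal_mul (Real.exp_nonneg _), ← Real.exp_add, ← Real.exp_add]
  gcongr
  rw [dist_eq_norm, zero_sub, norm_neg, Complex.sub_re, Complex.re_ofReal_mul,
    Complex.re_ofReal_mul, ← Complex.ofReal_pow, Complex.ofReal_re]
  have h : (inner ℂ u z : ℂ).re ≤ ‖u‖ * ‖z‖ :=
    (Complex.re_le_norm _).trans (norm_inner_le_norm u z)
  nlinarith

theorem continuous_toeplitzIntegrand (α : ℝ) {f : Cn n → ℂ} (hf : Continuous f) (z : Cn n) :
    Continuous (toeplitzIntegrand α f z) := by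
  unfold toeplitzIntegrand
  fun_prop

theorem fockAbs_toeplitz_le (α : ℝ) (μ : Measure (Cn n)) (f : Cn n → ℂ) (z : Cn n) :
    fockAbs α (toeplitz α μ f) z ≤ gaussOp α μ (fockAbs α f) z := by
  rw [fockAbs, gaussOp, toeplitz]
  simp_rw [← enorm_toeplitzIntegrand_mul]
  rw [lintegral_mul_const' _ _ ENNReal.ofReal_ne_top]
  gcongr
  exact enorm_integral_le_lintegral_enorm _

/-- Discretisation: on the cell of `k` the function is replaced by its bound `S k` and the Gaussian
by a wider one centred at `k`. The cells may overlap, which is harmless for an upper bound. -/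
theorem gaussOp_le {α : ℝ} (hα : 0 < α) (μ : Measure (Cn n)) {F : Cn n → ℝ≥0∞}
    {S : net n → ℝ≥0∞} (hS : ∀ k : net n, ∀ u ∈ Metric.closedBall (k : Cn n) (1 / 2), F u ≤ S k)
    (z : Cn n) : gaussOp α μ F z ≤ ∑' k : net n,
      (ENNReal.ofReal (Real.exp (α / 2 * (1 / 2) ^ 2)) * S k *
        μ (Metric.closedBall (k : Cn n) (1 / 2))) * gauss (α / 4) k z := by
  refine (lintegral_le_tsum_net μ _).trans (ENNReal.tsum_le_tsum fun k => ?_)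
  calc ∫⁻ u in Metric.closedBall (k : Cn n) (1 / 2), F u * gauss (α / 2) z u ∂μ
      ≤ ∫⁻ u in Metric.closedBall (k : Cn n) (1 / 2), S k *
          (ENNReal.ofReal (Real.exp (α / 2 * (1 / 2) ^ 2)) * gauss (α / 4) k z) ∂μ := by
        refine setLIntegral_mono' Metric.isClosed_closedBall.measurableSet fun u hu => ?_
        refine mul_le_mul' (hS k u hu) ?_
        rw [gauss_comm, show α / 4 = α / 2 / 2 by ring]
        exact gauss_le_of_dist_le (by positivity) hu z
    _ = _ := by rw [setLIntegral_const]; ring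

section LocalBound

variable {ν : Measure (Cn n)} {α p q : ℝ}

/-- On the cell of a point `k` of the net, `|f|e^{-α|·|²/2}` is controlled by its local `L^p`
mean. -/
theorem HasLocalBound.fockAbs_le (hL : HasLocalBound α p ν) (hν : ExpDoubling ν) (hp : 0 < p) :
    ∃ D : ℝ≥0, ∀ f : Cn n → ℂ, Differentiable ℂ f → ∀ k : Cn n,
      ∀ u ∈ Metric.closedBall k (1 / 2), fockAbs α f u ≤
        D * (∫⁻ v in Metric.ball k 2, fockAbs α f v ^ p ∂ν) ^ (1 / p) *
          ν (Metric.ball k 1) ^ (-(1 / p)) := by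
  obtain ⟨C, hC⟩ := hL
  obtain ⟨K, hK⟩ := hν.le_of_dist_le (1 / 2)
  refine ⟨(C * K) ^ (1 / p), fun f hf k u hu => ?_⟩
  set W := ν (Metric.ball k 1) with hW
  have hW0 : W ≠ 0 := hν.ne_zero k
  have hWt : W ≠ ∞ := hν.ne_top k
  set I := ∫⁻ v in Metric.ball k 2, fockAbs α f v ^ p ∂ν with hI
  have h1 : fockAbs α f u ^ p * W ≤ C * K * I := by
    calc fockAbs α f u ^ p * W ≤ fockAbs α f u ^ p * (K * ν (Metric.ball u 1)) := by
          gcongr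
          exact hK _ _ (by rw [dist_comm]; exact hu)
      _ = K * (fockAbs α f u ^ p * ν (Metric.ball u 1)) := by ring
      _ ≤ K * (C * ∫⁻ v in Metric.ball u 1, fockAbs α f v ^ p ∂ν) := mul_le_mul' le_rfl (hC f hf u)
      _ ≤ K * (C * I) := by
          gcongr
          exact lintegral_mono_set (Metric.ball_subset_ball' (by
            have := Metric.mem_closedBall.1 hu; linarith))
      _ = _ := by ring
  have h2 : fockAbs α f u ^ p ≤ C * K * I * W⁻¹ := by
    rwa [← div_eq_mul_inv, ENNReal.le_div_iff_mul_le (Or.inl hW0) (Or.inl hWt)]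
  calc fockAbs α f u = (fockAbs α f u ^ p) ^ (1 / p) := by
        rw [← ENNReal.rpow_mul, mul_one_div_cancel hp.ne', ENNReal.rpow_one]
    _ ≤ (C * K * I * W⁻¹) ^ (1 / p) := ENNReal.rpow_le_rpow h2 (by positivity)
    _ = _ := by
        rw [ENNReal.mul_rpow_of_nonneg _ _ (by positivity),
          ENNReal.mul_rpow_of_nonneg _ _ (by positivity), ENNReal.rpow_neg, ENNReal.inv_rpow,
          ENNReal.coe_rpow_of_nonneg _ (by positivity), ENNReal.coe_mul]

/-- The discretised estimate of the dominating operator. -/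
theorem lintegral_gaussOp_rpow_le (hL : HasLocalBound α p ν) (hν : ExpDoubling ν) (hα : 0 < α)
    (hp : 0 < p) (hq : 0 < q) : ∃ C : ℝ≥0, ∀ (μ : Measure (Cn n)) (f : Cn n → ℂ),
      Differentiable ℂ f → ∫⁻ z, gaussOp α μ (fockAbs α f) z ^ q ∂ν ≤ C * ∑' k : net n,
        (∫⁻ v in Metric.ball (k : Cn n) 2, fockAbs α f v ^ p ∂ν) ^ (q / p) *
        (μ (Metric.closedBall (k : Cn n) (1 / 2)) *
          ν (Metric.ball (k : Cn n) 1) ^ (1 / q - 1 / p)) ^ q := by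
  obtain ⟨D, hD⟩ := hL.fockAbs_le hν hp
  obtain ⟨C, hC⟩ := hν.lintegral_tsum_mul_gauss_rpow_le (c := α / 4) (by positivity) hq
  set E := ENNReal.ofReal (Real.exp (α / 2 * (1 / 2) ^ 2)) with hE
  have hconst : C * (E * D) ^ q ≠ ∞ := ENNReal.mul_ne_top ENNReal.coe_ne_top
    (ENNReal.rpow_ne_top_of_nonneg hq.le (ENNReal.mul_ne_top ENNReal.ofReal_ne_top
      ENNReal.coe_ne_top))
  refine ⟨(C * (E * D) ^ q).toNNReal, fun μ f hf => ?_⟩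
  rw [ENNReal.coe_toNNReal hconst]
  calc ∫⁻ z, gaussOp α μ (fockAbs α f) z ^ q ∂ν
      ≤ ∫⁻ z, (∑' k : net n, (E * (D * (∫⁻ v in Metric.ball (k : Cn n) 2,
          fockAbs α f v ^ p ∂ν) ^ (1 / p) * ν (Metric.ball (k : Cn n) 1) ^ (-(1 / p))) *
          μ (Metric.closedBall (k : Cn n) (1 / 2))) * gauss (α / 4) k z) ^ q ∂ν :=
        lintegral_mono fun z => ENNReal.rpow_le_rpow
          (gaussOp_le hα μ (fun k u hu => hD f hf k u hu) z) hq.le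
    _ ≤ _ := hC _
    _ = _ := by
        rw [mul_assoc, ← ENNReal.tsum_mul_left (a := (E * D) ^ q)]
        congr 2
        funext k
        set W := ν (Metric.ball (k : Cn n) 1)
        have hW0 : W ≠ 0 := hν.ne_zero k
        have hWt : W ≠ ∞ := hν.ne_top k
        set I := ∫⁻ v in Metric.ball (k : Cn n) 2, fockAbs α f v ^ p ∂ν
        set m := μ (Metric.closedBall (k : Cn n) (1 / 2))
        -- The factor `W ^ (-(1 / p))` comes from the local mean of `f`, and the extra `W` from
        -- integrating the Gaussian at `k` against `ν`.
        have e1 : (W ^ (1 / q - 1 / p)) ^ q = (W ^ (-(1 / p))) ^ q * W := by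
          rw [← ENNReal.rpow_mul, ← ENNReal.rpow_mul]
          conv_rhs => rw [← ENNReal.rpow_one W, ← ENNReal.rpow_mul, one_mul,
            ← ENNReal.rpow_add _ _ hW0 hWt]
          congr 1
          field_simp
          ring
        have e2 : I ^ (q / p) = (I ^ (1 / p)) ^ q := by
          rw [← ENNReal.rpow_mul]; congr 1; ring
        rw [e2]
        simp only [ENNReal.mul_rpow_of_nonneg _ _ hq.le]
        rw [e1]
        ring

/-- `L^p`-`L^q` bound for the dominating operator on entire functions. -/
def GaussOpBound (p q α : ℝ) (ν μ : Measure (Cn n)) (K : ℝ≥0∞) : Prop :=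
  ∀ f : Cn n → ℂ, Differentiable ℂ f →
    (∫⁻ z, gaussOp α μ (fockAbs α f) z ^ q ∂ν) ^ (1 / q) ≤
      K * (∫⁻ z, fockAbs α f z ^ p ∂ν) ^ (1 / p)

/-- The supremum is taken out of the discretised sum. What remains is an `ℓ^{q/p}` sum of local
masses, dominated by their `ℓ¹` sum because `q/p ≥ 1`, hence by the global integral because the
balls overlap boundedly. -/
theorem exists_gaussOpBound_of_le (hL : HasLocalBound α p ν) (hν : ExpDoubling ν) (hα : 0 < α)
    (hp : 0 < p) (hpq : p ≤ q) : ∃ C : ℝ≥0, ∀ μ : Measure (Cn n),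
      GaussOpBound p q α ν μ (C * ⨆ z, μ (Metric.ball z 1) *
        ν (Metric.ball z 1) ^ (1 / q - 1 / p)) := by
  have hq : 0 < q := hp.trans_le hpq
  obtain ⟨C, hC⟩ := lintegral_gaussOp_rpow_le hL hν hα hp hq
  obtain ⟨N, hN⟩ := tsum_setLIntegral_ball_le (n := n) 2
  refine ⟨C ^ (1 / q) * N ^ (1 / p), fun μ f hf => ?_⟩
  set M := ⨆ z, μ (Metric.ball z 1) * ν (Metric.ball z 1) ^ (1 / q - 1 / p)
  set I : net n → ℝ≥0∞ := fun k => ∫⁻ v in Metric.ball (k : Cn n) 2, fockAbs α f v ^ p ∂ν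
  set A := ∫⁻ z, fockAbs α f z ^ p ∂ν
  have hIA : ∑' k, I k ≤ N * A := hN ν _ ((measurable_fockAbs α hf.continuous).pow_const p)
  have h1 : ∑' k, I k ^ (q / p) ≤ (N * A) ^ (q / p) := by
    have := tsum_rpow_le_of_le_one (fun k => I k ^ (q / p)) (q := p / q) (by positivity)
      (by rwa [div_le_one hq])
    simp_rw [← ENNReal.rpow_mul, div_mul_div_cancel₀ hp.ne', div_self hq.ne', ENNReal.rpow_one]
      at this
    calc ∑' k, I k ^ (q / p) = ((∑' k, I k ^ (q / p)) ^ (p / q)) ^ (q / p) := by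
          rw [← ENNReal.rpow_mul, div_mul_div_cancel₀ hq.ne', div_self hp.ne', ENNReal.rpow_one]
      _ ≤ (N * A) ^ (q / p) := ENNReal.rpow_le_rpow (this.trans hIA) (by positivity)
  have h2 : ∫⁻ z, gaussOp α μ (fockAbs α f) z ^ q ∂ν ≤ C * (M ^ q * (N * A) ^ (q / p)) := by
    refine (hC μ f hf).trans ?_
    gcongr
    refine le_trans ?_ (mul_le_mul_right h1 _)
    rw [← ENNReal.tsum_mul_left]
    refine ENNReal.tsum_le_tsum fun k => ?_
    rw [mul_comm]
    gcongr
    refine le_trans ?_ (le_iSup _ (k : Cn n))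
    gcongr
    exact Metric.closedBall_subset_ball (by norm_num)
  refine (ENNReal.rpow_le_rpow h2 (by positivity)).trans_eq ?_
  rw [ENNReal.mul_rpow_of_nonneg _ _ (by positivity), ENNReal.mul_rpow_of_nonneg _ _ (by positivity),
    ← ENNReal.rpow_mul, ← ENNReal.rpow_mul, mul_one_div_cancel hq.ne', ENNReal.rpow_one,
    show q / p * (1 / q) = 1 / p by field_simp, ENNReal.mul_rpow_of_nonneg _ _ (by positivity),
    ENNReal.coe_mul, ENNReal.coe_rpow_of_nonneg _ (by positivity),
    ENNReal.coe_rpow_of_nonneg _ (by positivity)]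
  ring

theorem tsum_mul_le_Lp_mul_Lq {ι : Type*} {s t : ℝ} (hst : s.HolderConjugate t)
    (a b : ι → ℝ≥0∞) : ∑' k, a k * b k ≤ (∑' k, a k ^ s) ^ (1 / s) * (∑' k, b k ^ t) ^ (1 / t) := by
  let _ : MeasurableSpace ι := ⊤
  have := ENNReal.lintegral_mul_le_Lp_mul_Lq (Measure.count : Measure ι) hst (f := a) (g := b)
    (Measurable.of_discrete).aemeasurable (Measurable.of_discrete).aemeasurable
  simpa [lintegral_count] using this

/-- Each value on the net is dominated by the values of `H_μ` on a ball. -/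
theorem measure_closedBall_half_mul_le (hν : ExpDoubling ν) (e : ℝ) : ∃ K : ℝ≥0,
    ∀ (μ : Measure (Cn n)) (x z : Cn n), dist z x < 1 / 2 →
      μ (Metric.closedBall x (1 / 2)) * ν (Metric.ball x 1) ^ e ≤
        K * (μ (Metric.ball z 1) * ν (Metric.ball z 1) ^ e) := by
  obtain ⟨K, hK⟩ := hν.rpow_le_of_dist_le e (1 / 2)
  refine ⟨K, fun μ x z hz => ?_⟩
  rw [mul_left_comm]
  refine mul_le_mul' (measure_mono fun u hu => ?_) (hK x z (by rw [dist_comm]; exact hz.le))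
  have := dist_triangle u x z
  rw [dist_comm x z] at this
  rw [Metric.mem_ball]
  have h2 := Metric.mem_closedBall.1 hu
  linarith

/-- The term at `k` is at most a constant times the integrand at every point of `B_{1/2}(k)`;
averaging over this ball and bounded overlap give the integral. -/
theorem tsum_net_rpow_le_lintegral (hν : ExpDoubling ν) (e : ℝ) {r : ℝ} (hr : 0 < r) :
    ∃ C : ℝ≥0, ∀ (μ : Measure (Cn n)),
      Measurable (fun z => μ (Metric.ball z 1) * ν (Metric.ball z 1) ^ e) →
      ∑' k : net n, (μ (Metric.closedBall (k : Cn n) (1 / 2)) * ν (Metric.ball (k : Cn n) 1) ^ e) ^ r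
        ≤ C * ∫⁻ z, (μ (Metric.ball z 1) * ν (Metric.ball z 1) ^ e) ^ r := by
  obtain ⟨K, hK⟩ := measure_closedBall_half_mul_le hν e
  obtain ⟨N, hN⟩ := tsum_setLIntegral_ball_le (n := n) (1 / 2)
  set b := volume (Metric.ball (0 : Cn n) (1 / 2)) with hb
  have hb0 : b ≠ 0 := (Metric.measure_ball_pos volume (0 : Cn n) (by norm_num)).ne'
  have hbt : b ≠ ∞ := measure_ball_lt_top.ne
  have hc : (K : ℝ≥0∞) ^ r * N / b ≠ ∞ := ENNReal.div_ne_top (ENNReal.mul_ne_top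
    (ENNReal.rpow_ne_top_of_nonneg hr.le ENNReal.coe_ne_top) ENNReal.coe_ne_top) hb0
  refine ⟨((K : ℝ≥0∞) ^ r * N / b).toNNReal, fun μ hm => ?_⟩
  rw [ENNReal.coe_toNNReal hc, ← ENNReal.mul_div_right_comm,
    ENNReal.le_div_iff_mul_le (Or.inl hb0) (Or.inl hbt), ← ENNReal.tsum_mul_right, mul_assoc]
  refine le_trans ?_ (mul_le_mul_right (hN volume _ (hm.pow_const r)) _)
  rw [← ENNReal.tsum_mul_left]
  refine ENNReal.tsum_le_tsum fun k => ?_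
  rw [hb, ← Measure.addHaar_ball_center volume (k : Cn n), ← setLIntegral_const,
    ← lintegral_const_mul _ (hm.pow_const r)]
  refine setLIntegral_mono' measurableSet_ball fun z hz => ?_
  rw [← ENNReal.mul_rpow_of_nonneg _ _ hr.le]
  exact ENNReal.rpow_le_rpow (hK μ _ _ hz) hr.le

/-- Hölder's inequality on the lattice with the conjugate exponents `p/q` and `r/q`, where `r =
pq/(p-q)`. The first factor collects the local masses of `f`, the second the lattice values of the
symbol. -/
theorem exists_gaussOpBound_of_lt (hL : HasLocalBound α p ν) (hν : ExpDoubling ν) (hα : 0 < α)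
    (hq : 0 < q) (hpq : q < p) : ∃ C : ℝ≥0, ∀ μ : Measure (Cn n),
      Measurable (fun z => μ (Metric.ball z 1) * ν (Metric.ball z 1) ^ (1 / q - 1 / p)) →
      GaussOpBound p q α ν μ (C * (∫⁻ z, (μ (Metric.ball z 1) *
        ν (Metric.ball z 1) ^ (1 / q - 1 / p)) ^ (p * q / (p - q))) ^ (1 / (p * q / (p - q)))) := by
  have hp : 0 < p := hq.trans hpq
  have hpq' : 0 < p - q := by linarith
  set r := p * q / (p - q) with hr
  have hr0 : 0 < r := by positivity
  obtain ⟨C, hC⟩ := lintegral_gaussOp_rpow_le hL hν hα hp hq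
  obtain ⟨N, hN⟩ := tsum_setLIntegral_ball_le (n := n) 2
  obtain ⟨D, hD⟩ := tsum_net_rpow_le_lintegral hν (1 / q - 1 / p) hr0
  refine ⟨C ^ (1 / q) * N ^ (1 / p) * D ^ (1 / r), fun μ hm f hf => ?_⟩
  set J := ∫⁻ z, (μ (Metric.ball z 1) * ν (Metric.ball z 1) ^ (1 / q - 1 / p)) ^ r
  set I : net n → ℝ≥0∞ := fun k => ∫⁻ v in Metric.ball (k : Cn n) 2, fockAbs α f v ^ p ∂ν with hI
  set A := ∫⁻ z, fockAbs α f z ^ p ∂ν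
  have hIA : ∑' k, I k ≤ N * A := hN ν _ ((measurable_fockAbs α hf.continuous).pow_const p)
  have hst : (p / q).HolderConjugate (r / q) := by
    rw [Real.holderConjugate_iff]
    refine ⟨by rwa [one_lt_div hq], ?_⟩
    rw [hr]; field_simp; ring
  have h2 : ∫⁻ z, gaussOp α μ (fockAbs α f) z ^ q ∂ν ≤
      C * ((N * A) ^ (q / p) * (D * J) ^ (q / r)) := by
    refine (hC μ f hf).trans ?_
    gcongr
    refine (tsum_mul_le_Lp_mul_Lq hst _ _).trans ?_
    simp_rw [← ENNReal.rpow_mul, one_div_div]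
    rw [div_mul_div_cancel₀ hp.ne', div_self hq.ne', mul_div_cancel₀ r hq.ne']
    simp_rw [ENNReal.rpow_one]
    gcongr
    exact hD μ hm
  refine (ENNReal.rpow_le_rpow h2 (by positivity)).trans_eq ?_
  rw [ENNReal.mul_rpow_of_nonneg _ _ (by positivity), ENNReal.mul_rpow_of_nonneg _ _ (by positivity),
    ← ENNReal.rpow_mul, ← ENNReal.rpow_mul,
    show q / p * (1 / q) = 1 / p by field_simp, show q / r * (1 / q) = 1 / r by field_simp,
    ENNReal.mul_rpow_of_nonneg _ _ (by positivity), ENNReal.mul_rpow_of_nonneg _ _ (by positivity),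
    ENNReal.coe_mul, ENNReal.coe_mul, ENNReal.coe_rpow_of_nonneg _ (by positivity),
    ENNReal.coe_rpow_of_nonneg _ (by positivity), ENNReal.coe_rpow_of_nonneg _ (by positivity)]
  ring

end LocalBound

/-! ### Absolute convergence and holomorphy of `T^α_μ f` -/

section Entire

variable {ν μ : Measure (Cn n)} {α p q : ℝ}

/-- On the cell of `k`, `|f| e^{-α|·|²/2}` is `O(W^{-1/p})` and `μ` has mass `O(W^{1/p-1/q})`, where
`W = ν(B_1(k))`. Their product is `O(W^{-1/q})`, which grows at most exponentially in `|k|`, so the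
Gaussian makes the sum over the cells converge. -/
theorem lintegral_fockAbs_mul_exp_lt_top (hL : HasLocalBound α p ν) (hν : ExpDoubling ν)
    (hα : 0 < α) (hp : 0 < p)
    (hμ : ∃ M : ℝ≥0, ∀ k : net n, μ (Metric.closedBall (k : Cn n) (1 / 2)) *
      ν (Metric.ball (k : Cn n) 1) ^ (1 / q - 1 / p) ≤ M)
    {f : Cn n → ℂ} (hf : Differentiable ℂ f) (hfp : ∫⁻ z, fockAbs α f z ^ p ∂ν < ∞)
    {b : ℝ} (hb : 0 ≤ b) :
    ∫⁻ u, fockAbs α f u * ENNReal.ofReal (Real.exp (b * ‖u‖)) * gauss (α / 2) 0 u ∂μ < ∞ := by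
  obtain ⟨D, hD⟩ := hL.fockAbs_le hν hp
  obtain ⟨C, c, hC, hc, hW⟩ := hν.rpow_growth (-(1 / q))
  obtain ⟨M, hM⟩ := hμ
  obtain ⟨N, hN⟩ := tsum_gauss_le (n := n) (c := α / 4 / 2) (by positivity)
  set E := ENNReal.ofReal (Real.exp (α / 2 * (1 / 2) ^ 2))
  set A := (∫⁻ z, fockAbs α f z ^ p ∂ν) ^ (1 / p)
  have hA : A ≠ ∞ := ENNReal.rpow_ne_top_of_nonneg (by positivity) hfp.ne
  set W0 := ν (Metric.ball (0 : Cn n) 1) ^ (-(1 / q))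
  have hW0 : W0 ≠ ∞ := hν.rpow_ne_top _ _
  set B := ENNReal.ofReal (Real.exp (b / 2))
  set G := ENNReal.ofReal (Real.exp ((b + c) ^ 2 / (2 * (α / 4))))
  have hterm : ∀ k : net n, ∫⁻ u in Metric.closedBall (k : Cn n) (1 / 2),
      fockAbs α f u * ENNReal.ofReal (Real.exp (b * ‖u‖)) * gauss (α / 2) 0 u ∂μ ≤
      (D * A * B * E * M * ENNReal.ofReal C * W0 * G) * gauss (α / 4 / 2) (k : Cn n) 0 := by
    intro k
    set W := ν (Metric.ball (k : Cn n) 1) with hWdef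
    set d := dist (k : Cn n) 0
    have hsplit : W ^ (-(1 / p)) = W ^ (1 / q - 1 / p) * W ^ (-(1 / q)) := by
      rw [← ENNReal.rpow_add _ _ (hν.ne_zero k) (hν.ne_top k)]; congr 1; ring
    have hexp : ENNReal.ofReal (Real.exp (b * d)) * ENNReal.ofReal (Real.exp (c * d)) *
        gauss (α / 4) (k : Cn n) 0 ≤ G * gauss (α / 4 / 2) (k : Cn n) 0 := by
      rw [← ENNReal.ofReal_mul (Real.exp_nonneg _), ← Real.exp_add, ← add_mul]
      exact exp_mul_gauss_le (by positivity) _ _ _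
    calc ∫⁻ u in Metric.closedBall (k : Cn n) (1 / 2),
          fockAbs α f u * ENNReal.ofReal (Real.exp (b * ‖u‖)) * gauss (α / 2) 0 u ∂μ
        ≤ ∫⁻ u in Metric.closedBall (k : Cn n) (1 / 2), (D * A * W ^ (-(1 / p))) *
          (B * ENNReal.ofReal (Real.exp (b * d))) * (E * gauss (α / 4) (k : Cn n) 0) ∂μ := by
          refine setLIntegral_mono' Metric.isClosed_closedBall.measurableSet fun u hu => ?_
          refine mul_le_mul' (mul_le_mul' ((hD f hf k u hu).trans ?_) ?_) ?_
          · gcongr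
            exact ENNReal.rpow_le_rpow (setLIntegral_le_lintegral _ _) (by positivity)
          · rw [← ENNReal.ofReal_mul (Real.exp_nonneg _), ← Real.exp_add]
            refine ENNReal.ofReal_le_ofReal (Real.exp_le_exp.2 ?_)
            have h1 : ‖u‖ ≤ 1 / 2 + d := by
              have := dist_triangle u k 0
              rw [dist_zero_right] at this
              have h2 := Metric.mem_closedBall.1 hu
              linarith
            nlinarith
          · rw [gauss_comm, show α / 4 = α / 2 / 2 by ring]
            exact gauss_le_of_dist_le (by positivity) hu 0
      _ = D * A * B * E * (μ (Metric.closedBall (k : Cn n) (1 / 2)) * W ^ (1 / q - 1 / p)) *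
          W ^ (-(1 / q)) * ENNReal.ofReal (Real.exp (b * d)) * gauss (α / 4) (k : Cn n) 0 := by
          rw [setLIntegral_const, hsplit]; ring
      _ ≤ D * A * B * E * M * (ENNReal.ofReal (C * Real.exp (c * d)) * W0) *
          ENNReal.ofReal (Real.exp (b * d)) * gauss (α / 4) (k : Cn n) 0 := by
          gcongr
          · exact hM k
          · exact hW _ _
      _ = D * A * B * E * M * ENNReal.ofReal C * W0 * (ENNReal.ofReal (Real.exp (b * d)) *
          ENNReal.ofReal (Real.exp (c * d)) * gauss (α / 4) (k : Cn n) 0) := by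
          rw [ENNReal.ofReal_mul hC.le]; ring
      _ ≤ D * A * B * E * M * ENNReal.ofReal C * W0 * (G * gauss (α / 4 / 2) (k : Cn n) 0) := by gcongr
      _ = _ := by ring
  refine ((lintegral_le_tsum_net μ _).trans (ENNReal.tsum_le_tsum hterm)).trans_lt ?_
  rw [ENNReal.tsum_mul_left]
  refine ENNReal.mul_lt_top ?_ ((hN 0).trans_lt ENNReal.coe_lt_top)
  exact lt_top_iff_ne_top.2 (by finiteness)

theorem integrable_toeplitzIntegrand (hα : 0 < α) {f : Cn n → ℂ} (hf : Continuous f)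
    (h : ∀ b : ℝ, 0 ≤ b → ∫⁻ u, fockAbs α f u * ENNReal.ofReal (Real.exp (b * ‖u‖)) *
      gauss (α / 2) 0 u ∂μ < ∞) (z : Cn n) : Integrable (toeplitzIntegrand α f z) μ :=
  ⟨(continuous_toeplitzIntegrand α hf z).aestronglyMeasurable,
    (lintegral_mono fun u => enorm_toeplitzIntegrand_le hα f z u).trans_lt
      (h (α * ‖z‖) (by positivity))⟩

theorem hasFDerivAt_toeplitzIntegrand (α : ℝ) (f : Cn n → ℂ) (u z : Cn n) :
    HasFDerivAt (fun z => toeplitzIntegrand α f z u)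
      ((toeplitzIntegrand α f z u * α) • innerSL ℂ u) z := by
  unfold toeplitzIntegrand
  have h1 : HasFDerivAt (fun z : Cn n => (α : ℂ) * inner ℂ u z - (α : ℂ) * (‖u‖ : ℂ) ^ 2)
      ((α : ℂ) • innerSL ℂ u) z := by
    refine HasFDerivAt.sub_const _ ?_
    exact ((innerSL ℂ u).hasFDerivAt (x := z)).const_mul (α : ℂ)
  refine (h1.cexp.const_mul (f u)).congr_fderiv ?_
  rw [smul_smul, smul_smul]

theorem differentiable_toeplitz (hα : 0 < α) {f : Cn n → ℂ} (hf : Continuous f)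
    (h : ∀ b : ℝ, 0 ≤ b → ∫⁻ u, fockAbs α f u * ENNReal.ofReal (Real.exp (b * ‖u‖)) *
      gauss (α / 2) 0 u ∂μ < ∞) : Differentiable ℂ (toeplitz α μ f) := by
  intro z₀
  -- `α(‖z₀‖ + 1)` serves all `z` in the unit ball about `z₀`; the extra `1` absorbs the factor `‖u‖
  -- ≤ e^{‖u‖}` from differentiating the kernel.
  set b := α * (‖z₀‖ + 1) + 1 with hb
  have hb0 : 0 ≤ b := by positivity
  set bound : Cn n → ℝ := fun u => α * (‖f u‖ * Real.exp (-(α / 2) * ‖u‖ ^ 2) *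
    Real.exp (b * ‖u‖) * Real.exp (-(α / 2) * dist 0 u ^ 2)) with hbound
  have hbound_e : ∀ u, ‖bound u‖ₑ = ENNReal.ofReal α *
      (fockAbs α f u * ENNReal.ofReal (Real.exp (b * ‖u‖)) * gauss (α / 2) 0 u) := fun u => by
    rw [Real.enorm_of_nonneg (by positivity), hbound, ENNReal.ofReal_mul hα.le,
      ENNReal.ofReal_mul (by positivity), ENNReal.ofReal_mul (by positivity),
      ENNReal.ofReal_mul (by positivity), ofReal_norm, fockAbs, gauss]
  have hbi : Integrable bound μ := by
    refine ⟨Continuous.aestronglyMeasurable (by fun_prop), ?_⟩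
    rw [hasFiniteIntegral_iff_enorm]
    simp_rw [hbound_e]
    rw [lintegral_const_mul' _ _ ENNReal.ofReal_ne_top]
    exact ENNReal.mul_lt_top ENNReal.ofReal_lt_top (h b hb0)
  have hd := hasFDerivAt_integral_of_dominated_of_fderiv_le (𝕜 := ℂ) (μ := μ) (x₀ := z₀)
    (F := fun z u => toeplitzIntegrand α f z u)
    (F' := fun z u => (toeplitzIntegrand α f z u * α) • innerSL ℂ u) (bound := bound)
    (s := Metric.ball z₀ 1) (Metric.ball_mem_nhds z₀ one_pos)
    (Eventually.of_forall fun z => (continuous_toeplitzIntegrand α hf z).aestronglyMeasurable)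
    (integrable_toeplitzIntegrand hα hf h z₀) ?_ ?_ hbi
    (Eventually.of_forall fun u z _ => hasFDerivAt_toeplitzIntegrand α f u z)
  · exact hd.differentiableAt
  · refine Continuous.aestronglyMeasurable ?_
    exact ((continuous_toeplitzIntegrand α hf z₀).mul continuous_const).smul
      (innerSL ℂ).continuous
  · refine Eventually.of_forall fun u z hz => ?_
    have hz' : ‖z‖ ≤ ‖z₀‖ + 1 := by
      have h1 := norm_le_norm_add_norm_sub' z z₀
      have h2 := (mem_ball_iff_norm.1 hz).le
      linarith
    have hnn : 0 ≤ bound u := by positivity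
    rw [← Real.norm_of_nonneg hnn, ← enorm_le_iff_norm_le, hbound_e]
    have hn : ‖(innerSL ℂ u : Cn n →L[ℂ] ℂ)‖ₑ = ‖u‖ₑ := by
      rw [← ofReal_norm, innerSL_apply_norm, ofReal_norm]
    rw [enorm_smul, enorm_mul, hn]
    have e1 : ‖(α : ℂ)‖ₑ = ENNReal.ofReal α := by
      rw [← ofReal_norm, Complex.norm_real, Real.norm_of_nonneg hα.le]
    have e2 : ‖u‖ₑ ≤ ENNReal.ofReal (Real.exp ‖u‖) := by
      rw [← ofReal_norm]
      exact ENNReal.ofReal_le_ofReal ((lt_add_one _).le.trans (Real.add_one_le_exp _))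
    rw [e1]
    calc ‖toeplitzIntegrand α f z u‖ₑ * ENNReal.ofReal α * ‖u‖ₑ
        ≤ (fockAbs α f u * ENNReal.ofReal (Real.exp (α * ‖z‖ * ‖u‖)) * gauss (α / 2) 0 u) *
          ENNReal.ofReal α * ENNReal.ofReal (Real.exp ‖u‖) := by
          gcongr
          exact enorm_toeplitzIntegrand_le hα f z u
      _ = ENNReal.ofReal α * (fockAbs α f u * (ENNReal.ofReal (Real.exp (α * ‖z‖ * ‖u‖)) *
          ENNReal.ofReal (Real.exp ‖u‖)) * gauss (α / 2) 0 u) := by ring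
      _ ≤ _ := by
          gcongr
          rw [← ENNReal.ofReal_mul (Real.exp_nonneg _), ← Real.exp_add]
          refine ENNReal.ofReal_le_ofReal (Real.exp_le_exp.2 ?_)
          rw [hb]
          nlinarith [mul_nonneg (mul_nonneg hα.le (sub_nonneg.2 hz')) (norm_nonneg u)]

end Entire

section Fock

variable {w : Cn n → ℝ} {μ : Measure (Cn n)} {α p q : ℝ}

theorem MemFock.lintegral_lt_top (hw : IsWeight w) (hp : 0 < p) {f : Cn n → ℂ}
    (hf : MemFock p α w f) : ∫⁻ z, fockAbs α f z ^ p ∂(weightMeasure w) < ∞ := by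
  rw [← fockNorm_rpow hw hp α hf.1.continuous]
  exact ENNReal.rpow_lt_top_of_nonneg hp.le hf.2.ne

/-- A uniform bound on the cells of the lattice is all that is required of `μ`. Both a bounded and
an `L^r` symbol provide it, so the two ranges of exponents share this argument. -/
theorem toeplitz_properties (hw : RestrictedAInfty w) (hα : 0 < α) (hp : 0 < p)
    (hμ : ∃ M : ℝ≥0, ∀ k : net n, μ (Metric.closedBall (k : Cn n) (1 / 2)) *
      weightMeasure w (Metric.ball (k : Cn n) 1) ^ (1 / q - 1 / p) ≤ M)
    {f : Cn n → ℂ} (hf : MemFock p α w f) :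
    (∀ z, Integrable (toeplitzIntegrand α f z) μ) ∧ Differentiable ℂ (toeplitz α μ f) := by
  have h := fun b hb => lintegral_fockAbs_mul_exp_lt_top (hw.hasLocalBound hα hp) hw.expDoubling
    hα hp hμ hf.1 (hf.lintegral_lt_top hw.exists_localAs.1 hp) (b := b) hb
  exact ⟨integrable_toeplitzIntegrand hα hf.1.continuous h,
    differentiable_toeplitz hα hf.1.continuous h⟩

theorem fockNorm_toeplitz_le (hw : RestrictedAInfty w) (hα : 0 < α) (hp : 0 < p) (hq : 0 < q)
    (hμ : ∃ M : ℝ≥0, ∀ k : net n, μ (Metric.closedBall (k : Cn n) (1 / 2)) *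
      weightMeasure w (Metric.ball (k : Cn n) 1) ^ (1 / q - 1 / p) ≤ M)
    {K : ℝ≥0∞} (hK : GaussOpBound p q α (weightMeasure w) μ K)
    {f : Cn n → ℂ} (hf : MemFock p α w f) :
    fockNorm q α w (toeplitz α μ f) ≤ K * fockNorm p α w f := by
  have hwt := hw.exists_localAs.1
  rw [fockNorm_eq hwt hq α (toeplitz_properties hw hα hp hμ hf).2.continuous,
    fockNorm_eq hwt hp α hf.1.continuous]
  refine le_trans ?_ (hK f hf.1)
  gcongr
  exact fockAbs_toeplitz_le α μ f _

theorem toeplitzMaps_of_gaussOpBound (hw : RestrictedAInfty w) (hα : 0 < α) (hp : 0 < p)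
    (hq : 0 < q)
    (hμ : ∃ M : ℝ≥0, ∀ k : net n, μ (Metric.closedBall (k : Cn n) (1 / 2)) *
      weightMeasure w (Metric.ball (k : Cn n) 1) ^ (1 / q - 1 / p) ≤ M)
    {K : ℝ≥0∞} (hKt : K ≠ ∞) (hK : GaussOpBound p q α (weightMeasure w) μ K) :
    ToeplitzMaps p q α w μ := fun f =>
  ⟨(toeplitz_properties hw hα hp hμ f.2).1, (toeplitz_properties hw hα hp hμ f.2).2,
    (fockNorm_toeplitz_le hw hα hp hq hμ hK f.2).trans_lt
      (ENNReal.mul_lt_top hKt.lt_top f.2.2)⟩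

theorem toeplitzBounded_of_gaussOpBound (hw : RestrictedAInfty w) (hα : 0 < α) (hp : 0 < p)
    (hq : 0 < q)
    (hμ : ∃ M : ℝ≥0, ∀ k : net n, μ (Metric.closedBall (k : Cn n) (1 / 2)) *
      weightMeasure w (Metric.ball (k : Cn n) 1) ^ (1 / q - 1 / p) ≤ M)
    {K : ℝ≥0∞} (hKt : K ≠ ∞) (hK : GaussOpBound p q α (weightMeasure w) μ K) :
    ToeplitzBounded p q α w μ ∧ toeplitzNorm p q α w μ ≤ K := by
  refine ⟨⟨toeplitzMaps_of_gaussOpBound hw hα hp hq hμ hKt hK, K.toNNReal, fun f => ?_⟩, ?_⟩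
  · rw [ENNReal.coe_toNNReal hKt]
    exact fockNorm_toeplitz_le hw hα hp hq hμ hK f.2
  · refine iSup₂_le fun f hf => (fockNorm_toeplitz_le hw hα hp hq hμ hK f.2).trans ?_
    exact mul_le_of_le_one_right' hf

end Fock

/-! ### Lower bounds by testing on coherent states -/

/-- The coherent state `z ↦ e^{α⟨z,x⟩ - α|x|²/2}`. -/
noncomputable def coherent (α : ℝ) (x z : Cn n) : ℂ :=
  Complex.exp ((α : ℂ) * inner ℂ x z - ((α / 2 * ‖x‖ ^ 2 : ℝ) : ℂ))

theorem differentiable_coherent (α : ℝ) (x : Cn n) : Differentiable ℂ (coherent α x) :=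
  Differentiable.cexp (((innerSL ℂ x).differentiable.const_mul (α : ℂ)).sub_const _)

theorem fockAbs_coherent (α : ℝ) (x z : Cn n) : fockAbs α (coherent α x) z = gauss (α / 2) x z := by
  rw [fockAbs, coherent, gauss, ← ofReal_norm, Complex.norm_exp,
    ← ENNReal.ofReal_mul (Real.exp_nonneg _), ← Real.exp_add]
  congr 2
  have h : ‖x - z‖ ^ 2 = ‖x‖ ^ 2 - 2 * (inner ℂ x z).re + ‖z‖ ^ 2 := norm_sub_sq (𝕜 := ℂ) x z
  rw [dist_eq_norm, h, Complex.sub_re, Complex.re_ofReal_mul, Complex.ofReal_re]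
  ring

theorem fockAbs_const_smul (α : ℝ) (c : ℂ) (f : Cn n → ℂ) (z : Cn n) :
    fockAbs α (c • f) z = ‖c‖ₑ * fockAbs α f z := by
  rw [fockAbs, fockAbs, Pi.smul_apply, smul_eq_mul, enorm_mul, mul_assoc]

theorem toeplitzIntegrand_const_smul (α : ℝ) (c : ℂ) (f : Cn n → ℂ) (z u : Cn n) :
    toeplitzIntegrand α (c • f) z u = c * toeplitzIntegrand α f z u := by
  simp only [toeplitzIntegrand, Pi.smul_apply, smul_eq_mul, mul_assoc]

theorem toeplitz_const_smul (α : ℝ) (μ : Measure (Cn n)) (c : ℂ) (f : Cn n → ℂ) :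
    toeplitz α μ (c • f) = c • toeplitz α μ f := by
  funext z
  simp only [toeplitz, toeplitzIntegrand_const_smul, Pi.smul_apply, smul_eq_mul]
  exact integral_const_mul _ _

/-- At its own centre the phase of the coherent state is conjugate to that of the kernel. The
integrand is therefore positive and nothing cancels against `μ`. -/
theorem toeplitzIntegrand_coherent_self (α : ℝ) (x u : Cn n) :
    toeplitzIntegrand α (coherent α x) x u =
      ((Real.exp (α / 2 * ‖x‖ ^ 2) * Real.exp (-α * dist x u ^ 2) : ℝ) : ℂ) := by
  rw [toeplitzIntegrand, coherent, ← Complex.exp_add, ← Real.exp_add, Complex.ofReal_exp]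
  congr 1
  have h : ((‖x - u‖ ^ 2 : ℝ) : ℂ) = ‖x‖ ^ 2 - inner ℂ x u - inner ℂ u x + ‖u‖ ^ 2 := by
    have h1 := inner_self_eq_norm_sq_to_K (𝕜 := ℂ) (x - u)
    rw [inner_sub_left, inner_sub_right, inner_sub_right, inner_self_eq_norm_sq_to_K,
      inner_self_eq_norm_sq_to_K] at h1
    push_cast
    rw [show ((‖x - u‖ : ℝ) : ℂ) ^ 2 = _ from h1.symm]
    simp only [Complex.coe_algebraMap]
    ring
  rw [dist_eq_norm, Complex.ofReal_add, Complex.ofReal_mul (-α), h]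
  push_cast
  ring

theorem fockAbs_toeplitz_coherent_self {α : ℝ} {μ : Measure (Cn n)} {x : Cn n}
    (h : Integrable (toeplitzIntegrand α (coherent α x) x) μ) :
    fockAbs α (toeplitz α μ (coherent α x)) x = ∫⁻ u, gauss α x u ∂μ := by
  have hfun : toeplitzIntegrand α (coherent α x) x = fun u =>
      ((Real.exp (α / 2 * ‖x‖ ^ 2) * Real.exp (-α * dist x u ^ 2) : ℝ) : ℂ) := by
    funext u; exact toeplitzIntegrand_coherent_self α x u
  have hr : Integrable (fun u => Real.exp (α / 2 * ‖x‖ ^ 2) * Real.exp (-α * dist x u ^ 2)) μ := by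
    rw [hfun] at h
    exact h.re
  rw [fockAbs, toeplitz, hfun]
  beta_reduce
  rw [integral_complex_ofReal, ← ofReal_norm, Complex.norm_real,
    Real.norm_of_nonneg (integral_nonneg fun u => by positivity),
    ofReal_integral_eq_lintegral_ofReal hr (Eventually.of_forall fun u => by positivity),
    ← lintegral_mul_const' _ _ ENNReal.ofReal_ne_top]
  refine lintegral_congr fun u => ?_
  rw [← ENNReal.ofReal_mul (by positivity), gauss, mul_right_comm, ← Real.exp_add]
  have : α / 2 * ‖x‖ ^ 2 + -(α / 2) * ‖x‖ ^ 2 = 0 := by ring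
  rw [this, Real.exp_zero, one_mul]

theorem measure_ball_le_lintegral_gauss {α : ℝ} (hα : 0 < α) (μ : Measure (Cn n)) (x : Cn n)
    (R : ℝ) : μ (Metric.ball x R) ≤
      ENNReal.ofReal (Real.exp (α * R ^ 2)) * ∫⁻ u, gauss α x u ∂μ := by
  rw [← lintegral_const_mul _ (measurable_gauss _ _), ← setLIntegral_one]
  refine le_trans ?_ (setLIntegral_le_lintegral (Metric.ball x R) _)
  refine setLIntegral_mono' measurableSet_ball fun u hu => ?_
  rw [gauss, ← ENNReal.ofReal_mul (Real.exp_nonneg _), ← Real.exp_add, ENNReal.one_le_ofReal,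
    Real.one_le_exp_iff]
  rw [Metric.mem_ball, dist_comm] at hu
  have : dist x u ^ 2 ≤ R ^ 2 := pow_le_pow_left₀ dist_nonneg hu.le 2
  nlinarith

section

variable {w : Cn n → ℝ} {μ : Measure (Cn n)} {α p q : ℝ}

theorem fockNorm_const_smul (hw : IsWeight w) (hp : 0 < p) (α : ℝ) (c : ℂ) {f : Cn n → ℂ}
    (hf : Continuous f) : fockNorm p α w (c • f) = ‖c‖ₑ * fockNorm p α w f := by
  have hm := (measurable_fockAbs α hf).pow_const p
  rw [fockNorm_eq hw hp α hf, fockNorm_eq hw hp α (hf.const_smul c)]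
  simp_rw [fockAbs_const_smul, ENNReal.mul_rpow_of_nonneg _ _ hp.le]
  rw [lintegral_const_mul _ hm, ENNReal.mul_rpow_of_nonneg _ _ (by positivity),
    ← ENNReal.rpow_mul, mul_one_div_cancel hp.ne', ENNReal.rpow_one]

/-- The multiple `c f` of an element of the Fock space. -/
def Fock.smul (hw : IsWeight w) (hp : 0 < p) (c : ℂ) (f : Fock n p α w) : Fock n p α w :=
  ⟨c • f.1, f.2.1.const_smul c, by
    rw [fockNorm_const_smul hw hp α c f.2.1.continuous]
    exact ENNReal.mul_lt_top enorm_lt_top f.2.2⟩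

theorem ToeplitzBounded.toeplitzNorm_lt_top (hT : ToeplitzBounded p q α w μ) :
    toeplitzNorm p q α w μ < ∞ := by
  obtain ⟨-, C, hC⟩ := hT
  refine lt_of_le_of_lt (iSup₂_le fun f hf => ?_) (ENNReal.coe_lt_top (r := C))
  exact (hC f).trans (mul_le_of_le_one_right' hf)

theorem HasLocalBound.fockAbs_mul_le {ν : Measure (Cn n)} (hL : HasLocalBound α q ν)
    (hq : 0 < q) : ∃ C : ℝ≥0, ∀ g : Cn n → ℂ, Differentiable ℂ g → ∀ x,
      fockAbs α g x * ν (Metric.ball x 1) ^ (1 / q) ≤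
        C * (∫⁻ u in Metric.ball x 1, fockAbs α g u ^ q ∂ν) ^ (1 / q) := by
  obtain ⟨C, hC⟩ := hL
  refine ⟨C ^ (1 / q), fun g hg x => ?_⟩
  have := ENNReal.rpow_le_rpow (hC g hg x) (by positivity : 0 ≤ 1 / q)
  rwa [ENNReal.mul_rpow_of_nonneg _ _ (by positivity), ENNReal.mul_rpow_of_nonneg _ _
    (by positivity), ← ENNReal.rpow_mul, mul_one_div_cancel hq.ne', ENNReal.rpow_one,
    ← ENNReal.coe_rpow_of_nonneg _ (by positivity)] at this

theorem fockNorm_toeplitz_le_toeplitzNorm_mul (hw : RestrictedAInfty w) (hα : 0 < α) (hp : 0 < p)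
    (hq : 0 < q) (hT : ToeplitzMaps p q α w μ) (f : Fock n p α w) :
    fockNorm q α w (toeplitz α μ f.1) ≤ toeplitzNorm p q α w μ * fockNorm p α w f.1 := by
  have hwt := hw.exists_localAs.1
  -- Rescaling to the unit ball is impossible at norm zero. There the local mean value estimate
  -- forces `f = 0`, written as `0 • f` so that homogeneity finishes the case.
  by_cases h0 : fockNorm p α w f.1 = 0
  · obtain ⟨C, hC⟩ := (hw.hasLocalBound hα hp).fockAbs_mul_le hp
    have hf : f.1 = (0 : ℂ) • f.1 := by
      funext x
      have h1 : (∫⁻ u in Metric.ball x 1, fockAbs α f.1 u ^ p ∂(weightMeasure w)) ^ (1 / p) ≤ 0 := by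
        rw [← h0, fockNorm_eq hwt hp α f.2.1.continuous]
        exact ENNReal.rpow_le_rpow (setLIntegral_le_lintegral _ _) (by positivity)
      have h2 := (hC f.1 f.2.1 x).trans (mul_le_mul' le_rfl h1)
      rw [mul_zero, nonpos_iff_eq_zero, mul_eq_zero, or_iff_left (hw.expDoubling.rpow_ne_zero _ x),
        fockAbs, mul_eq_zero] at h2
      have h3 : ENNReal.ofReal (Real.exp (-(α / 2) * ‖x‖ ^ 2)) ≠ 0 := by
        simpa using Real.exp_pos _
      simpa using h2.resolve_right h3
    rw [hf, toeplitz_const_smul, fockNorm_const_smul hwt hq α _ (hT f).2.1.continuous]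
    simp
  have ht : fockNorm p α w f.1 ≠ ∞ := f.2.2.ne
  set t := (fockNorm p α w f.1).toReal
  have htpos : 0 < t := ENNReal.toReal_pos h0 ht
  have hte : ENNReal.ofReal t = fockNorm p α w f.1 := ENNReal.ofReal_toReal ht
  have hce : ‖((t⁻¹ : ℝ) : ℂ)‖ₑ = (fockNorm p α w f.1)⁻¹ := by
    rw [← ofReal_norm, Complex.norm_real, Real.norm_of_nonneg (by positivity),
      ENNReal.ofReal_inv_of_pos htpos, hte]
  have h1 : fockNorm p α w (Fock.smul hwt hp ((t⁻¹ : ℝ) : ℂ) f).1 ≤ 1 := by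
    change fockNorm p α w (((t⁻¹ : ℝ) : ℂ) • f.1) ≤ 1
    rw [fockNorm_const_smul hwt hp α _ f.2.1.continuous, hce, ENNReal.inv_mul_cancel h0 ht]
  have h2 : fockNorm q α w (toeplitz α μ (((t⁻¹ : ℝ) : ℂ) • f.1)) ≤ toeplitzNorm p q α w μ :=
    le_iSup₂ (f := fun (f : Fock n p α w) (_ : fockNorm p α w f.1 ≤ 1) =>
      fockNorm q α w (toeplitz α μ f.1)) (Fock.smul hwt hp ((t⁻¹ : ℝ) : ℂ) f) h1
  rw [toeplitz_const_smul, fockNorm_const_smul hwt hq α _ (hT f).2.1.continuous, hce] at h2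
  rwa [mul_comm, ← div_eq_mul_inv, ENNReal.div_le_iff h0 ht] at h2

/-- The modulus of the coherent state with its Fock factor is a Gaussian at `x`, whose `p`-th power
has integral `O(w(B_1(x)))`. -/
theorem fockNorm_coherent_le (hw : RestrictedAInfty w) (hα : 0 < α) (hp : 0 < p) :
    ∃ C : ℝ≥0, 0 < C ∧ ∀ x, fockNorm p α w (coherent α x) ≤
      C * weightMeasure w (Metric.ball x 1) ^ (1 / p) := by
  obtain ⟨C, hC⟩ := hw.expDoubling.lintegral_gauss_le (c := α / 2 * p) (by positivity)
  refine ⟨(C + 1) ^ (1 / p), by positivity, fun x => ?_⟩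
  rw [fockNorm_eq hw.exists_localAs.1 hp α (differentiable_coherent α x).continuous]
  simp_rw [fockAbs_coherent, gauss_rpow _ _ _ hp.le]
  rw [ENNReal.coe_rpow_of_nonneg _ (by positivity), ← ENNReal.mul_rpow_of_nonneg _ _
    (by positivity)]
  gcongr
  refine (hC x).trans ?_
  gcongr
  simp

theorem memFock_coherent (hw : RestrictedAInfty w) (hα : 0 < α) (hp : 0 < p) (x : Cn n) :
    MemFock p α w (coherent α x) := by
  obtain ⟨C, -, hC⟩ := fockNorm_coherent_le hw hα hp
  exact ⟨differentiable_coherent α x, (hC x).trans_lt (ENNReal.mul_lt_top ENNReal.coe_lt_top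
    (hw.expDoubling.rpow_ne_top _ x).lt_top)⟩

/-- Testing `T^α_μ` on normalised coherent states. -/
theorem exists_test_function (hw : RestrictedAInfty w) (hα : 0 < α) (hp : 0 < p) :
    ∃ C : ℝ≥0, ∀ x : Cn n, ∃ f : Fock n p α w, fockNorm p α w f.1 ≤ 1 ∧
      ∀ μ : Measure (Cn n), ToeplitzMaps p q α w μ →
        μ (Metric.ball x 1) * weightMeasure w (Metric.ball x 1) ^ (1 / q - 1 / p) ≤
          C * (fockAbs α (toeplitz α μ f.1) x * weightMeasure w (Metric.ball x 1) ^ (1 / q)) := by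
  obtain ⟨C, hC0, hC⟩ := fockNorm_coherent_le hw hα hp
  refine ⟨(Real.exp (α * 1 ^ 2)).toNNReal * C, fun x => ?_⟩
  have hwt := hw.exists_localAs.1
  have hν := hw.expDoubling
  set W := weightMeasure w (Metric.ball x 1)
  set c := (C * W ^ (1 / p))⁻¹ with hcdef
  have hd0 : C * W ^ (1 / p) ≠ 0 :=
    mul_ne_zero (ENNReal.coe_ne_zero.2 hC0.ne') (hν.rpow_ne_zero _ x)
  have hdt : C * W ^ (1 / p) ≠ ∞ := ENNReal.mul_ne_top ENNReal.coe_ne_top (hν.rpow_ne_top _ x)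
  have hct : c ≠ ∞ := ENNReal.inv_ne_top.2 hd0
  have hce : ‖(c.toReal : ℂ)‖ₑ = c := by
    rw [← ofReal_norm, Complex.norm_real, Real.norm_of_nonneg ENNReal.toReal_nonneg,
      ENNReal.ofReal_toReal hct]
  refine ⟨Fock.smul hwt hp (c.toReal : ℂ) ⟨coherent α x, memFock_coherent hw hα hp x⟩, ?_, ?_⟩
  · change fockNorm p α w ((c.toReal : ℂ) • coherent α x) ≤ 1
    rw [fockNorm_const_smul hwt hp α _ (differentiable_coherent α x).continuous, hce, hcdef,
      mul_comm, ← div_eq_mul_inv]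
    exact ENNReal.div_le_of_le_mul (by rw [one_mul]; exact hC x)
  · intro μ hT
    change _ ≤ _ * (fockAbs α (toeplitz α μ ((c.toReal : ℂ) • coherent α x)) x * _)
    rw [toeplitz_const_smul, fockAbs_const_smul, hce, fockAbs_toeplitz_coherent_self
      ((hT ⟨coherent α x, memFock_coherent hw hα hp x⟩).1 x)]
    set J := ∫⁻ u, gauss α x u ∂μ
    -- The normalising factor `c` is `W ^ (-(1 / p)) / C`; this supplies the part of the exponent
    -- that involves `p`.
    have hW : W ^ (1 / q - 1 / p) = C * c * W ^ (1 / q) := by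
      have : C * c = W ^ (-(1 / p)) := by
        rw [hcdef, ENNReal.mul_inv (Or.inr (hν.rpow_ne_top _ x)) (Or.inl ENNReal.coe_ne_top),
          ← mul_assoc, ENNReal.mul_inv_cancel (ENNReal.coe_ne_zero.2 hC0.ne') ENNReal.coe_ne_top,
          one_mul, ENNReal.rpow_neg]
      rw [this, ← ENNReal.rpow_add _ _ (hν.ne_zero x) (hν.ne_top x)]
      congr 1; ring
    rw [hW]
    calc μ (Metric.ball x 1) * (C * c * W ^ (1 / q))
        ≤ (ENNReal.ofReal (Real.exp (α * 1 ^ 2)) * J) * (C * c * W ^ (1 / q)) := by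
          gcongr
          exact measure_ball_le_lintegral_gauss hα μ x 1
      _ = _ := by rw [ENNReal.coe_mul]; change _ = ENNReal.ofReal _ * _ * _; ring

/-- The value of the image of the test function at `x` is bounded by its norm through the local mean
value estimate with exponent `q`. -/
theorem measure_ball_mul_le_toeplitzNorm (hw : RestrictedAInfty w) (hα : 0 < α) (hp : 0 < p)
    (hq : 0 < q) : ∃ C : ℝ≥0, ∀ μ : Measure (Cn n), ToeplitzMaps p q α w μ → ∀ x,
      μ (Metric.ball x 1) * weightMeasure w (Metric.ball x 1) ^ (1 / q - 1 / p) ≤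
        C * toeplitzNorm p q α w μ := by
  obtain ⟨C, hC⟩ := exists_test_function (q := q) hw hα hp
  obtain ⟨D, hD⟩ := (hw.hasLocalBound hα hq).fockAbs_mul_le hq
  refine ⟨C * D, fun μ hT x => ?_⟩
  obtain ⟨f, hf, h⟩ := hC x
  refine (h μ hT).trans ?_
  rw [ENNReal.coe_mul, mul_assoc]
  refine mul_le_mul' le_rfl ((hD _ (hT f).2.1 x).trans ?_)
  gcongr
  refine le_trans ?_ (le_iSup₂ (f := fun (f : Fock n p α w) (_ : fockNorm p α w f.1 ≤ 1) =>
      fockNorm q α w (toeplitz α μ f.1)) f hf)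
  rw [fockNorm_eq hw.exists_localAs.1 hq α (hT f).2.1.continuous]
  exact ENNReal.rpow_le_rpow (setLIntegral_le_lintegral _ _) (by positivity)

theorem add_rpow_le_two_rpow_mul (x y : ℝ≥0∞) {q : ℝ} (hq : 0 ≤ q) :
    (x + y) ^ q ≤ 2 ^ q * (x ^ q + y ^ q) := by
  have h : x + y ≤ 2 * max x y := by
    rw [two_mul]; exact add_le_add (le_max_left _ _) (le_max_right _ _)
  refine (ENNReal.rpow_le_rpow h hq).trans ?_
  rw [ENNReal.mul_rpow_of_nonneg _ _ hq]
  gcongr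
  rcases le_total x y with hxy | hxy
  · rw [max_eq_right hxy]; exact le_add_self
  · rw [max_eq_left hxy]; exact le_self_add

/-- A single term is dominated in mean by the sums with random signs. -/
theorem enorm_rpow_mul_card_le_sum_signs {ι : Type*} [Fintype ι] [DecidableEq ι] (v : ι → ℂ)
    {q : ℝ} (hq : 0 ≤ q) (k : ι) :
    ‖v k‖ₑ ^ q * Fintype.card (ι → ℤˣ) ≤
      2 * 2 ^ q * ∑ e : ι → ℤˣ, ‖∑ j, ((e j : ℤ) : ℂ) * v j‖ₑ ^ q := by
  set S : (ι → ℤˣ) → ℂ := fun e => ∑ j, ((e j : ℤ) : ℂ) * v j with hS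
  -- Multiplying by `τ` flips the `k`-th sign only, so `S e - S (e * τ)` is `±2 v k`. As `e ↦ e * τ`
  -- permutes the sign patterns, both sums have the same average.
  set τ : ι → ℤˣ := Pi.mulSingle k (-1)
  have hdiff : ∀ e, S e - S (e * τ) = 2 * (((e k : ℤ) : ℂ) * v k) := fun e => by
    rw [hS]
    simp only [← Finset.sum_sub_distrib]
    rw [Finset.sum_eq_single k]
    · simp [τ]; ring
    · intro j _ hj
      simp [τ, Pi.mulSingle_eq_of_ne hj]
    · simp
  have h1 : ∀ e, ‖v k‖ₑ ≤ ‖S e‖ₑ + ‖S (e * τ)‖ₑ := fun e => by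
    refine le_trans ?_ (enorm_sub_le (a := S e) (b := S (e * τ)))
    rw [hdiff, ← ofReal_norm, ← ofReal_norm, norm_mul, norm_mul]
    refine ENNReal.ofReal_le_ofReal ?_
    have : ‖((e k : ℤ) : ℂ)‖ = 1 := by
      rcases Int.units_eq_one_or (e k) with h | h <;> simp [h]
    rw [this]
    simp
    linarith [norm_nonneg (v k)]
  have h2 : ∑ e : ι → ℤˣ, ‖S (e * τ)‖ₑ ^ q = ∑ e : ι → ℤˣ, ‖S e‖ₑ ^ q :=
    Fintype.sum_equiv (Equiv.mulRight τ) _ _ fun e => rfl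
  calc ‖v k‖ₑ ^ q * Fintype.card (ι → ℤˣ) = ∑ e : ι → ℤˣ, ‖v k‖ₑ ^ q := by
        rw [Finset.sum_const, nsmul_eq_mul, mul_comm, Finset.card_univ]
    _ ≤ ∑ e : ι → ℤˣ, 2 ^ q * (‖S e‖ₑ ^ q + ‖S (e * τ)‖ₑ ^ q) :=
        Finset.sum_le_sum fun e _ => (ENNReal.rpow_le_rpow (h1 e) hq).trans
          (add_rpow_le_two_rpow_mul _ _ hq)
    _ = _ := by
        rw [← Finset.mul_sum, Finset.sum_add_distrib, h2]; ring

end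

/-! ### Randomised sums of coherent states, for `p > q` -/

/-- A finite linear combination of coherent states centred at points of the net. -/
noncomputable def coherentSum (α : ℝ) (s : Finset (net n)) (c : s → ℂ) (z : Cn n) : ℂ :=
  ∑ j, c j * coherent α (j : net n) z

theorem differentiable_coherentSum (α : ℝ) (s : Finset (net n)) (c : s → ℂ) :
    Differentiable ℂ (coherentSum α s c) :=
  Differentiable.fun_sum fun j _ => (differentiable_coherent α _).const_mul (c j)

theorem fockAbs_coherentSum_le (α : ℝ) (s : Finset (net n)) (c : s → ℂ) (z : Cn n) :
    fockAbs α (coherentSum α s c) z ≤ ∑ j, ‖c j‖ₑ * gauss (α / 2) (j : net n) z := by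
  simp_rw [← fockAbs_coherent]
  rw [fockAbs, coherentSum]
  refine (mul_le_mul' (enorm_sum_le _ _) le_rfl).trans_eq ?_
  rw [Finset.sum_mul]
  refine Finset.sum_congr rfl fun j _ => ?_
  rw [enorm_mul, mul_assoc, fockAbs]

/-- The bound sees only the moduli of the coefficients, so it is the same for all choices of signs.
-/
theorem ExpDoubling.lintegral_coherentSum_le {ν : Measure (Cn n)} (hν : ExpDoubling ν) {α p : ℝ}
    (hα : 0 < α) (hp : 0 < p) : ∃ C : ℝ≥0, ∀ (s : Finset (net n)) (c : s → ℂ),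
      ∫⁻ z, fockAbs α (coherentSum α s c) z ^ p ∂ν ≤
        C * ∑ j, ‖c j‖ₑ ^ p * ν (Metric.ball ((j : net n) : Cn n) 1) := by
  classical
  obtain ⟨C, hC⟩ := hν.lintegral_tsum_mul_gauss_rpow_le (c := α / 2) (half_pos hα) hp
  refine ⟨C, fun s c => ?_⟩
  obtain ⟨A, hA0, hA1⟩ : ∃ A : net n → ℝ≥0∞, (∀ k ∉ s, A k = 0) ∧ ∀ j : s, A j = ‖c j‖ₑ :=
    ⟨fun k => if h : k ∈ s then ‖c ⟨k, h⟩‖ₑ else 0, fun k hk => dif_neg hk, fun j => by simp⟩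
  have hsum : ∀ (φ : ℝ≥0∞ → ℝ≥0∞) (g : net n → ℝ≥0∞), φ 0 = 0 →
      ∑' k, φ (A k) * g k = ∑ j : s, φ ‖c j‖ₑ * g j := fun φ g h0 => by
    rw [tsum_eq_sum (s := s) fun k hk => by rw [hA0 k hk, h0, zero_mul],
      ← Finset.sum_coe_sort s fun k => φ (A k) * g k]
    exact Finset.sum_congr rfl fun j _ => by rw [hA1]
  have h1 : ∀ z : Cn n, ∑' k : net n, A k * gauss (α / 2) k z =
      ∑ j : s, ‖c j‖ₑ * gauss (α / 2) (j : net n) z := fun z =>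
    hsum (fun x => x) (fun k => gauss (α / 2) (k : Cn n) z) (by simp)
  have h2 := hsum (fun x => x ^ p) (fun k => ν (Metric.ball (k : Cn n) 1)) (by simp [hp])
  rw [← h2]
  refine le_trans (lintegral_mono fun z => ENNReal.rpow_le_rpow ?_ hp.le) (hC A)
  rw [h1]
  exact fockAbs_coherentSum_le α s c z

section

variable {w : Cn n → ℝ} {α p q : ℝ}

theorem memFock_coherentSum (hw : RestrictedAInfty w) (hα : 0 < α) (hp : 0 < p)
    (s : Finset (net n)) (c : s → ℂ) : MemFock p α w (coherentSum α s c) := by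
  refine ⟨differentiable_coherentSum α s c, ?_⟩
  obtain ⟨C, hC⟩ := hw.expDoubling.lintegral_coherentSum_le hα hp
  rw [fockNorm_eq hw.exists_localAs.1 hp α (differentiable_coherentSum α s c).continuous]
  refine ENNReal.rpow_lt_top_of_nonneg (by positivity) ((hC s c).trans_lt ?_).ne
  refine ENNReal.mul_lt_top ENNReal.coe_lt_top (ENNReal.sum_lt_top.2 fun j _ => ?_)
  exact ENNReal.mul_lt_top (ENNReal.rpow_lt_top_of_nonneg hp.le enorm_ne_top)
    (hw.expDoubling.ne_top _).lt_top

theorem toeplitz_coherentSum {μ : Measure (Cn n)} {s : Finset (net n)}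
    (h : ∀ k : s, ∀ z, Integrable (toeplitzIntegrand α (coherent α ((k : net n) : Cn n)) z) μ)
    (c : s → ℂ) (z : Cn n) : toeplitz α μ (coherentSum α s c) z =
      ∑ j, c j * toeplitz α μ (coherent α ((j : net n) : Cn n)) z := by
  have : toeplitzIntegrand α (coherentSum α s c) z = fun u =>
      ∑ j, c j * toeplitzIntegrand α (coherent α ((j : net n) : Cn n)) z u := by
    funext u
    simp only [toeplitzIntegrand, coherentSum, Finset.sum_mul, mul_assoc]
  rw [toeplitz, this, integral_finsetSum _ fun j _ => (h j z).const_mul (c j)]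
  refine Finset.sum_congr rfl fun j _ => ?_
  rw [integral_const_mul, toeplitz]

/-- Testing `T^α_μ` on randomised sums of coherent states. -/
theorem exists_sum_rpow_le (hw : RestrictedAInfty w) (hα : 0 < α) (hp : 0 < p) (hq : 0 < q) :
    ∃ C : ℝ≥0, ∀ (μ : Measure (Cn n)) (B : ℝ≥0∞), ToeplitzMaps p q α w μ →
      (∀ f : Fock n p α w, fockNorm q α w (toeplitz α μ f.1) ≤ B * fockNorm p α w f.1) →
      ∀ (s : Finset (net n)) (a : s → ℝ≥0),
        ∑ k : s, (a k * (μ (Metric.ball ((k : net n) : Cn n) 2) *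
          weightMeasure w (Metric.ball ((k : net n) : Cn n) 1) ^ (1 / q - 1 / p))) ^ q ≤
        C * (B ^ q * (∑ k : s, (a k : ℝ≥0∞) ^ p) ^ (q / p)) := by
  classical
  have hwt := hw.exists_localAs.1
  have hν := hw.expDoubling
  set ν := weightMeasure w
  obtain ⟨C₁, hC₁⟩ := hw.hasLocalBound hα hq
  obtain ⟨C₂, hC₂⟩ := hν.lintegral_coherentSum_le hα hp
  obtain ⟨N, hN⟩ := tsum_setLIntegral_ball_le (n := n) 1
  set E := ENNReal.ofReal (Real.exp (α * 2 ^ 2))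
  set Q : ℝ≥0∞ := 2 * 2 ^ q with hQ
  have hconst : E ^ q * C₁ * Q * N * (C₂ : ℝ≥0∞) ^ (q / p) ≠ ∞ := by
    have h1 : E ^ q ≠ ∞ := ENNReal.rpow_ne_top_of_nonneg hq.le ENNReal.ofReal_ne_top
    have h2 : Q ≠ ∞ := ENNReal.mul_ne_top (by simp)
      (ENNReal.rpow_ne_top_of_nonneg hq.le (by simp))
    have h3 : (C₂ : ℝ≥0∞) ^ (q / p) ≠ ∞ :=
      ENNReal.rpow_ne_top_of_nonneg (by positivity) ENNReal.coe_ne_top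
    finiteness
  refine ⟨(E ^ q * C₁ * Q * N * (C₂ : ℝ≥0∞) ^ (q / p)).toNNReal, fun μ B hT hB s a => ?_⟩
  rw [ENNReal.coe_toNNReal hconst]
  set x : s → Cn n := fun k => ((k : net n) : Cn n) with hx
  change ∑ k : s, (a k * (μ (Metric.ball (x k) 2) * ν (Metric.ball (x k) 1) ^ (1 / q - 1 / p))) ^ q
    ≤ _
  have hint : ∀ k : s, ∀ z, Integrable (toeplitzIntegrand α (coherent α (x k)) z) μ := fun k z =>
    (hT ⟨_, memFock_coherent hw hα hp (x k)⟩).1 z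
  have hdiff : ∀ k : s, Differentiable ℂ (toeplitz α μ (coherent α (x k))) := fun k =>
    (hT ⟨_, memFock_coherent hw hα hp (x k)⟩).2.1
  -- The normalisation by `ν(B_1(x_k))^{-1/p}` makes the `p`-th power of the norm of the sum `O(∑
  -- a_k^p)`.
  set c : s → ℂ := fun k =>
    (((a k : ℝ≥0∞) * ν (Metric.ball (x k) 1) ^ (-(1 / p))).toReal : ℂ) with hc
  have hce : ∀ k, ‖c k‖ₑ = a k * ν (Metric.ball (x k) 1) ^ (-(1 / p)) := fun k => by
    rw [hc, ← ofReal_norm, Complex.norm_real, Real.norm_of_nonneg ENNReal.toReal_nonneg,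
      ENNReal.ofReal_toReal (ENNReal.mul_ne_top ENNReal.coe_ne_top (hν.rpow_ne_top _ _))]
  set v : s → Cn n → ℂ := fun k => c k • toeplitz α μ (coherent α (x k)) with hv
  have hvdiff : ∀ k, Differentiable ℂ (v k) := fun k => (hdiff k).const_smul (c k)
  set ce : (s → ℤˣ) → s → ℂ := fun e k => ((e k : ℤ) : ℂ) * c k with hced
  set g : (s → ℤˣ) → Cn n → ℂ := fun e => toeplitz α μ (coherentSum α s (ce e)) with hg
  have hge : ∀ e z, g e z = ∑ j, ((e j : ℤ) : ℂ) * v j z := fun e z => by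
    rw [hg]
    simp only
    rw [toeplitz_coherentSum hint]
    refine Finset.sum_congr rfl fun j _ => ?_
    simp only [hced, hv, Pi.smul_apply, smul_eq_mul, mul_assoc, hx]
  have hgm : ∀ e, MemFock q α w (g e) := fun e =>
    (hT ⟨_, memFock_coherentSum hw hα hp s (ce e)⟩).2
  have hgmeas : ∀ e, Measurable fun z => fockAbs α (g e) z ^ q := fun e =>
    (measurable_fockAbs α (hgm e).1.continuous).pow_const q
  set X := ∑ k : s, (a k : ℝ≥0∞) ^ p with hX
  have hcard0 : (Fintype.card (s → ℤˣ) : ℝ≥0∞) ≠ 0 := by simp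
  have hcardt : (Fintype.card (s → ℤˣ) : ℝ≥0∞) ≠ ∞ := ENNReal.natCast_ne_top _
  -- The diagonal terms: near `x k` only the image of the coherent state centred at `x k` is looked
  -- at, and its value at the centre controls `μ(B_2(x_k))`.
  have hterm : ∀ k : s, (a k * (μ (Metric.ball (x k) 2) *
      ν (Metric.ball (x k) 1) ^ (1 / q - 1 / p))) ^ q ≤
      E ^ q * C₁ * ∫⁻ z in Metric.ball (x k) 1, fockAbs α (v k) z ^ q ∂ν := by
    intro k
    have hJ := measure_ball_le_lintegral_gauss hα μ (x k) 2
    have hW : ν (Metric.ball (x k) 1) ^ (1 / q - 1 / p) =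
        ν (Metric.ball (x k) 1) ^ (-(1 / p)) * ν (Metric.ball (x k) 1) ^ (1 / q) := by
      rw [← ENNReal.rpow_add _ _ (hν.ne_zero _) (hν.ne_top _)]; congr 1; ring
    have hvk : fockAbs α (v k) (x k) = a k * ν (Metric.ball (x k) 1) ^ (-(1 / p)) *
        ∫⁻ u, gauss α (x k) u ∂μ := by
      rw [hv, fockAbs_const_smul, hce, fockAbs_toeplitz_coherent_self (hint k _)]
    calc (a k * (μ (Metric.ball (x k) 2) * ν (Metric.ball (x k) 1) ^ (1 / q - 1 / p))) ^ q
        ≤ (a k * ((E * ∫⁻ u, gauss α (x k) u ∂μ) *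
            ν (Metric.ball (x k) 1) ^ (1 / q - 1 / p))) ^ q := by gcongr
      _ = (E * (fockAbs α (v k) (x k) * ν (Metric.ball (x k) 1) ^ (1 / q))) ^ q := by
          rw [hvk, hW]; congr 1; ring
      _ = E ^ q * (fockAbs α (v k) (x k) ^ q * ν (Metric.ball (x k) 1)) := by
          rw [ENNReal.mul_rpow_of_nonneg _ _ hq.le, ENNReal.mul_rpow_of_nonneg _ _ hq.le,
            ← ENNReal.rpow_mul (ν _), one_div_mul_cancel hq.ne', ENNReal.rpow_one]
      _ ≤ E ^ q * (C₁ * ∫⁻ z in Metric.ball (x k) 1, fockAbs α (v k) z ^ q ∂ν) :=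
          mul_le_mul' le_rfl (hC₁ _ (hvdiff k) (x k))
      _ = _ := by ring
  have hsign : ∀ k : s, ∀ z, fockAbs α (v k) z ^ q * Fintype.card (s → ℤˣ) ≤
      Q * ∑ e, fockAbs α (g e) z ^ q := by
    intro k z
    have h := enorm_rpow_mul_card_le_sum_signs (fun j => v j z) hq.le k
    simp_rw [← hge] at h
    simp only [fockAbs, ENNReal.mul_rpow_of_nonneg _ _ hq.le]
    rw [← Finset.sum_mul, ← mul_assoc, mul_right_comm]
    gcongr
  have hnorm : ∀ e, ∫⁻ z, fockAbs α (g e) z ^ q ∂ν ≤ B ^ q * (C₂ * X) ^ (q / p) := by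
    intro e
    have h1 := hB ⟨_, memFock_coherentSum hw hα hp s (ce e)⟩
    have h2 := ENNReal.rpow_le_rpow h1 hq.le
    rw [fockNorm_rpow hwt hq α (hgm e).1.continuous, ENNReal.mul_rpow_of_nonneg _ _ hq.le,
      fockNorm_eq hwt hp α (differentiable_coherentSum α s (ce e)).continuous,
      ← ENNReal.rpow_mul, one_div_mul_eq_div] at h2
    refine h2.trans ?_
    gcongr
    refine (hC₂ s (ce e)).trans ?_
    refine mul_le_mul' le_rfl (Finset.sum_le_sum fun k _ => ?_)
    have h3 : ‖ce e k‖ₑ = ‖c k‖ₑ := by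
      have : ‖((e k : ℤ) : ℂ)‖ₑ = 1 := by
        rcases Int.units_eq_one_or (e k) with h | h <;> simp [h]
      rw [hced, enorm_mul, this, one_mul]
    rw [h3, hce, ENNReal.mul_rpow_of_nonneg _ _ hp.le, ← ENNReal.rpow_mul, mul_assoc]
    have h4 : ν (Metric.ball (x k) 1) ^ (-(1 / p) * p) * ν (Metric.ball (x k) 1) = 1 := by
      rw [show -(1 / p) * p = -1 by field_simp, ENNReal.rpow_neg_one,
        ENNReal.inv_mul_cancel (hν.ne_zero _) (hν.ne_top _)]
    rw [h4, mul_one]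
  have hsumk : ∀ e, ∑ k : s, ∫⁻ z in Metric.ball (x k) 1, fockAbs α (g e) z ^ q ∂ν ≤
      N * ∫⁻ z, fockAbs α (g e) z ^ q ∂ν := fun e => by
    refine le_trans ?_ (hN ν _ (hgmeas e))
    rw [Finset.sum_coe_sort s fun k : net n =>
      ∫⁻ z in Metric.ball (k : Cn n) 1, fockAbs α (g e) z ^ q ∂ν]
    exact ENNReal.sum_le_tsum s
  -- Each diagonal term is recovered by averaging over the signs. For every fixed sign pattern the
  -- balls overlap boundedly, so the sum over `k` costs only `N` times one global norm.
  have hmain : (∑ k : s, ∫⁻ z in Metric.ball (x k) 1, fockAbs α (v k) z ^ q ∂ν) ≤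
      Q * N * (B ^ q * (C₂ * X) ^ (q / p)) := by
    rw [← ENNReal.mul_le_mul_iff_left hcard0 hcardt, Finset.sum_mul]
    calc ∑ k : s, (∫⁻ z in Metric.ball (x k) 1, fockAbs α (v k) z ^ q ∂ν) *
          Fintype.card (s → ℤˣ)
        = ∑ k : s, ∫⁻ z in Metric.ball (x k) 1, fockAbs α (v k) z ^ q *
          Fintype.card (s → ℤˣ) ∂ν := by
          refine Finset.sum_congr rfl fun k _ => ?_
          rw [lintegral_mul_const' _ _ hcardt]
      _ ≤ ∑ k : s, ∫⁻ z in Metric.ball (x k) 1, Q * ∑ e, fockAbs α (g e) z ^ q ∂ν :=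
          Finset.sum_le_sum fun k _ => lintegral_mono fun z => hsign k z
      _ = Q * ∑ e, ∑ k : s, ∫⁻ z in Metric.ball (x k) 1, fockAbs α (g e) z ^ q ∂ν := by
          rw [Finset.sum_comm, Finset.mul_sum]
          refine Finset.sum_congr rfl fun k _ => ?_
          rw [lintegral_const_mul _ (Finset.measurable_fun_sum _ fun e _ => hgmeas e),
            lintegral_finsetSum _ fun e _ => hgmeas e]
      _ ≤ Q * ∑ e : s → ℤˣ, N * (B ^ q * (C₂ * X) ^ (q / p)) := by
          gcongr with e
          exact (hsumk e).trans (by gcongr; exact hnorm e)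
      _ = _ := by
          rw [Finset.sum_const, nsmul_eq_mul, Finset.card_univ]; ring
  calc _ ≤ ∑ k : s, E ^ q * C₁ * ∫⁻ z in Metric.ball (x k) 1, fockAbs α (v k) z ^ q ∂ν :=
        Finset.sum_le_sum fun k _ => hterm k
    _ ≤ E ^ q * C₁ * (Q * N * (B ^ q * (C₂ * X) ^ (q / p))) := by
        rw [← Finset.mul_sum]; gcongr
    _ = _ := by
        rw [ENNReal.mul_rpow_of_nonneg _ _ (by positivity)]; ring

/-- The coefficients are chosen to be extremal for the duality behind the previous estimate. It then
reads `X ≤ C B^q X^{q/p}` for every finite partial sum `X`, and `X` can be divided out because it is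
finite. -/
theorem exists_tsum_rpow_le (hw : RestrictedAInfty w) (hα : 0 < α) (hq : 0 < q) (hpq : q < p) :
    ∃ C : ℝ≥0, ∀ (μ : Measure (Cn n)) (B : ℝ≥0∞), ToeplitzMaps p q α w μ →
      (∀ f : Fock n p α w, fockNorm q α w (toeplitz α μ f.1) ≤ B * fockNorm p α w f.1) →
      (∑' k : net n, (μ (Metric.ball (k : Cn n) 2) *
        weightMeasure w (Metric.ball (k : Cn n) 1) ^ (1 / q - 1 / p)) ^ (p * q / (p - q))) ^
        (1 / (p * q / (p - q))) ≤ C * B := by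
  have hp : 0 < p := hq.trans hpq
  have hpq' : 0 < p - q := by linarith
  set r := p * q / (p - q) with hr
  have hr0 : 0 < r := by positivity
  obtain ⟨C, hC⟩ := exists_sum_rpow_le hw hα hp hq
  refine ⟨C ^ (1 / q), fun μ B hT hB => ?_⟩
  set b : net n → ℝ≥0∞ := fun k => μ (Metric.ball (k : Cn n) 2) *
    weightMeasure w (Metric.ball (k : Cn n) 1) ^ (1 / q - 1 / p) with hb
  have hbt : ∀ k, b k ≠ ∞ := fun k => by
    refine ENNReal.mul_ne_top ?_ (hw.expDoubling.rpow_ne_top _ _)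
    refine ((measure_ball_le_lintegral_gauss hα μ (k : Cn n) 2).trans_lt ?_).ne
    have hi := (hT ⟨_, memFock_coherent hw hα hp (k : Cn n)⟩).1 (k : Cn n)
    rw [← fockAbs_toeplitz_coherent_self hi, fockAbs]
    finiteness
  rw [one_div r, ENNReal.rpow_inv_le_iff hr0, ENNReal.tsum_eq_iSup_sum]
  refine iSup_le fun s => ?_
  rw [← ENNReal.rpow_inv_le_iff hr0]
  -- With `a = b^{q/(p-q)}` both `(a b)^q` and `a^p` equal `b^r`.
  have h := hC μ B hT hB s fun k => (b k).toNNReal ^ (q / (p - q))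
  change ∑ k : s, (((b k).toNNReal ^ (q / (p - q)) : ℝ≥0) * b k) ^ q ≤ _ at h
  have hcoe : ∀ k : net n, (((b k).toNNReal ^ (q / (p - q)) : ℝ≥0) : ℝ≥0∞) =
      b k ^ (q / (p - q)) := fun k => by
    rw [ENNReal.coe_rpow_of_nonneg _ (by positivity), ENNReal.coe_toNNReal (hbt k)]
  simp_rw [hcoe] at h
  have h1 : ∀ k : net n, (b k ^ (q / (p - q)) * b k) ^ q = b k ^ r := fun k => by
    rw [ENNReal.mul_rpow_of_nonneg _ _ hq.le, ← ENNReal.rpow_mul,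
      ← ENNReal.rpow_add_of_nonneg _ _ (by positivity) hq.le]
    congr 1; rw [hr]; field_simp; ring
  have h2 : ∀ k : net n, (b k ^ (q / (p - q))) ^ p = b k ^ r := fun k => by
    rw [← ENNReal.rpow_mul]; congr 1; rw [hr]; ring
  simp_rw [h1, h2] at h
  rw [Finset.sum_coe_sort s fun k => b k ^ r] at h
  set X := ∑ k ∈ s, b k ^ r with hX
  have hXt : X ≠ ∞ := ENNReal.sum_ne_top.2 fun k _ =>
    ENNReal.rpow_ne_top_of_nonneg hr0.le (hbt k)
  by_cases hX0 : X = 0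
  · rw [hX0, ENNReal.zero_rpow_of_pos (by positivity)]
    exact zero_le
  have hY0 : X ^ (q / p) ≠ 0 := by simp [ENNReal.rpow_eq_zero_iff, hX0, hXt]
  have hYt : X ^ (q / p) ≠ ∞ := ENNReal.rpow_ne_top_of_nonneg (by positivity) hXt
  have h3 : X ^ (1 - q / p) ≤ C * B ^ q := by
    rw [← ENNReal.mul_le_mul_iff_left hY0 hYt, ← ENNReal.rpow_add _ _ hX0 hXt, sub_add_cancel,
      ENNReal.rpow_one]
    rwa [mul_assoc]
  have h4 := ENNReal.rpow_le_rpow h3 (by positivity : 0 ≤ 1 / q)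
  rw [← ENNReal.rpow_mul, ENNReal.mul_rpow_of_nonneg _ _ (by positivity), ← ENNReal.rpow_mul,
    mul_one_div_cancel hq.ne', ENNReal.rpow_one, ← ENNReal.coe_rpow_of_nonneg _ (by positivity)]
    at h4
  convert h4 using 2
  rw [hr]; field_simp

/-- For `z` within `1/2` of `k` the ball `B_1(z)` lies in `B_2(k)`; this is why the lower bound was
proved with balls of radius `2`. -/
theorem ExpDoubling.lintegral_rpow_le_tsum {ν : Measure (Cn n)} (hν : ExpDoubling ν) (e : ℝ)
    {r : ℝ} (hr : 0 < r) : ∃ C : ℝ≥0, ∀ μ : Measure (Cn n),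
      ∫⁻ z, (μ (Metric.ball z 1) * ν (Metric.ball z 1) ^ e) ^ r ≤
        C * ∑' k : net n, (μ (Metric.ball (k : Cn n) 2) * ν (Metric.ball (k : Cn n) 1) ^ e) ^ r := by
  obtain ⟨K, hK⟩ := hν.rpow_le_of_dist_le e (1 / 2)
  set b := volume (Metric.closedBall (0 : Cn n) (1 / 2)) with hb
  have hbt : b ≠ ∞ := measure_closedBall_lt_top.ne
  refine ⟨b.toNNReal * K ^ r, fun μ => ?_⟩
  refine (lintegral_le_tsum_net _ _).trans ?_
  rw [← ENNReal.tsum_mul_left]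
  refine ENNReal.tsum_le_tsum fun k => ?_
  rw [ENNReal.coe_mul, ENNReal.coe_toNNReal hbt, ENNReal.coe_rpow_of_nonneg _ hr.le, mul_assoc,
    ← ENNReal.mul_rpow_of_nonneg _ _ hr.le, mul_comm, hb,
    ← Measure.addHaar_closedBall_center volume (k : Cn n), ← setLIntegral_const]
  refine setLIntegral_mono' Metric.isClosed_closedBall.measurableSet fun z hz => ?_
  refine ENNReal.rpow_le_rpow ?_ hr.le
  rw [mul_left_comm]
  refine mul_le_mul' (measure_mono (Metric.ball_subset_ball' ?_)) (hK _ _ hz)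
  have := Metric.mem_closedBall.1 hz
  linarith

end

/-! ### Necessary conditions for compactness -/

theorem tendsto_setLIntegral_compl_ball {ν : Measure (Cn n)} {φ : Cn n → ℝ≥0∞}
    (h : ∫⁻ z, φ z ∂ν < ∞) :
    Tendsto (fun k : ℕ => ∫⁻ z in (Metric.ball (0 : Cn n) k)ᶜ, φ z ∂ν) atTop (𝓝 0) := by
  have hm : ∀ k : ℕ, MeasurableSet (Metric.ball (0 : Cn n) k)ᶜ := fun k => measurableSet_ball.compl
  have ht := tendsto_measure_iInter_atTop (μ := ν.withDensity φ)
    (s := fun k : ℕ => (Metric.ball (0 : Cn n) k)ᶜ) (fun k => (hm k).nullMeasurableSet)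
    (fun i j hij => Set.compl_subset_compl.2 (Metric.ball_subset_ball (by exact_mod_cast hij)))
    ⟨0, by
      rw [withDensity_apply _ (hm 0)]
      exact ((setLIntegral_le_lintegral _ _).trans_lt h).ne⟩
  have hI : ⋂ k : ℕ, (Metric.ball (0 : Cn n) k)ᶜ = ∅ := by
    ext z
    simp only [Set.mem_iInter, Set.mem_compl_iff, Metric.mem_ball, not_lt, Set.mem_empty_iff_false,
      iff_false, not_forall, not_le]
    exact exists_nat_gt _
  rw [hI, measure_empty] at ht
  refine ht.congr fun k => ?_
  exact withDensity_apply _ (hm k)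

theorem tendsto_setLIntegral_ball_cocompact {ν : Measure (Cn n)} {φ : Cn n → ℝ≥0∞}
    (h : ∫⁻ z, φ z ∂ν < ∞) :
    Tendsto (fun x => ∫⁻ z in Metric.ball x 1, φ z ∂ν) (cocompact (Cn n)) (𝓝 0) := by
  rw [ENNReal.tendsto_nhds_zero]
  intro ε hε
  obtain ⟨k, hk⟩ := (ENNReal.tendsto_nhds_zero.1 (tendsto_setLIntegral_compl_ball h) ε hε).exists
  have := (isCompact_closedBall (0 : Cn n) (k + 1)).compl_mem_cocompact
  filter_upwards [this] with x hx
  refine le_trans (lintegral_mono_set fun z hz => ?_) hk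
  simp only [Set.mem_compl_iff, Metric.mem_closedBall, Metric.mem_ball, not_le, not_lt] at hx hz ⊢
  have := dist_triangle x z 0
  rw [dist_comm x z] at this
  linarith

theorem fockAbs_add_rpow_le (α : ℝ) (f g : Cn n → ℂ) (z : Cn n) {q : ℝ} (hq : 0 ≤ q) :
    fockAbs α (f + g) z ^ q ≤ 2 ^ q * (fockAbs α f z ^ q + fockAbs α g z ^ q) := by
  refine le_trans (ENNReal.rpow_le_rpow ?_ hq) (add_rpow_le_two_rpow_mul _ _ hq)
  rw [fockAbs, fockAbs, fockAbs, ← add_mul, Pi.add_apply]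
  gcongr
  exact enorm_add_le _ _

/-- The element of the Fock space given by a function. -/
def Fock.ofMem {p α : ℝ} {w : Cn n → ℝ} (f : Cn n → ℂ) (hf : MemFock p α w f) : Fock n p α w :=
  ⟨f, hf⟩

section

variable {w : Cn n → ℝ} {μ : Measure (Cn n)} {α p q : ℝ}

theorem fockNorm_sub_rpow_lt_of_mem_eball [Fact (0 < q)] {f g : Fock n q α w} {ε : ℝ≥0∞}
    (h : f ∈ Metric.eball g ε) : fockNorm q α w (f.1 - g.1) ^ min 1 q < ε := h

theorem ToeplitzCompact.exists_finite_cover [Fact (0 < q)] (hT : ToeplitzCompact p q α w μ)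
    {ε : ℝ≥0∞} (hε : 0 < ε) : ∃ t : Set (Fock n q α w), t.Finite ∧
      ∀ f : Fock n p α w, fockNorm p α w f.1 ≤ 1 → ∃ g ∈ t,
        fockNorm q α w (toeplitz α μ f.1 - g.1) ^ min 1 q < ε := by
  obtain ⟨hmaps, hc⟩ := hT
  have h1 := (hc {f : Fock n p α w | fockNorm p α w f.1 ≤ 1}
    ⟨1, fun f hf => by rw [ENNReal.coe_one]; exact hf⟩).totallyBounded.subset subset_closure
  obtain ⟨t, htf, ht⟩ := EMetric.totallyBounded_iff.1 h1 ε hε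
  refine ⟨t, htf, fun f hf => ?_⟩
  have hmem : Fock.ofMem (toeplitz α μ f.1) (hmaps f).2 ∈ {g : Fock n q α w |
      ∃ f ∈ {f : Fock n p α w | fockNorm p α w f.1 ≤ 1}, g.1 = toeplitz α μ f.1} := ⟨f, hf, rfl⟩
  obtain ⟨g, hg, hfg⟩ := Set.mem_iUnion₂.1 (ht hmem)
  have h2 := fockNorm_sub_rpow_lt_of_mem_eball hfg
  exact ⟨g, hg, h2⟩

/-- Finitely many balls of radius `1` cover the image of the unit ball, and their centres have
finite norm. A homogeneity argument extends the bound to all `f`. -/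
theorem ToeplitzCompact.toeplitzBounded [Fact (0 < q)] (hw : RestrictedAInfty w) (hα : 0 < α)
    (hp : 0 < p) (hT : ToeplitzCompact p q α w μ) : ToeplitzBounded p q α w μ := by
  have hq : 0 < q := Fact.out
  obtain ⟨t, htf, ht⟩ := hT.exists_finite_cover (ε := 1) one_pos
  have hm : 0 < min 1 q := by positivity
  set N := ∑ g ∈ htf.toFinset, fockNorm q α w g.1 ^ min 1 q with hN
  have hNt : N ≠ ∞ := ENNReal.sum_ne_top.2 fun g _ =>
    ENNReal.rpow_ne_top_of_nonneg hm.le g.2.2.ne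
  have hbound : toeplitzNorm p q α w μ ≤ (1 + N) ^ (min 1 q)⁻¹ := by
    refine iSup₂_le fun f hf => ?_
    obtain ⟨g, hg, hfg⟩ := ht f hf
    rw [ENNReal.le_rpow_inv_iff hm]
    have h1 := fock_triangle hq α w ((hT.1 f).2.1.sub g.2.1) g.2.1
    rw [sub_add_cancel] at h1
    refine h1.trans (add_le_add hfg.le ?_)
    exact Finset.single_le_sum (f := fun g : Fock n q α w => fockNorm q α w g.1 ^ min 1 q)
      (fun _ _ => zero_le) (htf.mem_toFinset.2 hg)
  have ht' : toeplitzNorm p q α w μ ≠ ∞ :=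
    (hbound.trans_lt (ENNReal.rpow_lt_top_of_nonneg (by positivity) (by simp [hNt]))).ne
  refine ⟨hT.1, (toeplitzNorm p q α w μ).toNNReal, fun f => ?_⟩
  rw [ENNReal.coe_toNNReal ht']
  exact fockNorm_toeplitz_le_toeplitzNorm_mul hw hα hp hq hT.1 f

/-- The image of every test function is close to one of finitely many `g`, whose mass in `B_1(x)`
tends to `0` as `x` goes to infinity. Since the testing inequality can be localised to `B_1(x)`, the
symbol must tend to `0`. Weak convergence of the test functions is not needed, so the argument
covers all exponents. -/
theorem ToeplitzCompact.tendsto_symbol [Fact (0 < q)] (hw : RestrictedAInfty w) (hα : 0 < α)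
    (hp : 0 < p) (hT : ToeplitzCompact p q α w μ) :
    Tendsto (fun x => μ (Metric.ball x 1) *
      weightMeasure w (Metric.ball x 1) ^ (1 / q - 1 / p)) (cocompact (Cn n)) (𝓝 0) := by
  have hq : 0 < q := Fact.out
  have hwt := hw.exists_localAs.1
  obtain ⟨C, hC⟩ := exists_test_function (q := q) hw hα hp
  obtain ⟨D, hD⟩ := (hw.hasLocalBound hα hq).fockAbs_mul_le hq
  set ν := weightMeasure w
  have hm : 0 < min 1 q := by positivity
  have key : ∀ ε : ℝ≥0∞, 0 < ε → ∀ᶠ x in cocompact (Cn n), μ (Metric.ball x 1) *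
      ν (Metric.ball x 1) ^ (1 / q - 1 / p) ≤ C * (D * (2 ^ q * (ε + ε)) ^ (1 / q)) := by
    intro ε hε
    -- The distance is the norm to the power `min 1 q`; this exponent turns the covering radius into
    -- the bound `ε` for the integral of the `q`-th power.
    obtain ⟨t, htf, ht⟩ := hT.exists_finite_cover (ε := ε ^ (min 1 q / q)) (by
      rcases eq_or_ne ε ∞ with rfl | hεt
      · rw [ENNReal.top_rpow_of_pos (by positivity)]; simp
      · exact ENNReal.rpow_pos hε hεt)
    have htail : ∀ᶠ x in cocompact (Cn n), ∀ g ∈ t,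
        ∫⁻ z in Metric.ball x 1, fockAbs α g.1 z ^ q ∂ν ≤ ε :=
      (htf.eventually_all).2 fun g _ => ENNReal.tendsto_nhds_zero.1
        (tendsto_setLIntegral_ball_cocompact (g.2.lintegral_lt_top hwt hq)) ε hε
    filter_upwards [htail] with x hx
    obtain ⟨f, hf, h⟩ := hC x
    obtain ⟨g, hg, hfg⟩ := ht f hf
    refine (h μ hT.1).trans (mul_le_mul' le_rfl ((hD _ (hT.1 f).2.1 x).trans ?_))
    gcongr
    have hdiff : Differentiable ℂ (toeplitz α μ f.1 - g.1) := (hT.1 f).2.1.sub g.2.1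
    have hfg' : ∫⁻ z, fockAbs α (toeplitz α μ f.1 - g.1) z ^ q ∂ν ≤ ε := by
      rw [← fockNorm_rpow hwt hq α hdiff.continuous]
      have h1 := ENNReal.rpow_le_rpow hfg.le (by positivity : 0 ≤ q / min 1 q)
      rwa [← ENNReal.rpow_mul, ← ENNReal.rpow_mul, mul_div_cancel₀ _ hm.ne',
        div_mul_div_cancel₀ hq.ne', div_self hm.ne', ENNReal.rpow_one] at h1
    have hmeas := (measurable_fockAbs α hdiff.continuous).pow_const q
    calc ∫⁻ u in Metric.ball x 1, fockAbs α (toeplitz α μ f.1) u ^ q ∂ν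
        ≤ ∫⁻ u in Metric.ball x 1, 2 ^ q * (fockAbs α (toeplitz α μ f.1 - g.1) u ^ q +
          fockAbs α g.1 u ^ q) ∂ν := by
          refine lintegral_mono fun u => ?_
          have := fockAbs_add_rpow_le α (toeplitz α μ f.1 - g.1) g.1 u hq.le
          rwa [sub_add_cancel] at this
      _ = 2 ^ q * (∫⁻ u in Metric.ball x 1, fockAbs α (toeplitz α μ f.1 - g.1) u ^ q ∂ν +
          ∫⁻ u in Metric.ball x 1, fockAbs α g.1 u ^ q ∂ν) := by
          rw [lintegral_const_mul' _ _ (ENNReal.rpow_ne_top_of_nonneg hq.le (by simp)),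
            lintegral_add_left hmeas]
      _ ≤ 2 ^ q * (ε + ε) := by
          gcongr
          · exact (setLIntegral_le_lintegral _ _).trans hfg'
          · exact hx g hg
  rw [ENNReal.tendsto_nhds_zero]
  intro δ hδ
  have hlim : Tendsto (fun ε : ℝ≥0∞ => C * (D * (2 ^ q * (ε + ε)) ^ (1 / q))) (𝓝[>] 0) (𝓝 0) := by
    have h2 : (2 : ℝ≥0∞) ^ q ≠ ∞ := ENNReal.rpow_ne_top_of_nonneg hq.le (by simp)
    have h3 : Continuous fun ε : ℝ≥0∞ => (C : ℝ≥0∞) * (D * (2 ^ q * (ε + ε)) ^ (1 / q)) := by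
      refine (ENNReal.continuous_const_mul ENNReal.coe_ne_top).comp
        ((ENNReal.continuous_const_mul ENNReal.coe_ne_top).comp
        (ENNReal.continuous_rpow_const.comp ((ENNReal.continuous_const_mul h2).comp ?_)))
      exact continuous_id.add continuous_id
    have h4 := (h3.tendsto 0).mono_left (nhdsWithin_le_nhds (s := Set.Ioi 0))
    simpa [hq] using h4
  obtain ⟨ε, hεδ, hε⟩ := ((ENNReal.tendsto_nhds_zero.1 hlim δ hδ).and
    self_mem_nhdsWithin).exists
  exact (key ε hε).mono fun x hx => hx.trans hεδ

/-- Functions in the Fock space are bounded on balls by their norm. -/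
theorem exists_enorm_le_mul_fockNorm (hw : RestrictedAInfty w) (hα : 0 < α) (hp : 0 < p) (R : ℝ) :
    ∃ C : ℝ≥0, ∀ g : Cn n → ℂ, Differentiable ℂ g → ∀ z ∈ Metric.closedBall (0 : Cn n) R,
      ‖g z‖ₑ ≤ C * fockNorm p α w g := by
  have hν := hw.expDoubling
  obtain ⟨D, hD⟩ := (hw.hasLocalBound hα hp).fockAbs_mul_le hp
  obtain ⟨K, hK⟩ := hν.rpow_le_of_dist_le (-(1 / p)) R
  set W₀ := weightMeasure w (Metric.ball (0 : Cn n) 1) ^ (-(1 / p)) with hW₀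
  set E := ENNReal.ofReal (Real.exp (α / 2 * R ^ 2)) with hE
  have hc : E * (D * (K * W₀)) ≠ ∞ := by
    have := hν.rpow_ne_top (-(1 / p)) (0 : Cn n)
    finiteness
  refine ⟨(E * (D * (K * W₀))).toNNReal, fun g hg z hz => ?_⟩
  rw [ENNReal.coe_toNNReal hc]
  have hz' : ‖z‖ ≤ R := by simpa using hz
  have h1 : ‖g z‖ₑ ≤ E * fockAbs α g z := by
    rw [fockAbs, mul_left_comm, hE, ← ENNReal.ofReal_mul (Real.exp_nonneg _), ← Real.exp_add]
    refine le_mul_of_one_le_right' ?_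
    rw [ENNReal.one_le_ofReal, Real.one_le_exp_iff]
    have : ‖z‖ ^ 2 ≤ R ^ 2 := pow_le_pow_left₀ (norm_nonneg _) hz' 2
    nlinarith
  set W := weightMeasure w (Metric.ball z 1) with hW
  have h2 : fockAbs α g z ≤ D * fockNorm p α w g * W ^ (-(1 / p)) := by
    calc fockAbs α g z = fockAbs α g z * (W ^ (1 / p) * W ^ (-(1 / p))) := by
          rw [hν.rpow_mul_rpow_neg, mul_one]
      _ = (fockAbs α g z * W ^ (1 / p)) * W ^ (-(1 / p)) := by ring
      _ ≤ (D * fockNorm p α w g) * W ^ (-(1 / p)) := by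
          refine mul_le_mul' ((hD g hg z).trans (mul_le_mul' le_rfl ?_)) le_rfl
          rw [fockNorm_eq hw.exists_localAs.1 hp α hg.continuous]
          exact ENNReal.rpow_le_rpow (setLIntegral_le_lintegral _ _) (by positivity)
  calc ‖g z‖ₑ ≤ E * (D * fockNorm p α w g * W ^ (-(1 / p))) := h1.trans (by gcongr)
    _ ≤ E * (D * fockNorm p α w g * (K * W₀)) := by
        gcongr
        exact hK z 0 hz
    _ = _ := by ring

end

/-! ### Completeness of the Fock space -/

/-- A sequence of entire functions that is uniformly Cauchy on balls converges pointwise to an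
entire function. -/
theorem exists_differentiable_limit {f : ℕ → Cn n → ℂ} (hf : ∀ i, Differentiable ℂ (f i))
    (hc : ∀ R : ℝ, UniformCauchySeqOn f atTop (Metric.ball 0 R)) :
    ∃ g : Cn n → ℂ, Differentiable ℂ g ∧ ∀ z, Tendsto (fun i => f i z) atTop (𝓝 (g z)) := by
  -- Cauchy's estimate on unit balls transfers the uniform Cauchy property to the derivatives, at
  -- the cost of enlarging the radius by `1`.
  have hc' : ∀ R : ℝ, UniformCauchySeqOn (fun i => fderiv ℂ (f i)) atTop (Metric.ball 0 R) := by
    intro R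
    rw [Metric.uniformCauchySeqOn_iff]
    intro ε hε
    obtain ⟨N, hN⟩ := Metric.uniformCauchySeqOn_iff.1 (hc (R + 1)) (ε / 4) (by positivity)
    refine ⟨N, fun i hi j hj z hz => ?_⟩
    have hz' : ‖z‖ < R := by simpa using hz
    have hsub : ∀ u ∈ Metric.ball z 1, u ∈ Metric.ball (0 : Cn n) (R + 1) := fun u hu => by
      have h1 := norm_le_norm_add_norm_sub' u z
      have h2 := mem_ball_iff_norm.1 hu
      rw [mem_ball_zero_iff]
      linarith
    rw [dist_eq_norm, ← fderiv_sub (hf i z) (hf j z)]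
    have hb : ∀ u ∈ Metric.ball z 1, ‖(f i - f j) u‖ < ε / 4 := fun u hu => by
      have := hN i hi j hj u (hsub u hu)
      rwa [dist_eq_norm] at this
    have := Complex.norm_fderiv_le_div_of_mapsTo_ball (f := f i - f j) (c := z) (R₁ := 1)
      (R₂ := ε / 2) ((hf i).sub (hf j)).differentiableOn (fun u hu => by
        rw [Metric.mem_closedBall, dist_eq_norm]
        have h1 := hb u hu
        have h2 := hb z (Metric.mem_ball_self one_pos)
        have h3 := norm_sub_le ((f i - f j) u) ((f i - f j) z)
        linarith) one_pos
    rw [div_one] at this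
    linarith
  have hlim : ∀ z, ∃ a, Tendsto (fun i => f i z) atTop (𝓝 a) := fun z =>
    cauchySeq_tendsto_of_complete ((hc (‖z‖ + 1)).cauchySeq (by simp))
  have hlim' : ∀ z, ∃ a, Tendsto (fun i => fderiv ℂ (f i) z) atTop (𝓝 a) := fun z =>
    cauchySeq_tendsto_of_complete ((hc' (‖z‖ + 1)).cauchySeq (by simp))
  choose g hg using hlim
  choose g' hg' using hlim'
  refine ⟨g, fun z => ?_, hg⟩
  exact (hasFDerivAt_of_tendstoUniformlyOn (s := Metric.ball (0 : Cn n) (‖z‖ + 1))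
    Metric.isOpen_ball ((hc' (‖z‖ + 1)).tendstoUniformlyOn_of_tendsto fun u _ => hg' u)
    (fun i u _ => (hf i u).hasFDerivAt) (fun u _ => hg u) (by simp)).differentiableAt

theorem tendsto_fockAbs_sub {α : ℝ} {f : ℕ → Cn n → ℂ} {g : Cn n → ℂ} {z : Cn n}
    (h : Tendsto (fun i => f i z) atTop (𝓝 (g z))) (k : Cn n → ℂ) :
    Tendsto (fun i => fockAbs α (k - f i) z) atTop (𝓝 (fockAbs α (k - g) z)) := by
  unfold fockAbs
  refine ENNReal.Tendsto.mul_const ?_ (Or.inr ENNReal.ofReal_ne_top)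
  exact (continuous_enorm.tendsto _).comp (tendsto_const_nhds.sub h)

/-- The norm controls uniform convergence on balls, so a Cauchy sequence has an entire pointwise
limit. Fatou's lemma gives convergence in norm, also in the quasi-normed range `q < 1`. -/
theorem Fock.completeSpace {w : Cn n → ℝ} {α q : ℝ} [Fact (0 < q)] (hw : RestrictedAInfty w)
    (hα : 0 < α) : CompleteSpace (Fock n q α w) := by
  have hq : 0 < q := Fact.out
  have hwt := hw.exists_localAs.1
  have hm : 0 < min 1 q := by positivity
  refine UniformSpace.complete_of_cauchySeq_tendsto fun u hu => ?_
  rw [EMetric.cauchySeq_iff] at hu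
  have hu' : ∀ ε : ℝ≥0∞, 0 < ε → ∃ N, ∀ i ≥ N, ∀ j ≥ N,
      fockNorm q α w ((u i).1 - (u j).1) ^ min 1 q < ε := hu
  have hcauchy : ∀ ε : ℝ≥0∞, 0 < ε → ∃ N, ∀ i ≥ N, ∀ j ≥ N,
      fockNorm q α w ((u i).1 - (u j).1) ≤ ε := by
    intro ε hε
    obtain ⟨N, hN⟩ := hu' (ε ^ min 1 q) (by
      rcases eq_or_ne ε ∞ with rfl | hεt
      · rw [ENNReal.top_rpow_of_pos hm]; simp
      · exact ENNReal.rpow_pos hε hεt)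
    exact ⟨N, fun i hi j hj => (ENNReal.rpow_le_rpow_iff hm).1 (hN i hi j hj).le⟩
  obtain ⟨g, hg, hlim⟩ := exists_differentiable_limit (f := fun i => (u i).1) (fun i => (u i).2.1) (by
    intro R
    rw [Metric.uniformCauchySeqOn_iff]
    intro ε hε
    obtain ⟨C, hC⟩ := exists_enorm_le_mul_fockNorm (p := q) hw hα hq R
    obtain ⟨N, hN⟩ := hcauchy (ENNReal.ofReal (ε / 2 / (C + 1))) (by
      rw [ENNReal.ofReal_pos]; positivity)
    refine ⟨N, fun i hi j hj z hz => ?_⟩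
    have h1 := hC ((u i).1 - (u j).1) ((u i).2.1.sub (u j).2.1) z (Metric.ball_subset_closedBall hz)
    have h2 : ‖((u i).1 - (u j).1) z‖ₑ ≤ ENNReal.ofReal (C * (ε / 2 / (C + 1))) := by
      rw [ENNReal.ofReal_mul (by positivity), ENNReal.ofReal_coe_nnreal]
      exact h1.trans (by gcongr; exact hN i hi j hj)
    rw [← ofReal_norm, ENNReal.ofReal_le_ofReal_iff (by positivity)] at h2
    rw [dist_eq_norm]
    refine lt_of_le_of_lt h2 ?_
    have : (C : ℝ) * (ε / 2 / (C + 1)) = (C / (C + 1)) * (ε / 2) := by ring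
    rw [this]
    have h3 : (C : ℝ) / (C + 1) ≤ 1 := by
      rw [div_le_one (by positivity)]; linarith
    nlinarith)
  have hfatou : ∀ ε : ℝ≥0∞, ∀ N, (∀ i ≥ N, ∀ j ≥ N, fockNorm q α w ((u i).1 - (u j).1) ≤ ε) →
      ∀ i ≥ N, fockNorm q α w ((u i).1 - g) ≤ ε := by
    intro ε N hN i hi
    rw [← ENNReal.rpow_le_rpow_iff hq, fockNorm_rpow hwt hq α ((u i).2.1.sub hg).continuous]
    have h1 : ∀ z, fockAbs α ((u i).1 - g) z ^ q =
        liminf (fun j => fockAbs α ((u i).1 - (u j).1) z ^ q) atTop := fun z =>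
      (((ENNReal.continuous_rpow_const.tendsto _).comp
        (tendsto_fockAbs_sub (hlim z) (u i).1)).liminf_eq).symm
    simp_rw [h1]
    refine (lintegral_liminf_le fun j =>
      (measurable_fockAbs α ((u i).2.1.sub (u j).2.1).continuous).pow_const q).trans ?_
    refine liminf_le_of_frequently_le' (Eventually.frequently ?_)
    filter_upwards [eventually_ge_atTop N] with j hj
    rw [← fockNorm_rpow hwt hq α ((u i).2.1.sub (u j).2.1).continuous]
    exact ENNReal.rpow_le_rpow (hN i hi j hj) hq.le
  have hgm : fockNorm q α w g < ∞ := by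
    obtain ⟨N, hN⟩ := hcauchy 1 one_pos
    have h1 := hfatou 1 N hN N le_rfl
    have h2 := fock_triangle hq α w (u N).2.1 (hg.sub (u N).2.1)
    rw [add_sub_cancel] at h2
    have h3 : fockNorm q α w (g - (u N).1) = fockNorm q α w ((u N).1 - g) := by
      simp only [fockNorm, Pi.sub_apply, ← edist_eq_enorm_sub, edist_comm]
    rw [h3] at h2
    rw [← ENNReal.rpow_lt_top_iff_of_pos hm]
    refine h2.trans_lt (ENNReal.add_lt_top.2
      ⟨ENNReal.rpow_lt_top_of_nonneg hm.le (u N).2.2.ne,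
        ENNReal.rpow_lt_top_of_nonneg hm.le (h1.trans_lt ENNReal.one_lt_top).ne⟩)
  have hgM : MemFock q α w g := ⟨hg, hgm⟩
  refine ⟨Fock.ofMem g hgM, ?_⟩
  rw [EMetric.tendsto_atTop]
  intro ε hε
  obtain ⟨δ, hδ0, hδ⟩ := exists_between hε
  obtain ⟨N, hN⟩ := hcauchy (δ ^ (min 1 q)⁻¹) (by
    exact ENNReal.rpow_pos hδ0 (ne_top_of_lt hδ))
  refine ⟨N, fun i hi => ?_⟩
  have h1 := hfatou _ N hN i hi
  refine lt_of_le_of_lt ?_ hδ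
  have h2 := ENNReal.rpow_le_rpow h1 hm.le
  rwa [← ENNReal.rpow_mul, inv_mul_cancel₀ hm.ne', ENNReal.rpow_one] at h2

/-! ### Sufficient conditions for compactness -/

/-- A family of entire functions that is uniformly bounded on a ball can be approximated uniformly
on a smaller ball by finitely many of its members. -/
theorem exists_finite_approx {S : Set (Cn n → ℂ)} (hd : ∀ f ∈ S, Differentiable ℂ f) {R B : ℝ}
    (hB : ∀ f ∈ S, ∀ z ∈ Metric.closedBall (0 : Cn n) (R + 1), ‖f z‖ ≤ B) {δ : ℝ} (hδ : 0 < δ) :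
    ∃ t ⊆ S, t.Finite ∧ ∀ f ∈ S, ∃ g ∈ t, ∀ z ∈ Metric.closedBall (0 : Cn n) R,
      ‖f z - g z‖ ≤ δ := by
  -- On unit balls centred in the smaller ball the members of `S` oscillate by at most `2|B|`, so
  -- they vary by at most `2|B|ρ ≤ δ/4` over distance `ρ`; the bound `1/2` keeps the points inside
  -- the unit ball.
  set ρ := min (1 / 2) (δ / (8 * (|B| + 1))) with hρ
  have hρ0 : 0 < ρ := by positivity
  have hρB : |B| * ρ ≤ δ / 8 := by
    have h1 : ρ * (8 * (|B| + 1)) ≤ δ := by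
      rw [← le_div_iff₀ (by positivity)]
      exact min_le_right _ _
    nlinarith [abs_nonneg B]
  have hlip : ∀ f ∈ S, ∀ z ∈ Metric.closedBall (0 : Cn n) R, ∀ y : Cn n, dist y z < ρ →
      ‖f y - f z‖ ≤ δ / 4 := by
    intro f hf z hz y hy
    have hz' : ‖z‖ ≤ R := by simpa using hz
    have hmem : ∀ u ∈ Metric.ball z 1, u ∈ Metric.closedBall (0 : Cn n) (R + 1) := fun u hu => by
      have h1 := norm_le_norm_add_norm_sub' u z
      have h2 := mem_ball_iff_norm.1 hu
      rw [mem_closedBall_zero_iff]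
      linarith
    have h1 := Complex.dist_le_div_mul_dist_of_mapsTo_ball (f := f) (c := z) (z := y) (R₁ := 1)
      (R₂ := 2 * |B|) (hd f hf).differentiableOn (fun u hu => by
        rw [Metric.mem_closedBall, dist_eq_norm]
        have h1 := hB f hf u (hmem u hu)
        have h2 := hB f hf z (hmem z (Metric.mem_ball_self one_pos))
        have h3 := norm_sub_le (f u) (f z)
        linarith [le_abs_self B])
      (Metric.mem_ball.2 (hy.trans_le ((min_le_left _ _).trans (by norm_num))))
    rw [dist_eq_norm, div_one] at h1
    nlinarith [abs_nonneg B]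
  obtain ⟨N, hNs, hN, hcov⟩ := Metric.finite_approx_of_totallyBounded
    (isCompact_closedBall (0 : Cn n) R).totallyBounded ρ hρ0
  have := hN.fintype
  -- Evaluation on a finite `ρ`-net sends `S` to a bounded set of a finite-dimensional space. Two
  -- functions within `δ/2` there are within `δ/4 + δ/2 + δ/4` on the whole ball.
  set ev : (Cn n → ℂ) → N → ℂ := fun f y => f y with hev
  have htb : TotallyBounded (ev '' S) := by
    refine (isCompact_closedBall (0 : N → ℂ) |B|).totallyBounded.subset ?_
    rintro _ ⟨f, hf, rfl⟩
    rw [mem_closedBall_zero_iff, pi_norm_le_iff_of_nonneg (abs_nonneg B)]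
    intro y
    refine (hB f hf y (Metric.closedBall_subset_closedBall (by linarith) (hNs y.2))).trans
      (le_abs_self B)
  obtain ⟨t, htS, htf, ht⟩ := Set.exists_subset_image_finite_and.1
    (Metric.finite_approx_of_totallyBounded htb (δ / 2) (by positivity))
  refine ⟨t, htS, htf, fun f hf => ?_⟩
  obtain ⟨_, ⟨g, hg, rfl⟩, hfg⟩ := Set.mem_iUnion₂.1 (ht ⟨f, hf, rfl⟩)
  refine ⟨g, hg, fun z hz => ?_⟩
  obtain ⟨y, hy, hzy⟩ := Set.mem_iUnion₂.1 (hcov hz)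
  have h1 := hlip f hf y (hNs hy) z hzy
  have h2 := hlip g (htS hg) y (hNs hy) z hzy
  have h3 : ‖f y - g y‖ < δ / 2 := by
    have := (dist_pi_lt_iff (by positivity)).1 (Metric.mem_ball.1 hfg) ⟨y, hy⟩
    rwa [dist_eq_norm] at this
  calc ‖f z - g z‖ = ‖(f z - f y) + (f y - g y) - (g z - g y)‖ := by congr 1; ring
    _ ≤ ‖f z - f y‖ + ‖f y - g y‖ + ‖g z - g y‖ :=
        (norm_sub_le _ _).trans (add_le_add (norm_add_le _ _) le_rfl)
    _ ≤ δ := by linarith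

theorem exists_pos_mul_rpow_le {N : ℝ≥0∞} (hN : N ≠ ∞) {m : ℝ} (hm : 0 < m) {ε : ℝ≥0∞}
    (hε : 0 < ε) : ∃ δ : ℝ, 0 < δ ∧ (ENNReal.ofReal δ * N) ^ m ≤ ε := by
  have h : Tendsto (fun δ : ℝ => (ENNReal.ofReal δ * N) ^ m) (𝓝[>] 0) (𝓝 0) := by
    have h1 : Continuous fun δ : ℝ => (ENNReal.ofReal δ * N) ^ m :=
      ENNReal.continuous_rpow_const.comp
        ((ENNReal.continuous_mul_const hN).comp ENNReal.continuous_ofReal)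
    have h2 := (h1.tendsto 0).mono_left (nhdsWithin_le_nhds (s := Set.Ioi 0))
    simpa [hm] using h2
  obtain ⟨δ, h1, h2⟩ := ((ENNReal.tendsto_nhds_zero.1 h ε hε).and self_mem_nhdsWithin).exists
  exact ⟨δ, h2, h1⟩

section

variable {w : Cn n → ℝ} {μ : Measure (Cn n)} {α p q : ℝ}

/-- On the part of the measure in a ball, the Toeplitz operator is controlled by the size of the
function on that ball. -/
theorem exists_fockNorm_toeplitz_restrict_ball_le (hw : RestrictedAInfty w) (hα : 0 < α)
    (hq : 0 < q) {R : ℝ} (hR : μ (Metric.ball 0 R) ≠ ∞) :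
    ∃ D : ℝ≥0∞, D ≠ ∞ ∧ ∀ (h : Cn n → ℂ) (δ : ℝ≥0∞),
      Differentiable ℂ (toeplitz α (μ.restrict (Metric.ball 0 R)) h) →
      (∀ z ∈ Metric.ball (0 : Cn n) R, ‖h z‖ₑ ≤ δ) →
      fockNorm q α w (toeplitz α (μ.restrict (Metric.ball 0 R)) h) ≤ δ * D := by
  have hν := hw.expDoubling
  set ν := weightMeasure w
  obtain ⟨C, hC⟩ := hν.lintegral_gauss_le (c := α / 2 / 2 * q) (by positivity)
  set E := ENNReal.ofReal (Real.exp (α / 2 * R ^ 2)) with hE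
  set A := E * μ (Metric.ball 0 R) with hA
  have hAt : A ≠ ∞ := by finiteness
  refine ⟨A * (C * ν (Metric.ball (0 : Cn n) 1)) ^ (1 / q), ?_, fun h δ hd hδ => ?_⟩
  · have := hν.ne_top (0 : Cn n)
    have h2 : (C * ν (Metric.ball (0 : Cn n) 1)) ^ (1 / q) ≠ ∞ :=
      ENNReal.rpow_ne_top_of_nonneg (by positivity) (by finiteness)
    finiteness
  rw [fockNorm_eq hw.exists_localAs.1 hq α hd.continuous]
  -- For `u` in the ball the Gaussian centred at `u` is at most a constant times a wider one centred
  -- at `0`, so the image is dominated by a fixed Gaussian, which has finite norm.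
  have hpt : ∀ z : Cn n, fockAbs α (toeplitz α (μ.restrict (Metric.ball 0 R)) h) z ≤
      δ * A * gauss (α / 2 / 2) 0 z := by
    intro z
    refine (fockAbs_toeplitz_le α _ h z).trans ?_
    calc gaussOp α (μ.restrict (Metric.ball 0 R)) (fockAbs α h) z
        ≤ ∫⁻ _ in Metric.ball 0 R, δ * (E * gauss (α / 2 / 2) 0 z) ∂μ := by
          refine setLIntegral_mono' measurableSet_ball fun u hu => mul_le_mul' ?_ ?_
          · rw [fockAbs]
            refine (mul_le_of_le_one_right' ?_).trans (hδ u hu)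
            rw [ENNReal.ofReal_le_one, Real.exp_le_one_iff]
            nlinarith [sq_nonneg ‖u‖]
          · rw [gauss_comm]
            exact gauss_le_of_dist_le (by positivity) (Metric.mem_ball.1 hu).le z
      _ = δ * A * gauss (α / 2 / 2) 0 z := by
          rw [setLIntegral_const]; ring
  calc (∫⁻ z, fockAbs α (toeplitz α (μ.restrict (Metric.ball 0 R)) h) z ^ q ∂ν) ^ (1 / q)
      ≤ (∫⁻ z, (δ * A) ^ q * gauss (α / 2 / 2 * q) 0 z ∂ν) ^ (1 / q) := by
        refine ENNReal.rpow_le_rpow (lintegral_mono fun z => ?_) (by positivity)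
        rw [← gauss_rpow _ _ _ hq.le, ← ENNReal.mul_rpow_of_nonneg _ _ hq.le]
        exact ENNReal.rpow_le_rpow (hpt z) hq.le
    _ ≤ ((δ * A) ^ q * (C * ν (Metric.ball (0 : Cn n) 1))) ^ (1 / q) := by
        refine ENNReal.rpow_le_rpow ?_ (by positivity)
        rw [lintegral_const_mul _ (measurable_gauss _ _)]
        exact mul_le_mul' le_rfl (hC 0)
    _ = δ * (A * (C * ν (Metric.ball (0 : Cn n) 1)) ^ (1 / q)) := by
        rw [ENNReal.mul_rpow_of_nonneg _ _ (by positivity), ← ENNReal.rpow_mul,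
          mul_one_div_cancel hq.ne', ENNReal.rpow_one, mul_assoc]

theorem toeplitz_sub {f g : Cn n → ℂ} (hf : ∀ z, Integrable (toeplitzIntegrand α f z) μ)
    (hg : ∀ z, Integrable (toeplitzIntegrand α g z) μ) :
    toeplitz α μ (f - g) = toeplitz α μ f - toeplitz α μ g := by
  ext z
  rw [Pi.sub_apply, toeplitz, toeplitz, toeplitz, ← integral_sub (hf z) (hg z)]
  refine integral_congr_ae (Eventually.of_forall fun u => ?_)
  simp only [toeplitzIntegrand, Pi.sub_apply, sub_mul]

theorem toeplitz_restrict_add_compl {A : Set (Cn n)} (hA : MeasurableSet A) {f : Cn n → ℂ}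
    (hf : ∀ z, Integrable (toeplitzIntegrand α f z) μ) :
    toeplitz α μ f = toeplitz α (μ.restrict A) f + toeplitz α (μ.restrict Aᶜ) f := by
  ext z
  rw [Pi.add_apply, toeplitz, toeplitz, toeplitz, integral_add_compl hA (hf z)]

theorem MemFock.sub (hp : 0 < p) {f g : Cn n → ℂ} (hf : MemFock p α w f) (hg : MemFock p α w g) :
    MemFock p α w (f - g) ∧ fockNorm p α w (f - g) ^ min 1 p ≤
      fockNorm p α w f ^ min 1 p + fockNorm p α w g ^ min 1 p := by
  have hm : 0 < min 1 p := by positivity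
  have h1 := fock_triangle hp α w hf.1 hg.1.neg
  have h2 : fockNorm p α w (-g) = fockNorm p α w g := by simp [fockNorm]
  rw [h2, ← sub_eq_add_neg] at h1
  refine ⟨⟨hf.1.sub hg.1, ?_⟩, h1⟩
  rw [← ENNReal.rpow_lt_top_iff_of_pos hm]
  exact h1.trans_lt (ENNReal.add_lt_top.2 ⟨ENNReal.rpow_lt_top_of_nonneg hm.le hf.2.ne,
    ENNReal.rpow_lt_top_of_nonneg hm.le hg.2.ne⟩)

theorem exists_cell_bound_mono {μ' : Measure (Cn n)} (h : μ' ≤ μ) {ν : Measure (Cn n)} {e : ℝ}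
    (hμ : ∃ M : ℝ≥0, ∀ k : net n, μ (Metric.closedBall (k : Cn n) (1 / 2)) *
      ν (Metric.ball (k : Cn n) 1) ^ e ≤ M) :
    ∃ M : ℝ≥0, ∀ k : net n, μ' (Metric.closedBall (k : Cn n) (1 / 2)) *
      ν (Metric.ball (k : Cn n) 1) ^ e ≤ M := by
  obtain ⟨M, hM⟩ := hμ
  exact ⟨M, fun k => (mul_le_mul' (h _) le_rfl).trans (hM k)⟩

/-- If two functions are close on a large ball and the part of the measure outside of the ball has
a small operator norm, then their images under the Toeplitz operator are close. -/
theorem fockNorm_toeplitz_sub_rpow_le (hw : RestrictedAInfty w) (hα : 0 < α) (hp : 0 < p)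
    (hq : 0 < q)
    (hμ : ∃ M : ℝ≥0, ∀ k : net n, μ (Metric.closedBall (k : Cn n) (1 / 2)) *
      weightMeasure w (Metric.ball (k : Cn n) 1) ^ (1 / q - 1 / p) ≤ M)
    {R : ℝ} {K D δ : ℝ≥0∞}
    (hK : GaussOpBound p q α (weightMeasure w) (μ.restrict (Metric.ball 0 R)ᶜ) K)
    (hD : ∀ (h : Cn n → ℂ) (δ : ℝ≥0∞),
      Differentiable ℂ (toeplitz α (μ.restrict (Metric.ball 0 R)) h) →
      (∀ z ∈ Metric.ball (0 : Cn n) R, ‖h z‖ₑ ≤ δ) →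
      fockNorm q α w (toeplitz α (μ.restrict (Metric.ball 0 R)) h) ≤ δ * D)
    {f g : Cn n → ℂ} (hf : MemFock p α w f) (hg : MemFock p α w g)
    (hfg : ∀ z ∈ Metric.ball (0 : Cn n) R, ‖f z - g z‖ₑ ≤ δ) :
    fockNorm q α w (toeplitz α μ f - toeplitz α μ g) ^ min 1 q ≤
      (δ * D) ^ min 1 q + (K * fockNorm p α w (f - g)) ^ min 1 q := by
  have hm : 0 < min 1 q := by positivity
  have hs := (hf.sub hp hg).1
  have hμ₁ := exists_cell_bound_mono
    (Measure.restrict_le_self (μ := μ) (s := Metric.ball (0 : Cn n) R)) hμ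
  have hμ₂ := exists_cell_bound_mono
    (Measure.restrict_le_self (μ := μ) (s := (Metric.ball (0 : Cn n) R)ᶜ)) hμ
  have hd₁ := (toeplitz_properties hw hα hp hμ₁ hs).2
  have hd₂ := (toeplitz_properties hw hα hp hμ₂ hs).2
  rw [← toeplitz_sub (toeplitz_properties hw hα hp hμ hf).1
    (toeplitz_properties hw hα hp hμ hg).1, toeplitz_restrict_add_compl
    (measurableSet_ball (x := (0 : Cn n)) (ε := R)) (toeplitz_properties hw hα hp hμ hs).1]
  refine (fock_triangle hq α w hd₁ hd₂).trans (add_le_add ?_ ?_)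
  · exact ENNReal.rpow_le_rpow (hD _ δ hd₁ hfg) hm.le
  · exact ENNReal.rpow_le_rpow (fockNorm_toeplitz_le hw hα hp hq hμ₂ hK hs) hm.le

/-- A Toeplitz operator is compact if the parts of its measure outside of large balls have small
operator norms. -/
theorem toeplitzCompact_of_tail [Fact (0 < q)] (hw : RestrictedAInfty w) (hα : 0 < α) (hp : 0 < p)
    (hmaps : ToeplitzMaps p q α w μ)
    (hμ : ∃ M : ℝ≥0, ∀ k : net n, μ (Metric.closedBall (k : Cn n) (1 / 2)) *
      weightMeasure w (Metric.ball (k : Cn n) 1) ^ (1 / q - 1 / p) ≤ M)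
    (hfin : ∀ R : ℝ, μ (Metric.ball 0 R) ≠ ∞)
    (htail : ∀ ε : ℝ≥0∞, 0 < ε → ∃ R : ℝ,
      GaussOpBound p q α (weightMeasure w) (μ.restrict (Metric.ball 0 R)ᶜ) ε) :
    ToeplitzCompact p q α w μ := by
  have hq : 0 < q := Fact.out
  have hm : 0 < min 1 q := by positivity
  have hmp : 0 < min 1 p := by positivity
  have := Fock.completeSpace (q := q) hw hα
  refine ⟨hmaps, fun S ⟨M, hM⟩ => TotallyBounded.isCompact_of_isClosed
    (TotallyBounded.closure ?_) isClosed_closure⟩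
  rw [EMetric.totallyBounded_iff]
  intro ε hε
  set N : ℝ≥0∞ := ((M : ℝ≥0∞) ^ min 1 p + (M : ℝ≥0∞) ^ min 1 p) ^ (min 1 p)⁻¹ with hN
  have hNt : N ≠ ∞ := by
    have h1 : (M : ℝ≥0∞) ^ min 1 p ≠ ∞ :=
      ENNReal.rpow_ne_top_of_nonneg hmp.le ENNReal.coe_ne_top
    exact ENNReal.rpow_ne_top_of_nonneg (by positivity) (ENNReal.add_ne_top.2 ⟨h1, h1⟩)
  have hfgN : ∀ f ∈ S, ∀ g ∈ S, fockNorm p α w (f.1 - g.1) ≤ N := by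
    intro f hf g hg
    rw [hN, ENNReal.le_rpow_inv_iff hmp]
    refine (f.2.sub hp g.2).2.trans (add_le_add ?_ ?_)
    · exact ENNReal.rpow_le_rpow (hM f hf) hmp.le
    · exact ENNReal.rpow_le_rpow (hM g hg) hmp.le
  -- Order of the choices: the tail size `κ` fixes the radius `R`, then `R` fixes the constant `D`
  -- of the inner part, and `D` fixes the accuracy `δ` of the approximation on the ball.
  obtain ⟨ε', hε'0, hε'⟩ := exists_between (ENNReal.half_pos hε.ne')
  obtain ⟨κ, hκ0, hκ⟩ := exists_pos_mul_rpow_le hNt hm hε'0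
  obtain ⟨R, hR⟩ := htail (ENNReal.ofReal κ) (ENNReal.ofReal_pos.2 hκ0)
  obtain ⟨D, hDt, hD⟩ := exists_fockNorm_toeplitz_restrict_ball_le hw hα hq (hfin R)
  obtain ⟨δ, hδ0, hδ⟩ := exists_pos_mul_rpow_le hDt hm hε'0
  obtain ⟨C, hC⟩ := exists_enorm_le_mul_fockNorm (p := p) hw hα hp (R + 1)
  have happrox := exists_finite_approx (S := Subtype.val '' S) (R := R) (B := C * M)
    (by rintro _ ⟨f, hf, rfl⟩; exact f.2.1)
    (by
      rintro _ ⟨f, hf, rfl⟩ z hz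
      have h1 := (hC f.1 f.2.1 z hz).trans (mul_le_mul' le_rfl (hM f hf))
      rw [← ENNReal.coe_mul, enorm_le_coe] at h1
      exact_mod_cast h1) hδ0
  obtain ⟨s, hsS, hsf, hs⟩ : ∃ s ⊆ S, s.Finite ∧ ∀ f ∈ S, ∃ g ∈ s,
      ∀ z ∈ Metric.closedBall (0 : Cn n) R, ‖f.1 z - g.1 z‖ ≤ δ := by
    obtain ⟨s, hsS, hsf, hs⟩ := Set.exists_subset_image_finite_and.1 happrox
    refine ⟨s, hsS, hsf, fun f hf => ?_⟩
    obtain ⟨_, ⟨g, hg, rfl⟩, h⟩ := hs f.1 ⟨f, hf, rfl⟩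
    exact ⟨g, hg, h⟩
  refine ⟨(fun f : Fock n p α w => Fock.ofMem (toeplitz α μ f.1) (hmaps f).2) '' s,
    hsf.image _, ?_⟩
  rintro u ⟨f, hf, hu⟩
  obtain ⟨g, hg, hfg⟩ := hs f hf
  refine Set.mem_iUnion₂.2 ⟨_, ⟨g, hg, rfl⟩, ?_⟩
  have key : fockNorm q α w (u.1 - toeplitz α μ g.1) ^ min 1 q < ε := by
    rw [hu]
    refine (fockNorm_toeplitz_sub_rpow_le hw hα hp hq hμ hR hD f.2 g.2
      (δ := ENNReal.ofReal δ) (fun z hz => ?_)).trans_lt ?_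
    · rw [← ofReal_norm]
      exact ENNReal.ofReal_le_ofReal (hfg z (Metric.ball_subset_closedBall hz))
    · have h2 : (ENNReal.ofReal κ * fockNorm p α w (f.1 - g.1)) ^ min 1 q ≤ ε' :=
        (ENNReal.rpow_le_rpow (mul_le_mul' le_rfl (hfgN f hf g (hsS hg))) hm.le).trans hκ
      calc _ ≤ ε' + ε' := add_le_add hδ h2
        _ < ε / 2 + ε / 2 := ENNReal.add_lt_add hε' hε'
        _ = ε := ENNReal.add_halves ε
  exact key

end

/-! ### The symbol `H_μ` and its tails -/

/-- The function is lower semicontinuous: slightly smaller concentric balls nearly exhaust the mass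
and stay inside the balls with nearby centres. No finiteness of `μ` is required. -/
theorem measurable_measure_ball (μ : Measure (Cn n)) (r : ℝ) :
    Measurable fun z => μ (Metric.ball z r) := by
  refine LowerSemicontinuous.measurable fun z a ha => ?_
  obtain ⟨u, hu, -, hlim⟩ := exists_seq_strictMono_tendsto r
  have hU : ⋃ k, Metric.ball z (u k) = Metric.ball z r := by
    ext y
    simp only [Set.mem_iUnion, Metric.mem_ball]
    refine ⟨fun ⟨k, hk⟩ => hk.trans_le (hu.monotone.ge_of_tendsto hlim k), fun hy => ?_⟩
    exact (hlim.eventually_const_lt hy).exists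
  have hmono : Monotone fun k => Metric.ball z (u k) :=
    fun i j hij => Metric.ball_subset_ball (hu.monotone hij)
  change a < μ (Metric.ball z r) at ha
  rw [← hU, hmono.measure_iUnion, lt_iSup_iff] at ha
  obtain ⟨k, hk⟩ := ha
  have hkr : u k < r := (hu k.lt_succ_self).trans_le (hu.monotone.ge_of_tendsto hlim _)
  filter_upwards [Metric.ball_mem_nhds z (sub_pos.2 hkr)] with y hy
  refine hk.trans_le (measure_mono (Metric.ball_subset_ball' ?_))
  rw [Metric.mem_ball, dist_comm] at hy
  linarith

theorem exists_le_of_tendsto_cocompact {φ : Cn n → ℝ≥0∞}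
    (h : Tendsto φ (cocompact (Cn n)) (𝓝 0)) {ε : ℝ≥0∞} (hε : 0 < ε) :
    ∃ R : ℝ, ∀ z : Cn n, R ≤ ‖z‖ → φ z ≤ ε := by
  have h1 := ENNReal.tendsto_nhds_zero.1 h ε hε
  rw [← Metric.cobounded_eq_cocompact, ← comap_norm_atTop, eventually_comap] at h1
  obtain ⟨R, hR⟩ := eventually_atTop.1 h1
  exact ⟨R, fun z hz => hR _ hz z rfl⟩

theorem GaussOpBound.mono {p q α : ℝ} {ν μ : Measure (Cn n)} {K K' : ℝ≥0∞}
    (h : GaussOpBound p q α ν μ K) (hK : K ≤ K') : GaussOpBound p q α ν μ K' :=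
  fun f hf => (h f hf).trans (mul_le_mul' hK le_rfl)

section

variable {w : Cn n → ℝ} {μ : Measure (Cn n)} {α p q : ℝ}

theorem H_eq (p q : ℝ) (w : Cn n → ℝ) (μ : Measure (Cn n)) :
    H p q w μ = fun z => μ (Metric.ball z 1) *
      weightMeasure w (Metric.ball z 1) ^ (1 / q - 1 / p) := by
  ext z
  rw [H, div_eq_mul_inv, ← ENNReal.rpow_neg, neg_sub, weightMeasure_apply w measurableSet_ball]

theorem measurable_H (p q : ℝ) (w : Cn n → ℝ) (μ : Measure (Cn n)) : Measurable (H p q w μ) := by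
  rw [H_eq]
  exact (measurable_measure_ball μ 1).mul ((measurable_measure_ball _ 1).pow_const _)

theorem exists_cell_bound_of_H_le {M : ℝ≥0∞} (hM : M ≠ ∞) (h : ∀ z, H p q w μ z ≤ M) :
    ∃ M : ℝ≥0, ∀ k : net n, μ (Metric.closedBall (k : Cn n) (1 / 2)) *
      weightMeasure w (Metric.ball (k : Cn n) 1) ^ (1 / q - 1 / p) ≤ M := by
  refine ⟨M.toNNReal, fun k => ?_⟩
  rw [ENNReal.coe_toNNReal hM]
  refine le_trans ?_ (h k)
  rw [H_eq]
  exact mul_le_mul' (measure_mono (Metric.closedBall_subset_ball (by norm_num))) le_rfl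

/-- Points where `H_μ` is finite are dense, and the unit ball about such a point contains a
neighbourhood of every point within `1/2` of it. For `p > q` this yields the local finiteness that
has to be assumed in the case `p ≤ q`. -/
theorem measure_ball_ne_top_of_ae_H_lt_top (hν : ExpDoubling (weightMeasure w))
    (h : ∀ᵐ z, H p q w μ z < ∞) (R : ℝ) : μ (Metric.ball 0 R) ≠ ∞ := by
  have : IsLocallyFiniteMeasure μ := by
    refine ⟨fun z => ?_⟩
    obtain ⟨y, hy, hyz⟩ := (Measure.dense_of_ae h).exists_dist_lt z (ε := 1 / 2) (by norm_num)
    refine ⟨Metric.ball z (1 / 2), Metric.ball_mem_nhds z (by norm_num), ?_⟩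
    refine (measure_mono (Metric.ball_subset_ball' (ε₂ := 1) (y := y) (by linarith))).trans_lt ?_
    by_contra hc
    have hy' : H p q w μ y < ∞ := hy
    simp [H_eq, not_lt_top_iff.1 hc, ENNReal.top_mul (hν.rpow_ne_zero _ y)] at hy'
  exact ((measure_mono Metric.ball_subset_closedBall).trans_lt
    (isCompact_closedBall (0 : Cn n) R).measure_lt_top).ne

/-- The limit controls `H_μ` only outside a ball; inside it, finiteness of `μ` on compact sets and
local comparability of the weight give the bound. -/
theorem iSup_H_lt_top_of_tendsto (hν : ExpDoubling (weightMeasure w))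
    (hμ : ∀ K : Set (Cn n), IsCompact K → μ K < ∞)
    (h : Tendsto (H p q w μ) (cocompact (Cn n)) (𝓝 0)) : ⨆ z, H p q w μ z < ∞ := by
  obtain ⟨R, hR⟩ := exists_le_of_tendsto_cocompact h one_pos
  obtain ⟨K, hK⟩ := hν.rpow_le_of_dist_le (1 / q - 1 / p) R
  have hb := hμ _ (isCompact_closedBall (0 : Cn n) (R + 1))
  set A := μ (Metric.closedBall (0 : Cn n) (R + 1)) *
    (K * weightMeasure w (Metric.ball (0 : Cn n) 1) ^ (1 / q - 1 / p)) with hA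
  have hAt : A < ∞ := by
    have := hν.rpow_ne_top (1 / q - 1 / p) (0 : Cn n)
    finiteness
  refine (iSup_le fun z => ?_).trans_lt (max_lt ENNReal.one_lt_top hAt)
  rcases le_total R ‖z‖ with hz | hz
  · exact (hR z hz).trans (le_max_left _ _)
  · refine le_trans ?_ (le_max_right _ _)
    rw [H_eq]
    refine mul_le_mul' (measure_mono (Metric.ball_subset_closedBall.trans
      (Metric.closedBall_subset_closedBall' ?_))) (hK z 0 (by simpa using hz))
    rw [dist_zero_right]
    linarith

/-- Unit balls centred inside `B_R(0)` do not meet the complement of `B_{R+1}(0)`, so removing the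
inner part of `μ` removes the symbol there. -/
theorem H_restrict_compl_ball_le (p q R : ℝ) (w : Cn n → ℝ) (μ : Measure (Cn n)) (z : Cn n) :
    H p q w (μ.restrict (Metric.ball 0 (R + 1))ᶜ) z ≤
      (Metric.ball (0 : Cn n) R)ᶜ.indicator (H p q w μ) z := by
  by_cases hz : z ∈ (Metric.ball (0 : Cn n) R)ᶜ
  · rw [Set.indicator_of_mem hz]
    exact ENNReal.div_le_div_right (Measure.restrict_le_self _) _
  · rw [Set.indicator_of_notMem hz, H, Measure.restrict_apply measurableSet_ball]
    have hzR : ‖z‖ < R := by simpa using hz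
    have hE : Metric.ball z 1 ∩ (Metric.ball (0 : Cn n) (R + 1))ᶜ = ∅ := by
      rw [← Set.sdiff_eq, Set.sdiff_eq_empty]
      refine Metric.ball_subset_ball' ?_
      rw [dist_zero_right]
      linarith
    simp [hE]

theorem exists_gaussOpBound_tail_of_tendsto (hw : RestrictedAInfty w) (hα : 0 < α) (hp : 0 < p)
    (hpq : p ≤ q) (h : Tendsto (H p q w μ) (cocompact (Cn n)) (𝓝 0)) {ε : ℝ≥0∞} (hε : 0 < ε) :
    ∃ R : ℝ, GaussOpBound p q α (weightMeasure w) (μ.restrict (Metric.ball 0 R)ᶜ) ε := by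
  obtain ⟨C, hC⟩ := exists_gaussOpBound_of_le (hw.hasLocalBound hα hp) hw.expDoubling hα hp hpq
  have hη : 0 < ε / (C + 1) := ENNReal.div_pos hε.ne' (by finiteness)
  obtain ⟨R, hR⟩ := exists_le_of_tendsto_cocompact h hη
  refine ⟨R + 1, (hC _).mono ?_⟩
  have h1 : ∀ z : Cn n, H p q w (μ.restrict (Metric.ball 0 (R + 1))ᶜ) z ≤ ε / (C + 1) := by
    intro z
    refine (H_restrict_compl_ball_le p q R w μ z).trans (Set.indicator_apply_le' (fun hz => ?_)
      fun _ => zero_le)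
    exact hR z (by simpa using hz)
  rw [H_eq] at h1
  calc _ ≤ ((C : ℝ≥0∞) + 1) * (ε / (C + 1)) := mul_le_mul' le_self_add (iSup_le h1)
    _ ≤ ε := ENNReal.mul_div_le

theorem exists_gaussOpBound_tail_of_lintegral (hw : RestrictedAInfty w) (hα : 0 < α) (hq : 0 < q)
    (hpq : q < p) (h : ∫⁻ z, H p q w μ z ^ (p * q / (p - q)) < ∞) {ε : ℝ≥0∞} (hε : 0 < ε) :
    ∃ R : ℝ, GaussOpBound p q α (weightMeasure w) (μ.restrict (Metric.ball 0 R)ᶜ) ε := by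
  have hp : 0 < p := hq.trans hpq
  obtain ⟨C, hC⟩ := exists_gaussOpBound_of_lt (hw.hasLocalBound hα hp) hw.expDoubling hα hq hpq
  have hr : 0 < p * q / (p - q) := div_pos (mul_pos hp hq) (sub_pos.2 hpq)
  set r := p * q / (p - q) with hr'
  have hlim : Tendsto (fun k : ℕ => (C : ℝ≥0∞) *
      (∫⁻ z in (Metric.ball (0 : Cn n) k)ᶜ, H p q w μ z ^ r) ^ (1 / r)) atTop (𝓝 0) := by
    have h1 : Continuous fun x : ℝ≥0∞ => (C : ℝ≥0∞) * x ^ (1 / r) :=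
      (ENNReal.continuous_const_mul ENNReal.coe_ne_top).comp ENNReal.continuous_rpow_const
    have h2 := (h1.tendsto 0).comp (tendsto_setLIntegral_compl_ball h)
    simpa [hr, Function.comp_def] using h2
  obtain ⟨k, hk⟩ := (ENNReal.tendsto_nhds_zero.1 hlim ε hε).exists
  have h1 := hC (μ.restrict (Metric.ball 0 ((k : ℝ) + 1))ᶜ)
  have hHm := measurable_H p q w (μ.restrict (Metric.ball 0 ((k : ℝ) + 1))ᶜ)
  rw [H_eq] at hHm
  refine ⟨k + 1, (h1 hHm).mono (le_trans ?_ hk)⟩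
  refine mul_le_mul' le_rfl (ENNReal.rpow_le_rpow ?_ (by positivity))
  rw [← lintegral_indicator measurableSet_ball.compl]
  refine lintegral_mono fun z => ?_
  have h2 := H_restrict_compl_ball_le p q k w μ z
  rw [H_eq] at h2
  refine (ENNReal.rpow_le_rpow h2 hr.le).trans_eq ?_
  by_cases hz : z ∈ (Metric.ball (0 : Cn n) (k : ℝ))ᶜ
  · rw [Set.indicator_of_mem hz, Set.indicator_of_mem hz]
  · rw [Set.indicator_of_notMem hz, Set.indicator_of_notMem hz, ENNReal.zero_rpow_of_pos hr]

end

/-! ### Assembling the two ranges of exponents -/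

section

variable {w : Cn n → ℝ} {α p q : ℝ}

theorem eLpNorm_H (w : Cn n → ℝ) (μ : Measure (Cn n)) {r : ℝ} (hr : 0 < r) :
    eLpNorm (H p q w μ) (ENNReal.ofReal r) volume = (∫⁻ z, H p q w μ z ^ r) ^ (1 / r) := by
  rw [eLpNorm_eq_lintegral_rpow_enorm_toReal (by simpa using hr) ENNReal.ofReal_ne_top,
    ENNReal.toReal_ofReal hr.le]
  simp

theorem exists_toeplitz_bounds_of_le (hw : RestrictedAInfty w) (hα : 0 < α) (hp : 0 < p)
    (hpq : p ≤ q) : ∃ C : ℝ≥0, 0 < C ∧ ∀ μ : Measure (Cn n),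
      (ToeplitzBounded p q α w μ → ⨆ z, H p q w μ z ≤ C * toeplitzNorm p q α w μ) ∧
      (⨆ z, H p q w μ z < ∞ → ToeplitzBounded p q α w μ ∧
        toeplitzNorm p q α w μ ≤ C * ⨆ z, H p q w μ z) := by
  have hq : 0 < q := hp.trans_le hpq
  obtain ⟨C, hC⟩ := exists_gaussOpBound_of_le (hw.hasLocalBound hα hp) hw.expDoubling hα hp hpq
  obtain ⟨D, hD⟩ := measure_ball_mul_le_toeplitzNorm hw hα hp hq
  refine ⟨C + D + 1, by positivity, fun μ => ⟨fun hT => iSup_le fun z => ?_, fun hH => ?_⟩⟩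
  · rw [H_eq]
    refine (hD μ hT.1 z).trans (mul_le_mul' ?_ le_rfl)
    exact_mod_cast le_add_right le_add_self
  · have hK : GaussOpBound p q α (weightMeasure w) μ (C * ⨆ z, H p q w μ z) := by
      rw [H_eq]
      exact hC μ
    obtain ⟨h1, h2⟩ := toeplitzBounded_of_gaussOpBound hw hα hp hq
      (exists_cell_bound_of_H_le hH.ne (le_iSup _))
      (ENNReal.mul_ne_top ENNReal.coe_ne_top hH.ne) hK
    refine ⟨h1, h2.trans (mul_le_mul' ?_ le_rfl)⟩
    exact_mod_cast le_add_right le_self_add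

theorem toeplitzCompact_iff_tendsto_of_le [Fact (0 < q)] (hw : RestrictedAInfty w) (hα : 0 < α)
    (hp : 0 < p) (hpq : p ≤ q) {μ : Measure (Cn n)}
    (hμ : ∀ K : Set (Cn n), IsCompact K → μ K < ∞) :
    ToeplitzCompact p q α w μ ↔ Tendsto (H p q w μ) (cocompact (Cn n)) (𝓝 0) := by
  refine ⟨fun hT => ?_, fun h => ?_⟩
  · rw [H_eq]
    exact hT.tendsto_symbol hw hα hp
  obtain ⟨C, -, hC⟩ := exists_toeplitz_bounds_of_le hw hα hp hpq
  have hH := iSup_H_lt_top_of_tendsto hw.expDoubling hμ h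
  exact toeplitzCompact_of_tail hw hα hp ((hC μ).2 hH).1.1
    (exists_cell_bound_of_H_le hH.ne (le_iSup _))
    (fun R => ((measure_mono Metric.ball_subset_closedBall).trans_lt
      (hμ _ (isCompact_closedBall (0 : Cn n) R))).ne)
    (fun ε hε => exists_gaussOpBound_tail_of_tendsto hw hα hp hpq h hε)

theorem exists_toeplitz_bounds_of_lt [Fact (0 < q)] (hw : RestrictedAInfty w) (hα : 0 < α)
    (hpq : q < p) : ∃ C : ℝ≥0, 0 < C ∧ ∀ μ : Measure (Cn n),
      (ToeplitzBounded p q α w μ → (∫⁻ z, H p q w μ z ^ (p * q / (p - q))) ^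
        (1 / (p * q / (p - q))) ≤ C * toeplitzNorm p q α w μ) ∧
      (∫⁻ z, H p q w μ z ^ (p * q / (p - q)) < ∞ → ToeplitzCompact p q α w μ ∧
        toeplitzNorm p q α w μ ≤ C * (∫⁻ z, H p q w μ z ^ (p * q / (p - q))) ^
          (1 / (p * q / (p - q)))) := by
  have hq : 0 < q := Fact.out
  have hp : 0 < p := hq.trans hpq
  have hν := hw.expDoubling
  have hr : 0 < p * q / (p - q) := div_pos (mul_pos hp hq) (sub_pos.2 hpq)
  obtain ⟨C, hC⟩ := exists_gaussOpBound_of_lt (hw.hasLocalBound hα hp) hν hα hq hpq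
  obtain ⟨D, hD⟩ := exists_tsum_rpow_le hw hα hq hpq
  obtain ⟨E, hE⟩ := hν.lintegral_rpow_le_tsum (1 / q - 1 / p) hr
  obtain ⟨F, hF⟩ := tsum_net_rpow_le_lintegral hν (1 / q - 1 / p) hr
  set r := p * q / (p - q)
  refine ⟨C + E ^ (1 / r) * D + 1, by positivity, fun μ => ?_⟩
  have hHm := measurable_H p q w μ
  refine ⟨fun hT => ?_, fun hH => ?_⟩
  · have h1 := hD μ _ hT.1
      (fun f => fockNorm_toeplitz_le_toeplitzNorm_mul hw hα hp hq hT.1 f)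
    rw [H_eq]
    calc _ ≤ _ := ENNReal.rpow_le_rpow (hE μ) (by positivity)
      _ ≤ (E : ℝ≥0∞) ^ (1 / r) * (D * toeplitzNorm p q α w μ) := by
        rw [ENNReal.mul_rpow_of_nonneg _ _ (by positivity)]
        exact mul_le_mul' le_rfl h1
      _ = ((E ^ (1 / r) * D : ℝ≥0) : ℝ≥0∞) * toeplitzNorm p q α w μ := by
        rw [ENNReal.coe_mul, ENNReal.coe_rpow_of_nonneg _ (by positivity), mul_assoc]
      _ ≤ _ := by
        refine mul_le_mul' ?_ le_rfl
        exact_mod_cast le_add_right le_add_self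
  -- A single term of the lattice sum is at most the whole sum, which the integral of the symbol
  -- bounds.
  · have hcell : ∃ M : ℝ≥0, ∀ k : net n, μ (Metric.closedBall (k : Cn n) (1 / 2)) *
        weightMeasure w (Metric.ball (k : Cn n) 1) ^ (1 / q - 1 / p) ≤ M := by
      rw [H_eq] at hHm hH
      have hne : (F * ∫⁻ z, (μ (Metric.ball z 1) *
          weightMeasure w (Metric.ball z 1) ^ (1 / q - 1 / p)) ^ r) ^ r⁻¹ ≠ ∞ :=
        ENNReal.rpow_ne_top_of_nonneg (by positivity)
          (ENNReal.mul_ne_top ENNReal.coe_ne_top hH.ne)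
      obtain ⟨M, hM⟩ := WithTop.ne_top_iff_exists.1 hne
      refine ⟨M, fun k => ?_⟩
      refine le_trans ?_ hM.ge
      rw [ENNReal.le_rpow_inv_iff hr]
      exact (ENNReal.le_tsum k).trans (hF μ hHm)
    have hK : GaussOpBound p q α (weightMeasure w) μ
        (C * (∫⁻ z, H p q w μ z ^ r) ^ (1 / r)) := by
      rw [H_eq] at hHm ⊢
      exact hC μ hHm
    have hKt : C * (∫⁻ z, H p q w μ z ^ r) ^ (1 / r) ≠ ∞ := ENNReal.mul_ne_top
      ENNReal.coe_ne_top (ENNReal.rpow_ne_top_of_nonneg (by positivity) hH.ne)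
    obtain ⟨h1, h2⟩ := toeplitzBounded_of_gaussOpBound hw hα hp hq hcell hKt hK
    have hae : ∀ᵐ z, H p q w μ z < ∞ := by
      filter_upwards [ae_lt_top (hHm.pow_const r) hH.ne] with z hz
      exact (ENNReal.rpow_lt_top_iff_of_pos hr).1 hz
    refine ⟨toeplitzCompact_of_tail hw hα hp h1.1 hcell
      (measure_ball_ne_top_of_ae_H_lt_top hν hae)
      (fun ε hε => exists_gaussOpBound_tail_of_lintegral hw hα hq hpq hH hε),
      h2.trans (mul_le_mul' ?_ le_rfl)⟩
    exact_mod_cast le_add_right le_self_add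

end

end WeightedFock

open WeightedFock in
theorem theorem1p2 (n : ℕ) (hn : 1 ≤ n) (p q α : ℝ) [Fact (0 < p)] [Fact (0 < q)] (hα : 0 < α)
    (w : Cn n → ℝ) (hw : RestrictedAInfty w) :
    (p ≤ q → ∃ C : ℝ≥0, 0 < C ∧ ∀ μ : Measure (Cn n),
      (ToeplitzBounded p q α w μ ↔ (⨆ z, H p q w μ z) < ∞) ∧
      (ToeplitzBounded p q α w μ →
        toeplitzNorm p q α w μ ≤ C * (⨆ z, H p q w μ z) ∧
        (⨆ z, H p q w μ z) ≤ C * toeplitzNorm p q α w μ) ∧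
      ((∀ K : Set (Cn n), IsCompact K → μ K < ∞) →
        (ToeplitzCompact p q α w μ ↔ Tendsto (H p q w μ) (cocompact (Cn n)) (𝓝 0)))) ∧
    (q < p → ∃ C : ℝ≥0, 0 < C ∧ ∀ μ : Measure (Cn n),
      List.TFAE [ToeplitzBounded p q α w μ, ToeplitzCompact p q α w μ,
        MemLp (H p q w μ) (ENNReal.ofReal (p * q / (p - q))) volume] ∧
      (ToeplitzBounded p q α w μ →
        toeplitzNorm p q α w μ ≤
          C * eLpNorm (H p q w μ) (ENNReal.ofReal (p * q / (p - q))) volume ∧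
        eLpNorm (H p q w μ) (ENNReal.ofReal (p * q / (p - q))) volume ≤
          C * toeplitzNorm p q α w μ)) := by
  have hp : 0 < p := Fact.out
  have hq : 0 < q := Fact.out
  refine ⟨fun hpq => ?_, fun hpq => ?_⟩
  · obtain ⟨C, hC0, hC⟩ := exists_toeplitz_bounds_of_le hw hα hp hpq
    have hbdd : ∀ μ : Measure (Cn n), ToeplitzBounded p q α w μ → ⨆ z, H p q w μ z < ∞ :=
      fun μ hT => ((hC μ).1 hT).trans_lt (ENNReal.mul_lt_top ENNReal.coe_lt_top
        hT.toeplitzNorm_lt_top)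
    exact ⟨C, hC0, fun μ => ⟨⟨hbdd μ, fun h => ((hC μ).2 h).1⟩,
      fun hT => ⟨((hC μ).2 (hbdd μ hT)).2, (hC μ).1 hT⟩,
      fun hμ => toeplitzCompact_iff_tendsto_of_le hw hα hp hpq hμ⟩⟩
  · obtain ⟨C, hC0, hC⟩ := exists_toeplitz_bounds_of_lt hw hα hpq
    have hr : 0 < p * q / (p - q) := div_pos (mul_pos hp hq) (sub_pos.2 hpq)
    have hbdd : ∀ μ : Measure (Cn n), ToeplitzBounded p q α w μ →
        ∫⁻ z, H p q w μ z ^ (p * q / (p - q)) < ∞ := fun μ hT => by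
      rw [← ENNReal.rpow_lt_top_iff_of_pos (one_div_pos.2 hr)]
      exact ((hC μ).1 hT).trans_lt (ENNReal.mul_lt_top ENNReal.coe_lt_top hT.toeplitzNorm_lt_top)
    refine ⟨C, hC0, fun μ => ⟨?_, fun hT => ?_⟩⟩
    -- The cycle passes from boundedness to integrability by randomised testing, from there to
    -- compactness by small tails, and back by a finite cover.
    · tfae_have 1 → 3 := fun hT => ⟨(measurable_H p q w μ).aestronglyMeasurable, by
        rw [eLpNorm_H w μ hr, ENNReal.rpow_lt_top_iff_of_pos (one_div_pos.2 hr)]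
        exact hbdd μ hT⟩
      tfae_have 3 → 2 := fun h => ((hC μ).2 (by
        have h1 := h.2
        rwa [eLpNorm_H w μ hr, ENNReal.rpow_lt_top_iff_of_pos (one_div_pos.2 hr)] at h1)).1
      tfae_have 2 → 1 := fun hT => hT.toeplitzBounded hw hα hp
      tfae_finish
    · rw [eLpNorm_H w μ hr]
      exact ⟨((hC μ).2 (hbdd μ hT)).2, (hC μ).1 hT⟩
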